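/- Let $j_1,j_2\in\{0,\tfrac12,1,\dots\}$ and $h\in\mathbb C$. For a spin $j$ let $V^{(j)}$ be the $(2j+1)$-dimensional space with basis $e^j_m$ ($m=-j,-j+1,\dots,j$) and operators $He^j_m=2m\,e^j_m$, $Z_\pm e^j_m=\sqrt{(j\mp m)(j\pm m+1)}\,e^j_{m\pm1}$. The Jordanian quantum algebra $\mathcal U_h(\mathrm{sl}(2))$, with generators $H,X,Y$, acts on $V^{(j)}$ by this $H$ and by the $X,Y$ determined by $Z_+=\frac2h\tanh\frac{hX}2$, i.e. $X=\sum_{k\ge0}\frac{(h/2)^{2k}}{2k+1}Z_+^{2k+1}$, and $Z_-=(\cosh\frac{hX}2)\,Y\,(\cosh\frac{hX}2)$. It acts on $V^{(j_1)}\otimes V^{(j_2)}$ through $\Delta(H)=H\otimes e^{hX}+e^{-hX}\otimes H$, $\Delta(X)=X\otimes1+1\otimes X$, $\Delta(Y)=Y\otimes e^{hX}+e^{-hX}\otimes Y$. With the Pochhammer symbol $(x)_n=x(x+1)\cdots(x+n-1)$, put $$b^{m_1,m_2}_{k,l}=\frac{(-2m_1-k)_l\,(-2m_2-l)_k}{k!\,l!}\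 \ (k,l\ge0),\qquad b^{m_1,m_2}_{k,l}=0\ \text{ otherwise},$$ $$a^{m_1,m_2}_{k,l}=(-1)^k(h/2)^{k+l}\bigl(b^{m_1,m_2}_{k,l}-b^{m_1,m_2}_{k-1,l-1}\bigr),\qquad \alpha_{j,m}=\sqrt{(j+m)!/(j-m)!}.$$ For $j\in\{|j_1-j_2|,|j_1-j_2|+1,\dots,j_1+j_2\}$ define $$\mathcal C^{j_1,j_2,j}_{n_1,n_2,m}(h)=\sum_{m_1+m_2=m}C^{j_1,j_2,j}_{m_1,m_2,m}\;a^{m_1,m_2}_{n_1-m_1,\,n_2-m_2}\;\frac{\alpha_{j_1,n_1}\alpha_{j_2,n_2}}{\alpha_{j_1,m_1}\alpha_{j_2,m_2}},$$ where $C^{j_1,j_2,j}_{m_1,m_2,m}$ are the usual $\mathrm{su}(2)$ Clebsch–Gordan coefficients (Condon–Shortley convention). These are the Clebsch–Gordan coefficients of $\mathcal U_h(\mathrm{sl}(2))$: for each such $j$ the vectors $e^{(j_1j_2)j}_m=\sum_{n_1,n_2}\mathcal C^{j_1,j_2,j}_{n_1,n_2,m}(h)\,e^{j_1}_{n_1}\otimes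 e^{j_2}_{n_2}$ transform under $\Delta(H),\Delta(X),\Delta(Y)$ exactly as the vectors $e^j_m$ of $V^{(j)}$ transform under $H,X,Y$. They satisfy the two skew-orthogonality relations $$\sum_{n_1,n_2}(-1)^{j_1+j_2-j}\,\mathcal C^{j_1,j_2,j}_{n_1,n_2,m}(h)\,\mathcal C^{j_1,j_2,j'}_{-n_1,-n_2,-m'}(h)=\delta_{j,j'}\delta_{m,m'},$$ $$\sum_{j,m}(-1)^{j_1+j_2-j}\,\mathcal C^{j_1,j_2,j}_{n_1,n_2,m}(h)\,\mathcal C^{j_1,j_2,j}_{-n_1',-n_2',-m}(h)=\delta_{n_1,n_1'}\delta_{n_2,n_2'},$$ for all admissible indices, where in the second sum $j=|j_1-j_2|,\dots,j_1+j_2$ and $m=-j,\dots,j$. Consequently the Clebsch–Gordan matrix with entry $\mathcal C^{j_1,j_2,j}_{n_1,n_2,m}(h)$ in row $(j,m)$ and column $(n_1,n_2)$ is invertible, and its two-sided inverse has entry $(-1)^{j_1+j_2-j}\,\mathcal C^{j_1,j_2,j}_{-n_1,-n_2,-m}(h)$ in row $(n_1,n_2)$ and column $(j,m)$. -/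

import Mathlib

noncomputable section

namespace Jordanian

/-! Spins are encoded by their doubles: `J : ℕ` stands for the spin `j = J / 2`, and
`i : Fin (J + 1)` stands for the magnetic quantum number `m = i - J / 2`, so that
`j + m = i` and `j - m = J - i`.  The number `-m` is then encoded by `i.rev`. -/

/-- The magnetic quantum number `m = i - J / 2`. -/
def mag {J : ℕ} (i : Fin (J + 1)) : ℚ := (i : ℚ) - (J : ℚ) / 2

/-! ### The representation of `U_h(sl(2))` on `V^(j)`, as matrices in the basis `e^j_m` -/

/-- `H e_m = 2 m e_m`. -/
def opH (J : ℕ) : Matrix (Fin (J + 1)) (Fin (J + 1)) ℂ :=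
  Matrix.diagonal fun i => ((2 * mag i : ℚ) : ℂ)

/-- `Z_+ e_m = √((j - m) (j + m + 1)) e_{m+1}`. -/
def opZp (J : ℕ) : Matrix (Fin (J + 1)) (Fin (J + 1)) ℂ :=
  Matrix.of fun a i =>
    if (a : ℕ) = (i : ℕ) + 1 then ((Real.sqrt (((J : ℝ) - (i : ℝ)) * ((i : ℝ) + 1)) : ℝ) : ℂ)
    else 0

/-- `Z_- e_m = √((j + m) (j - m + 1)) e_{m-1}`. -/
def opZm (J : ℕ) : Matrix (Fin (J + 1)) (Fin (J + 1)) ℂ :=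
  Matrix.of fun a i =>
    if (a : ℕ) + 1 = (i : ℕ) then ((Real.sqrt ((i : ℝ) * ((J : ℝ) - (i : ℝ) + 1)) : ℝ) : ℂ)
    else 0

/-- `X`, the solution of `Z_+ = (2 / h) tanh (h X / 2)`, that is
`X = (2 / h) artanh (h Z_+ / 2) = ∑ₖ (h / 2)^(2k) / (2k + 1) Z_+^(2k + 1)`; the series is finite
because `Z_+ ^ (J + 1) = 0`. -/
def opX (h : ℂ) (J : ℕ) : Matrix (Fin (J + 1)) (Fin (J + 1)) ℂ :=
  ∑ k ∈ Finset.range (J + 1), ((h / 2) ^ (2 * k) / (2 * (k : ℂ) + 1)) • opZp J ^ (2 * k + 1)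

/-- `exp (c X)`. -/
def expX (h : ℂ) (J : ℕ) (c : ℂ) : Matrix (Fin (J + 1)) (Fin (J + 1)) ℂ :=
  NormedSpace.exp (c • opX h J)

/-- `cosh (h X / 2)`. -/
def coshX (h : ℂ) (J : ℕ) : Matrix (Fin (J + 1)) (Fin (J + 1)) ℂ :=
  (1 / 2 : ℂ) • (expX h J (h / 2) + expX h J (-(h / 2)))

/-- `Y`, the solution of `Z_- = cosh (h X / 2) Y cosh (h X / 2)` (the matrix `cosh (h X / 2)` is
unipotent, hence invertible). -/
def opY (h : ℂ) (J : ℕ) : Matrix (Fin (J + 1)) (Fin (J + 1)) ℂ :=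
  (coshX h J)⁻¹ * opZm J * (coshX h J)⁻¹

/-! ### The action on `V^(j₁) ⊗ V^(j₂)` through the comultiplication -/

open scoped Kronecker in
/-- `Δ(H) = H ⊗ e^{hX} + e^{-hX} ⊗ H`. -/
def deltaH (h : ℂ) (J₁ J₂ : ℕ) :
    Matrix (Fin (J₁ + 1) × Fin (J₂ + 1)) (Fin (J₁ + 1) × Fin (J₂ + 1)) ℂ :=
  opH J₁ ⊗ₖ expX h J₂ h + expX h J₁ (-h) ⊗ₖ opH J₂

open scoped Kronecker in
/-- `Δ(X) = X ⊗ 1 + 1 ⊗ X`. -/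
def deltaX (h : ℂ) (J₁ J₂ : ℕ) :
    Matrix (Fin (J₁ + 1) × Fin (J₂ + 1)) (Fin (J₁ + 1) × Fin (J₂ + 1)) ℂ :=
  opX h J₁ ⊗ₖ 1 + 1 ⊗ₖ opX h J₂

open scoped Kronecker in
/-- `Δ(Y) = Y ⊗ e^{hX} + e^{-hX} ⊗ Y`. -/
def deltaY (h : ℂ) (J₁ J₂ : ℕ) :
    Matrix (Fin (J₁ + 1) × Fin (J₂ + 1)) (Fin (J₁ + 1) × Fin (J₂ + 1)) ℂ :=
  opY h J₁ ⊗ₖ expX h J₂ h + expX h J₁ (-h) ⊗ₖ opY h J₂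

/-- The vectors `e_m = ∑_{n₁,n₂} W_{(n₁,n₂),m} e^{j₁}_{n₁} ⊗ e^{j₂}_{n₂}` of `V^(j₁) ⊗ V^(j₂)`
transform under the generators `H`, `X`, `Y` of `U_h(sl(2))` (acting through `Δ`) exactly as the
standard basis `e^j_m` of `V^(j)`. -/
structure IsCoupledBasis (h : ℂ) (J₁ J₂ J : ℕ)
    (W : Matrix (Fin (J₁ + 1) × Fin (J₂ + 1)) (Fin (J + 1)) ℂ) : Prop where
  actH : deltaH h J₁ J₂ * W = W * opH J
  actX : deltaX h J₁ J₂ * W = W * opX h J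
  actY : deltaY h J₁ J₂ * W = W * opY h J

/-! ### The Clebsch–Gordan coefficients -/

/-- The doubled spins `J = 2j` occurring in the tensor product:
`j = |j₁ - j₂|, |j₁ - j₂| + 1, …, j₁ + j₂`. -/
def coupledSpins (J₁ J₂ : ℕ) : Finset ℕ :=
  (Finset.Icc (Nat.dist J₁ J₂) (J₁ + J₂)).filter fun J => Even (J₁ + J₂ + J)

/-- `j₁ + j₂ - j` (a natural number for `J ∈ coupledSpins J₁ J₂`). -/
def defect (J₁ J₂ J : ℕ) : ℕ := (J₁ + J₂ - J) / 2

open scoped Nat in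
/-- The usual `su(2)` Clebsch–Gordan coefficient `C^{j₁,j₂,j}_{m₁,m₂,m}` (real, Condon–Shortley
convention), by Racah's formula. With `r = j₁ + j₂ - j` it is `δ_{m₁+m₂,m}` times
`√((2j+1) (j+j₁-j₂)! (j+j₂-j₁)! r! / (j₁+j₂+j+1)!)`, times
`√((j+m)! (j-m)! (j₁+m₁)! (j₁-m₁)! (j₂+m₂)! (j₂-m₂)!)`, times
`∑ₖ (-1)^k / (k! (r-k)! (j₁-m₁-k)! (j₂+m₂-k)! (j-j₂+m₁+k)! (j-j₁-m₂+k)!)`, the sum being over all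
`k` for which every factorial has a nonnegative argument. -/
def su2CG (J₁ J₂ J : ℕ) (i₁ : Fin (J₁ + 1)) (i₂ : Fin (J₂ + 1)) (i : Fin (J + 1)) : ℝ :=
  let r : ℕ := defect J₁ J₂ J
  if mag i₁ + mag i₂ = mag i then
    Real.sqrt ((((J + 1) * (J₁ - r)! * (J₂ - r)! * r ! : ℕ) : ℝ) / ((J₁ + J₂ - r + 1)! : ℝ)) *
    Real.sqrt (((i : ℕ)! * (J - i)! * (i₁ : ℕ)! * (J₁ - i₁)! * (i₂ : ℕ)! * (J₂ - i₂)! : ℕ) : ℝ) *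
    ∑ k ∈ (Finset.range (r + 1)).filter
        (fun k => k ≤ J₁ - i₁ ∧ k ≤ i₂ ∧ r ≤ i₁ + k ∧ r ≤ (J₂ - i₂) + k),
      (-1 : ℝ) ^ k /
        ((k ! * (r - k)! * (J₁ - i₁ - k)! * (i₂ - k)! * (i₁ + k - r)! *
          (J₂ - i₂ + k - r)! : ℕ) : ℝ)
  else 0

open scoped Nat in
/-- `b^{m₁,m₂}_{k,l} = (-2m₁-k)_l (-2m₂-l)_k / (k! l!)` for `k, l ≥ 0`, and `0` otherwise. -/
def coeffB (m₁ m₂ : ℚ) (k l : ℤ) : ℚ :=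
  if 0 ≤ k ∧ 0 ≤ l then
    (ascPochhammer ℚ l.toNat).eval (-2 * m₁ - k) * (ascPochhammer ℚ k.toNat).eval (-2 * m₂ - l) /
      ((k.toNat ! : ℚ) * (l.toNat ! : ℚ))
  else 0

/-- `a^{m₁,m₂}_{k,l} = (-1)^k (h/2)^{k+l} (b^{m₁,m₂}_{k,l} - b^{m₁,m₂}_{k-1,l-1})`. -/
def coeffA (h : ℂ) (m₁ m₂ : ℚ) (k l : ℤ) : ℂ :=
  (-1) ^ k * (h / 2) ^ (k + l) * ((coeffB m₁ m₂ k l - coeffB m₁ m₂ (k - 1) (l - 1) : ℚ) : ℂ)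

open scoped Nat in
/-- `α_{j,m} = √((j+m)! / (j-m)!)`. -/
def alpha {J : ℕ} (i : Fin (J + 1)) : ℝ := Real.sqrt (((i : ℕ)! : ℝ) / ((J - i)! : ℝ))

/-- The Clebsch–Gordan coefficient of `U_h(sl(2))`,
`𝒞^{j₁,j₂,j}_{n₁,n₂,m}(h) = ∑_{m₁+m₂=m} C^{j₁,j₂,j}_{m₁,m₂,m} A^{m₁,m₂}_{n₁-m₁,n₂-m₂}` with
`A^{m₁,m₂}_{n₁-m₁,n₂-m₂} =
  a^{m₁,m₂}_{n₁-m₁,n₂-m₂} α_{j₁,n₁} α_{j₂,n₂} / (α_{j₁,m₁} α_{j₂,m₂})`. -/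
def CG (h : ℂ) (J₁ J₂ J : ℕ) (n₁ : Fin (J₁ + 1)) (n₂ : Fin (J₂ + 1)) (m : Fin (J + 1)) : ℂ :=
  ∑ p ∈ (Finset.univ : Finset (Fin (J₁ + 1) × Fin (J₂ + 1))).filter
      (fun p => mag p.1 + mag p.2 = mag m),
    (su2CG J₁ J₂ J p.1 p.2 m : ℂ) *
      (coeffA h (mag p.1) (mag p.2) ((n₁ : ℤ) - (p.1 : ℤ)) ((n₂ : ℤ) - (p.2 : ℤ)) *
        ((alpha n₁ * alpha n₂ / (alpha p.1 * alpha p.2) : ℝ) : ℂ))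

/-- The index set of the pairs `(j, m)`. -/
abbrev CoupledIndex (J₁ J₂ : ℕ) : Type := (J : {J : ℕ // J ∈ coupledSpins J₁ J₂}) × Fin (J.1 + 1)

/-- The Clebsch–Gordan matrix, with rows `(j, m)` and columns `(n₁, n₂)`. -/
def CGMatrix (h : ℂ) (J₁ J₂ : ℕ) :
    Matrix (CoupledIndex J₁ J₂) (Fin (J₁ + 1) × Fin (J₂ + 1)) ℂ :=
  Matrix.of fun s n => CG h J₁ J₂ s.1.1 n.1 n.2 s.2

/-- The signed skew-transpose of the Clebsch–Gordan matrix: its entry in row `(n₁, n₂)` and column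
`(j, m)` is `(-1)^{j₁+j₂-j} 𝒞^{j₁,j₂,j}_{-n₁,-n₂,-m}(h)`. -/
def CGSkewTranspose (h : ℂ) (J₁ J₂ : ℕ) :
    Matrix (Fin (J₁ + 1) × Fin (J₂ + 1)) (CoupledIndex J₁ J₂) ℂ :=
  Matrix.of fun n s =>
    (-1) ^ defect J₁ J₂ s.1.1 * CG h J₁ J₂ s.1.1 n.1.rev n.2.rev s.2.rev

end Jordanian

end

/-! Put `t = h / 2`, `z₁ = Z₊ ⊗ 1`, `z₂ = 1 ⊗ Z₊`. The coefficients factor as `U C`, where `C` holds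
the `su(2)` coefficients and `U` is `twistMatrix`. The theorem rests on three facts.

`U` intertwines. Since `Z₊^k e_m` is `e_{m+k}` times a ratio of `α`'s, the column of `U` at `(m₁,
m₂)` is `F_{p,q}(z₁, z₂)` applied to `e_{m₁} ⊗ e_{m₂}`, with `p = 2m₁`, `q = 2m₂` and `F` the
generating function of the `a`'s. Pascal's rule yields `F_{p,q} = (1 + t z₁)^q (1 - t z₂)^p (1 + t²
z₁ z₂)^(-(p+q))` (`truncSum_coeffB_sub`). `H` and `Z₋` pass functions of `Z₊` like differential
operators of order one and two (`HasLogDer`); moreover `e^{hX} = (1 + t Z₊) / (1 - t Z₊)`, and the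
addition law of tanh turns the deformed `Δ(Z₊)` into `(z₁ + z₂) / (1 + t² z₁ z₂)`. Intertwining the
deformed `Δ(H)`, `Δ(Z₊)`, `Δ(Z₋)` with the undeformed ones thus reduces to rational identities in
`z₁`, `z₂`. `X` is recovered as an artanh series and `Y` by cancelling cosh, so `U` carries an
`su(2)` coupled basis to a deformed one.

`U† U = 1`, where `†` is reflection in the antidiagonal. It negates both `Δ(H)` and the undeformed
total `H`, so `Δ(H) U = U H` makes `U† U` commute with `H`. But `U† U - 1` strictly raises the
weight, and a strictly raising matrix commuting with `H` is zero (`Raises.eq_zero_of_commute`). The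
same rigidity proves the formula for `e^{hX}` and the artanh addition law: it is enough to compare
commutators with `H`.

`C` is an orthonormal coupled basis. Racah's sum satisfies the recurrence of `Z₊` by telescoping;
the reflection `k ↦ r - k` gives the sign `(-1)^(j₁+j₂-j)` under `m ↦ -m`, hence also `Z₋`. Schur's
argument makes the Gram matrix diagonal and constant on each spin, and Vandermonde's identity fixes
the norm at `m = j`.

The Clebsch–Gordan matrix is then `(U C)ᵀ` and its signed skew-transpose `(U†)ᵀ C`, whose product is
`Cᵀ (U† U)ᵀ C = 1`. The other product follows by counting dimensions. -/

namespace Jordanian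

/-! ### Commuting `H` and `Z₋` past functions of `Z₊` -/

section LogDer

variable {S R : Type*} [CommRing S] [Algebra ℂ S] [Ring R] [Algebra ℂ R]

/-- `f` behaves, with respect to the generators `H` and `Z₋` of an `sl(2)` acting on functions of
the raising operator `z`, as a function with `f' = f a` and `f'' = f b`. -/
structure HasLogDer (ι : S →ₐ[ℂ] R) (H Zm : R) (z f a b : S) : Prop where
  actH : H * ι f = ι f * (H + ι (2 * z * a))
  actZ : Zm * ι f = ι f * (Zm - ι a * H - ι (z * b))

variable {ι : S →ₐ[ℂ] R} {H Zm : R} {z f g a b a' b' : S}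

/-- Leibniz rule for `f''`; the cross term `2 a a'` appears when the `H` produced by `f` is moved
past `g`. -/
theorem HasLogDer.mul (hf : HasLogDer ι H Zm z f a b) (hg : HasLogDer ι H Zm z g a' b') :
    HasLogDer ι H Zm z (f * g) (a + a') (b + b' + 2 * a * a') := by
  have comm : ∀ x y : S, ι x * ι y = ι y * ι x := fun x y => by
    rw [← map_mul, mul_comm, map_mul]
  constructor
  · rw [map_mul, ← mul_assoc, hf.actH, mul_assoc, add_mul, hg.actH, comm _ g, ← mul_add,
      ← mul_assoc, add_assoc, ← map_add]
    congr 3; ring_nf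
  · have e1 : ι a * H * ι g = ι g * (ι a * H + ι (2 * z * a * a')) := by
      rw [mul_assoc, hg.actH, ← mul_assoc, comm a g, mul_assoc, mul_add, ← map_mul]
      congr 3; ring_nf
    rw [map_mul, ← mul_assoc, hf.actZ, mul_assoc, sub_mul, sub_mul, hg.actZ, e1, comm _ g,
      ← mul_sub, ← mul_sub, ← mul_assoc]
    congr 1
    rw [show z * (b + b' + 2 * a * a') = z * b + z * b' + 2 * z * a * a' by ring, map_add, map_add,
      map_add, add_mul]
    abel

theorem HasLogDer.inv {fi : S} (hf : HasLogDer ι H Zm z f a b) (hi : f * fi = 1) :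
    HasLogDer ι H Zm z fi (-a) (-b + 2 * a ^ 2) := by
  have comm : ∀ x y : S, ι x * ι y = ι y * ι x := fun x y => by
    rw [← map_mul, mul_comm, map_mul]
  have i1 : ι f * ι fi = 1 := by rw [← map_mul, hi, map_one]
  have i2 : ι fi * ι f = 1 := by rw [comm, i1]
  have hH : H * ι fi = ι fi * (H + ι (2 * z * -a)) := by
    have : ι f * (H * ι fi) = H - ι (2 * z * a) := by
      have e : ι f * H = H * ι f - ι f * ι (2 * z * a) := by rw [hf.actH]; noncomm_ring
      rw [← mul_assoc, e, sub_mul, mul_assoc, i1, comm, mul_assoc, i1]; simp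
    rw [← one_mul (H * ι fi), ← i2, mul_assoc, this, mul_neg, map_neg, sub_eq_add_neg]
  refine ⟨hH, ?_⟩
  have : ι f * (Zm * ι fi) = Zm - ι (-a) * H - ι (z * (-b + 2 * a ^ 2)) := by
    have e : ι f * Zm = Zm * ι f + ι f * (ι a * H) + ι f * ι (z * b) := by
      rw [hf.actZ]; noncomm_ring
    have e1 : ι f * (ι a * H) * ι fi = ι a * H + ι (a * (2 * z * -a)) := by
      rw [mul_assoc, mul_assoc, hH, ← mul_assoc (ι a), comm a, mul_assoc, ← mul_assoc, i1, one_mul,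
        mul_add, ← map_mul]
    have e2 : ι f * ι (z * b) * ι fi = ι (z * b) := by rw [comm, mul_assoc, i1, mul_one]
    rw [← mul_assoc, e, add_mul, add_mul, mul_assoc, i1, e1, e2, mul_one,
      show z * (-b + 2 * a ^ 2) = - (z * b) - a * (2 * z * -a) by ring, map_neg, map_sub, map_neg]
    noncomm_ring
  rw [← one_mul (Zm * ι fi), ← i2, mul_assoc, this]

theorem HasLogDer.one : HasLogDer ι H Zm z 1 0 0 := by constructor <;> simp

theorem HasLogDer.of_commute (h₁ : Commute H (ι f)) (h₂ : Commute Zm (ι f)) :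
    HasLogDer ι H Zm z f 0 0 := by
  constructor
  · simpa using h₁.eq
  · simpa using h₂.eq

theorem HasLogDer.of_linear {d fi : S} (h₁ : H * ι f = ι f * H + ι (2 * z * d))
    (h₂ : Zm * ι f = ι f * Zm - ι d * H) (hi : f * fi = 1) :
    HasLogDer ι H Zm z f (d * fi) 0 := by
  constructor
  · rw [h₁, mul_add, ← map_mul, show f * (2 * z * (d * fi)) = 2 * z * d * (f * fi) by ring, hi,
      mul_one]
  · rw [h₂, mul_zero, map_zero, sub_zero, mul_sub, ← mul_assoc, ← map_mul,
      show f * (d * fi) = d * (f * fi) by ring, hi, mul_one]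

/-- Since `u'' = 0`, the second derivative of `u ^ n` is `n (n - 1) u'² u^(n - 2)`, also for
negative `n`. -/
theorem HasLogDer.zpow {u : Sˣ} {c : S} (hu : HasLogDer ι H Zm z u c 0) (n : ℤ) :
    HasLogDer ι H Zm z ((u ^ n : Sˣ) : S) (n * c) (n * (n - 1) * c ^ 2) := by
  induction n with
  | zero => simpa using HasLogDer.one
  | succ n ih =>
    have := ih.mul hu
    rw [← Units.val_mul, ← zpow_add_one] at this
    convert this using 1 <;> push_cast <;> ring
  | pred n ih =>
    have := ih.mul (hu.inv u.mul_inv)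
    rw [← Units.val_mul, ← zpow_sub_one] at this
    convert this using 1 <;> push_cast <;> ring

end LogDer

end Jordanian

namespace Jordanian

/-! ### The twisting function and its three rational identities -/

section Twist

variable {S R : Type*} [CommRing S] [Algebra ℂ S] [Ring R] [Algebra ℂ R]

/-- Two commuting copies of the relations `[H, Z₊] = 2 Z₊`, `[Z₊, Z₋] = H`, with the two raising
operators in a commutative algebra `S`. -/
structure TensorSL2 (ι : S →ₐ[ℂ] R) (H₁ Z₁ H₂ Z₂ : R) (z₁ z₂ : S) : Prop where
  h₁ : H₁ * ι z₁ = ι z₁ * H₁ + 2 * ι z₁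
  h₂ : H₂ * ι z₂ = ι z₂ * H₂ + 2 * ι z₂
  c₁ : Z₁ * ι z₁ = ι z₁ * Z₁ - H₁
  c₂ : Z₂ * ι z₂ = ι z₂ * Z₂ - H₂
  h₁₂ : Commute H₁ (ι z₂)
  h₂₁ : Commute H₂ (ι z₁)
  c₁₂ : Commute Z₁ (ι z₂)
  c₂₁ : Commute Z₂ (ι z₁)

theorem TensorSL2.swap {ι : S →ₐ[ℂ] R} {H₁ Z₁ H₂ Z₂ : R} {z₁ z₂ : S}
    (h : TensorSL2 ι H₁ Z₁ H₂ Z₂ z₁ z₂) : TensorSL2 ι H₂ Z₂ H₁ Z₁ z₂ z₁ :=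
  ⟨h.h₂, h.h₁, h.c₂, h.c₁, h.h₂₁, h.h₁₂, h.c₂₁, h.c₁₂⟩

variable {ι : S →ₐ[ℂ] R} {H₁ Z₁ H₂ Z₂ : R} {z₁ z₂ : S}

/-- For the first copy `z₂` is a constant, so `u` is affine in `z₁`. The slope covers `1 + t z₁` (`d
= 0`) and `1 + t² z₁ z₂` (`c = 0`) at once. -/
theorem TensorSL2.hasLogDer_affine (hr : TensorSL2 ι H₁ Z₁ H₂ Z₂ z₁ z₂) (c d : ℂ) {u : Sˣ}
    (hu : (u : S) = 1 + (algebraMap ℂ S c + algebraMap ℂ S d * z₂) * z₁) :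
    HasLogDer ι H₁ Z₁ z₁ u ((algebraMap ℂ S c + algebraMap ℂ S d * z₂) * ↑u⁻¹) 0 := by
  have hH : Commute H₁ (ι (algebraMap ℂ S c + algebraMap ℂ S d * z₂)) := by
    rw [map_add, map_mul, AlgHom.commutes, AlgHom.commutes]
    exact .add_right (Algebra.commutes c H₁).symm (.mul_right (Algebra.commutes d H₁).symm hr.h₁₂)
  have hZ : Commute Z₁ (ι (algebraMap ℂ S c + algebraMap ℂ S d * z₂)) := by
    rw [map_add, map_mul, AlgHom.commutes, AlgHom.commutes]
    exact .add_right (Algebra.commutes c Z₁).symm (.mul_right (Algebra.commutes d Z₁).symm hr.c₁₂)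
  generalize algebraMap ℂ S c + algebraMap ℂ S d * z₂ = e at *
  refine .of_linear ?_ ?_ u.mul_inv
  · rw [hu, map_add, map_one, map_mul, mul_add, ← mul_assoc, hH.eq, mul_assoc, hr.h₁,
      show 2 * z₁ * e = e * (2 * z₁) by ring, map_mul ι e, map_mul ι 2, map_ofNat]
    noncomm_ring
  · rw [hu, map_add, map_one, map_mul, mul_add, ← mul_assoc, hZ.eq, mul_assoc, hr.c₁]
    noncomm_ring

theorem TensorSL2.hasLogDer_const (hr : TensorSL2 ι H₁ Z₁ H₂ Z₂ z₁ z₂) (c : ℂ) {v : Sˣ}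
    (hv : (v : S) = 1 + algebraMap ℂ S c * z₂) : HasLogDer ι H₁ Z₁ z₁ v 0 0 := by
  refine .of_commute ?_ ?_ <;> rw [hv, map_add, map_one, map_mul, AlgHom.commutes] <;>
    refine (Commute.one_right _).add_right (.mul_right (Algebra.commutes c _).symm ?_)
  exacts [hr.h₁₂, hr.c₁₂]

/-- The exponent `p` leaves no trace in the derivatives: `v` involves `z₂` only. The second copy is
handled by the same lemma through `TensorSL2.swap`. -/
theorem TensorSL2.hasLogDer_monomial (hr : TensorSL2 ι H₁ Z₁ H₂ Z₂ z₁ z₂) (c d e : ℂ) {u v s : Sˣ}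
    (hu : (u : S) = 1 + algebraMap ℂ S c * z₁) (hv : (v : S) = 1 + algebraMap ℂ S e * z₂)
    (hs : (s : S) = 1 + algebraMap ℂ S d * z₂ * z₁) (p q r : ℤ) :
    HasLogDer ι H₁ Z₁ z₁ ((u ^ q * v ^ p * s ^ r : Sˣ) : S)
      (q * (algebraMap ℂ S c * ↑u⁻¹) + r * (algebraMap ℂ S d * z₂ * ↑s⁻¹))
      (q * (q - 1) * (algebraMap ℂ S c * ↑u⁻¹) ^ 2 +
        r * (r - 1) * (algebraMap ℂ S d * z₂ * ↑s⁻¹) ^ 2 +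
        2 * (q * (algebraMap ℂ S c * ↑u⁻¹)) * (r * (algebraMap ℂ S d * z₂ * ↑s⁻¹))) := by
  have h1 := (hr.hasLogDer_affine c 0 (u := u) (by simpa using hu)).zpow
  have h2 := (hr.hasLogDer_affine 0 d (u := s) (by simpa using hs)).zpow
  have h3 := (hr.hasLogDer_const e hv).zpow
  simp only [map_zero, zero_mul, add_zero, zero_add] at h1 h2
  convert ((h1 q).mul (h3 p)).mul (h2 r) using 1
  all_goals try simp only [Units.val_mul]
  all_goals ring

/-- The twisting function `(1 + t z₁)^q (1 - t z₂)^p (1 + t² z₁ z₂)^(-(p + q))`. -/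
def twist (u v s : Sˣ) (p q : ℤ) : Sˣ := u ^ q * v ^ p * s ^ (-(p + q))

variable {u v s : Sˣ} {t : ℂ}

omit [Algebra ℂ S] in
theorem twist_add (p q a b : ℤ) :
    twist u v s (p + a) (q + b) = twist u v s p q * twist u v s a b := by
  simp only [twist]
  rw [show -(p + a + (q + b)) = -(p + q) + -(a + b) by ring, zpow_add, zpow_add, zpow_add,
    mul_mul_mul_comm (u ^ q), mul_mul_mul_comm]

omit [Algebra ℂ S] in
-- Here `x = t z₁`, `y = t z₂`; the outer factors are `e^{hX}` on the second leg and `e^{-hX}` on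
-- the first, and each bracket is the weight plus twice the Euler logarithmic derivative of the
-- twist.
theorem twist_H_identity (x y ui vi si p q : S) (hu : (1 + x) * ui = 1) (hv : (1 - y) * vi = 1)
    (hs : (1 + x * y) * si = 1) :
    (1 + y) * vi * (p + 2 * (q * x * ui - (p + q) * x * y * si)) +
      (1 - x) * ui * (q + 2 * (- p * y * vi - (p + q) * x * y * si)) = p + q := by
  grind

omit [Algebra ℂ S] in
-- Cancellation of all terms with a derivative of the twist when `Δ(Z₋)` acts on a weight vector.
-- The exponent of `s` is `1 - p - q`, not `-(p + q)`, because one factor `s` of the operator has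
-- been absorbed.
theorem twist_Zm_identity (T z₁ z₂ ui vi si p q r : S) (hu : (1 + T * z₁) * ui = 1)
    (hv : (1 - T * z₂) * vi = 1) (hs : (1 + T ^ 2 * z₁ * z₂) * si = 1) (hr : r = 1 - p - q) :
    vi ^ 2 * (p * (q * (T * ui) + r * (T ^ 2 * z₂ * si)) +
      z₁ * (q * (q - 1) * (T * ui) ^ 2 + r * (r - 1) * (T ^ 2 * z₂ * si) ^ 2 +
        2 * (q * (T * ui)) * (r * (T ^ 2 * z₂ * si)))) +
    ui ^ 2 * (q * (p * (-T * vi) + r * (T ^ 2 * z₁ * si)) +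
      z₂ * (p * (p - 1) * (-T * vi) ^ 2 + r * (r - 1) * (T ^ 2 * z₁ * si) ^ 2 +
        2 * (p * (-T * vi)) * (r * (T ^ 2 * z₁ * si)))) = 0 := by
  subst hr; grind

omit [Algebra ℂ S] in
-- Shifting `p` by 2 multiplies the twist by `v² / s²`, shifting `q` by `u² / s²`, and `v² z₁ + u²
-- z₂ = (z₁ + z₂) s`.
theorem twist_Zp (T : S) (hu : (u : S) = 1 + T * z₁) (hv : (v : S) = 1 - T * z₂)
    (hs : (s : S) = 1 + T ^ 2 * z₁ * z₂) (p q : ℤ) :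
    (twist u v s (p + 2) q : S) * z₁ + twist u v s p (q + 2) * z₂ =
      (z₁ + z₂) * ↑s⁻¹ * twist u v s p q := by
  have e1 : twist u v s (p + 2) q = twist u v s p q * (v ^ 2 * s⁻¹ ^ 2) := by
    rw [← add_zero q, twist_add, add_zero]
    congr 1
    simp [twist, zpow_neg]
  have e2 : twist u v s p (q + 2) = twist u v s p q * (u ^ 2 * s⁻¹ ^ 2) := by
    rw [← add_zero p, twist_add, add_zero]
    congr 1
    simp [twist, zpow_neg]
  have key : (v : S) ^ 2 * (↑s⁻¹) ^ 2 * z₁ + (u : S) ^ 2 * (↑s⁻¹) ^ 2 * z₂ = (z₁ + z₂) * ↑s⁻¹ := by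
    have := s.mul_inv
    rw [hs] at this
    rw [hu, hv]
    generalize ((s⁻¹ : Sˣ) : S) = si at *
    grind
  rw [e1, e2]
  push_cast
  linear_combination (twist u v s p q : S) * key

theorem TensorSL2.commute_const (hr : TensorSL2 ι H₁ Z₁ H₂ Z₂ z₁ z₂) (c : ℂ) {v : Sˣ}
    (hv : (v : S) = 1 + algebraMap ℂ S c * z₂) (n : ℤ) :
    Commute H₁ (ι ((v ^ n : Sˣ) : S)) ∧ Commute Z₁ (ι ((v ^ n : Sˣ) : S)) := by
  have h := (hr.hasLogDer_const c hv).zpow n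
  exact ⟨by simpa [Commute, SemiconjBy] using h.actH, by simpa [Commute, SemiconjBy] using h.actZ⟩

/-- The exponents of the twist are the weights of the vector it acts on; the derivative terms
combine with the weights only because of this match. -/
theorem TensorSL2.twist_H (hr : TensorSL2 ι H₁ Z₁ H₂ Z₂ z₁ z₂)
    (hu : (u : S) = 1 + algebraMap ℂ S t * z₁) (hv : (v : S) = 1 - algebraMap ℂ S t * z₂)
    (hs : (s : S) = 1 + algebraMap ℂ S t ^ 2 * z₁ * z₂) {p q : ℤ} {e : R}
    (he₁ : H₁ * e = p * e) (he₂ : H₂ * e = q * e) :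
    (H₁ * ι ((1 + algebraMap ℂ S t * z₂) * ↑v⁻¹) + ι ((1 - algebraMap ℂ S t * z₁) * ↑u⁻¹) * H₂) *
      (ι (twist u v s p q) * e) = ι (twist u v s p q) * ((p + q : ℤ) * e) := by
  have hv' : (v : S) = 1 + algebraMap ℂ S (-t) * z₂ := by rw [hv, map_neg]; ring
  have hs₁ : (s : S) = 1 + algebraMap ℂ S (t ^ 2) * z₂ * z₁ := by rw [hs, map_pow]; ring
  have hs₂ : (s : S) = 1 + algebraMap ℂ S (t ^ 2) * z₁ * z₂ := by rw [hs, map_pow]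
  have d₁ := (hr.hasLogDer_monomial t (t ^ 2) (-t) hu hv' hs₁ p q (-(p + q))).actH
  have d₂ := (hr.swap.hasLogDer_monomial (-t) (t ^ 2) t hv' hu hs₂ q p (-(p + q))).actH
  rw [mul_comm (v ^ p)] at d₂
  rw [← twist] at d₁ d₂
  have cA : Commute H₁ (ι ((1 + algebraMap ℂ S t * z₂) * ↑v⁻¹)) := by
    rw [map_mul, map_add, map_one, map_mul, AlgHom.commutes]
    refine .mul_right (.add_right (.one_right _)
      (.mul_right (Algebra.commutes t _).symm hr.h₁₂)) ?_
    simpa using (hr.commute_const (-t) hv' (-1)).1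
  have key := twist_H_identity (algebraMap ℂ S t * z₁) (algebraMap ℂ S t * z₂) ↑u⁻¹ ↑v⁻¹ ↑s⁻¹
    (p : S) (q : S) (by rw [← hu, u.mul_inv]) (by rw [← hv, v.mul_inv])
    (by linear_combination s.mul_inv - ↑s⁻¹ * hs)
  generalize (twist u v s p q : S) = F at *
  have hp : H₁ * e = ι p * e := by rw [he₁, map_intCast]
  have hq : H₂ * e = ι q * e := by rw [he₂, map_intCast]
  have e₁ : ∀ a : S, H₁ * ι F = ι F * (H₁ + ι a) → H₁ * (ι F * e) = ι (F * (p + a)) * e := by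
    intro a h
    rw [← mul_assoc, h, mul_assoc, add_mul, hp, ← add_mul, ← map_add, ← mul_assoc, ← map_mul]
  have e₂ : ∀ a : S, H₂ * ι F = ι F * (H₂ + ι a) → H₂ * (ι F * e) = ι (F * (q + a)) * e := by
    intro a h
    rw [← mul_assoc, h, mul_assoc, add_mul, hq, ← add_mul, ← map_add, ← mul_assoc, ← map_mul]
  rw [cA.eq, add_mul, mul_assoc, mul_assoc, e₁ _ d₁, e₂ _ d₂, ← map_intCast ι (p + q),
    ← mul_assoc (ι _) (ι _) e, ← mul_assoc (ι _) (ι _) e, ← mul_assoc (ι _) (ι _) e, ← map_mul,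
    ← map_mul, ← map_mul, ← add_mul, ← map_add]
  congr 2
  push_cast [map_neg, map_pow] at key ⊢
  linear_combination F * key

theorem TensorSL2.twist_Zm (hr : TensorSL2 ι H₁ Z₁ H₂ Z₂ z₁ z₂)
    (hu : (u : S) = 1 + algebraMap ℂ S t * z₁) (hv : (v : S) = 1 - algebraMap ℂ S t * z₂)
    (hs : (s : S) = 1 + algebraMap ℂ S t ^ 2 * z₁ * z₂) {p q : ℤ} {e : R}
    (he₁ : H₁ * e = p * e) (he₂ : H₂ * e = q * e) :
    ι s * (Z₁ * ι ↑(v⁻¹ ^ 2) + ι ↑(u⁻¹ ^ 2) * Z₂) * ι s * (ι (twist u v s p q) * e) =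
      ι (twist u v s (p - 2) q) * (Z₁ * e) + ι (twist u v s p (q - 2)) * (Z₂ * e) := by
  have hv' : (v : S) = 1 + algebraMap ℂ S (-t) * z₂ := by rw [hv, map_neg]; ring
  have hs₁ : (s : S) = 1 + algebraMap ℂ S (t ^ 2) * z₂ * z₁ := by rw [hs, map_pow]; ring
  have hs₂ : (s : S) = 1 + algebraMap ℂ S (t ^ 2) * z₁ * z₂ := by rw [hs, map_pow]
  have d₁ := (hr.hasLogDer_monomial t (t ^ 2) (-t) hu hv' hs₁ p q (1 - p - q)).actZ
  have d₂ := (hr.swap.hasLogDer_monomial (-t) (t ^ 2) t hv' hu hs₂ q p (1 - p - q)).actZ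
  rw [mul_comm (v ^ p)] at d₂
  have cA : Commute Z₁ (ι ((v⁻¹ ^ 2 : Sˣ) : S)) := by
    have := (hr.commute_const (-t) hv' (-2)).2
    rwa [zpow_neg, ← inv_zpow] at this
  have key := twist_Zm_identity (algebraMap ℂ S t) z₁ z₂ ↑u⁻¹ ↑v⁻¹ ↑s⁻¹
    (p : S) (q : S) _ (by rw [← hu, u.mul_inv]) (by rw [← hv, v.mul_inv])
    (by rw [← hs, s.mul_inv]) rfl
  -- The right-hand `s` of the operator is absorbed into the twist before `Z₁` and `Z₂` are moved
  -- past it.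
  have e₀ : s * twist u v s p q = u ^ q * v ^ p * s ^ (1 - p - q) := by
    rw [twist, show 1 - p - q = 1 + -(p + q) by ring, zpow_add s 1, zpow_one,
      mul_left_comm]
  have e₁ : twist u v s (p - 2) q = s * v⁻¹ ^ 2 * (u ^ q * v ^ p * s ^ (1 - p - q)) := by
    have : twist u v s (-2) 0 = s * v⁻¹ ^ 2 * s := by
      rw [mul_right_comm, ← sq, mul_comm]
      simp [twist, zpow_neg]
    rw [← e₀, ← mul_assoc, ← this, mul_comm, ← twist_add, add_zero, sub_eq_add_neg]
  have e₂ : twist u v s p (q - 2) = s * u⁻¹ ^ 2 * (u ^ q * v ^ p * s ^ (1 - p - q)) := by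
    have : twist u v s 0 (-2) = s * u⁻¹ ^ 2 * s := by
      rw [mul_right_comm, ← sq, mul_comm]
      simp [twist, zpow_neg]
    rw [← e₀, ← mul_assoc, ← this, mul_comm, ← twist_add, add_zero, sub_eq_add_neg]
  rw [mul_assoc _ (ι s), ← mul_assoc (ι s) (ι _) e, ← map_mul, ← Units.val_mul, e₀, e₁, e₂, cA.eq]
  generalize u ^ q * v ^ p * s ^ (1 - p - q) = F at *
  have hp : H₁ * e = ι p * e := by rw [he₁, map_intCast]
  have hq : H₂ * e = ι q * e := by rw [he₂, map_intCast]
  have f₁ : ∀ a b : S, Z₁ * ι F = ι F * (Z₁ - ι a * H₁ - ι (z₁ * b)) →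
      Z₁ * (ι F * e) = ι F * (Z₁ * e) - ι ((F : S) * (p * a + z₁ * b)) * e := by
    intro a b h
    rw [← mul_assoc, h, mul_assoc, sub_mul, sub_mul, mul_assoc (ι a), hp, map_mul ι (F : S), map_add,
      mul_comm (p : S), map_mul ι a]
    noncomm_ring
  have f₂ : ∀ a b : S, Z₂ * ι F = ι F * (Z₂ - ι a * H₂ - ι (z₂ * b)) →
      Z₂ * (ι F * e) = ι F * (Z₂ * e) - ι ((F : S) * (q * a + z₂ * b)) * e := by
    intro a b h
    rw [← mul_assoc, h, mul_assoc, sub_mul, sub_mul, mul_assoc (ι a), hq, map_mul ι (F : S), map_add,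
      mul_comm (q : S), map_mul ι a]
    noncomm_ring
  rw [mul_assoc, add_mul, mul_assoc, mul_assoc, f₁ _ _ d₁, f₂ _ _ d₂]
  -- The terms carrying derivatives of `F` drop out as soon as their combination weighted by `v⁻²`
  -- and `u⁻²` is zero, which is `twist_Zm_identity`.
  have key' : ∀ a b : S, (v⁻¹ ^ 2 : Sˣ) * a + (u⁻¹ ^ 2 : Sˣ) * b = 0 →
      ι s * (ι (v⁻¹ ^ 2 : Sˣ) * (ι F * (Z₁ * e) - ι ((F : S) * a) * e) +
        ι (u⁻¹ ^ 2 : Sˣ) * (ι F * (Z₂ * e) - ι ((F : S) * b) * e)) =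
      ι (s * v⁻¹ ^ 2 * F : Sˣ) * (Z₁ * e) + ι (s * u⁻¹ ^ 2 * F : Sˣ) * (Z₂ * e) := by
    intro a b h
    have h' : ι s * ι (v⁻¹ ^ 2 : Sˣ) * ι ((F : S) * a) * e + ι s * ι (u⁻¹ ^ 2 : Sˣ) * ι ((F : S) * b) * e = 0 := by
      simp only [← map_mul]
      rw [← add_mul, ← map_add, show (s : S) * (v⁻¹ ^ 2 : Sˣ) * ((F : S) * a) + s * (u⁻¹ ^ 2 : Sˣ) * ((F : S) * b) =
        s * F * ((v⁻¹ ^ 2 : Sˣ) * a + (u⁻¹ ^ 2 : Sˣ) * b) by ring, h, mul_zero, map_zero, zero_mul]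
    have m : ∀ x : Sˣ, ι (s * x * F : Sˣ) = ι s * ι x * ι F := fun x => by
      rw [Units.val_mul, Units.val_mul, map_mul, map_mul]
    rw [m, m]
    calc _ = ι s * ι (v⁻¹ ^ 2 : Sˣ) * ι F * (Z₁ * e) + ι s * ι (u⁻¹ ^ 2 : Sˣ) * ι F * (Z₂ * e) -
        (ι s * ι (v⁻¹ ^ 2 : Sˣ) * ι ((F : S) * a) * e +
          ι s * ι (u⁻¹ ^ 2 : Sˣ) * ι ((F : S) * b) * e) := by
          simp only [mul_sub, mul_add, mul_assoc]; abel
      _ = _ := by rw [h', sub_zero]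
  refine key' _ _ ?_
  push_cast at key ⊢
  linear_combination key

end Twist

end Jordanian

namespace Jordanian

open scoped Kronecker Nat

/-! ### Weight-raising matrices and rigidity -/

section Raises

variable {n : Type*} [Fintype n] [DecidableEq n] {w : n → ℕ} {d e : ℕ} {M N : Matrix n n ℂ}

/-- `M` raises the weight by at least `d`. -/
def Raises (w : n → ℕ) (d : ℕ) (M : Matrix n n ℂ) : Prop := ∀ a b, M a b ≠ 0 → w b + d ≤ w a

omit [Fintype n] [DecidableEq n] in
theorem Raises.mono (h : Raises w d M) (hde : e ≤ d) : Raises w e M :=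
  fun a b hab => by have := h a b hab; omega

omit [Fintype n] [DecidableEq n] in
theorem Raises.add (hM : Raises w d M) (hN : Raises w d N) : Raises w d (M + N) := by
  intro a b hab
  by_cases h : M a b = 0
  · exact hN a b fun h' => hab (by simp [h, h'])
  · exact hM a b h

omit [Fintype n] [DecidableEq n] in
theorem Raises.smul (c : ℂ) (hM : Raises w d M) : Raises w d (c • M) :=
  fun a b hab => hM a b fun h => hab (by simp [h])

omit [Fintype n] [DecidableEq n] in
theorem Raises.neg (hM : Raises w d M) : Raises w d (-M) :=
  fun a b hab => hM a b fun h => hab (by simp [h])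

omit [Fintype n] [DecidableEq n] in
theorem Raises.sum {ι : Type*} {s : Finset ι} {f : ι → Matrix n n ℂ}
    (h : ∀ i ∈ s, Raises w d (f i)) : Raises w d (∑ i ∈ s, f i) := by
  intro a b hab
  rw [Matrix.sum_apply] at hab
  obtain ⟨i, hi, hne⟩ := Finset.exists_ne_zero_of_sum_ne_zero hab
  exact h i hi a b hne

omit [DecidableEq n] in
theorem Raises.mul (hM : Raises w d M) (hN : Raises w e N) : Raises w (d + e) (M * N) := by
  intro a b hab
  rw [Matrix.mul_apply] at hab
  obtain ⟨i, -, hne⟩ := Finset.exists_ne_zero_of_sum_ne_zero hab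
  have h1 := hM a i (left_ne_zero_of_mul hne)
  have h2 := hN i b (right_ne_zero_of_mul hne)
  omega

omit [Fintype n] in
theorem Raises.one : Raises w 0 (1 : Matrix n n ℂ) := by
  intro a b hab
  rcases eq_or_ne a b with rfl | h
  · simp
  · simp [h] at hab

theorem Raises.pow (hM : Raises w d M) (k : ℕ) : Raises w (k * d) (M ^ k) := by
  induction k with
  | zero => simpa using Raises.one
  | succ k ih => rw [pow_succ, add_mul, one_mul]; exact ih.mul hM

omit [Fintype n] [DecidableEq n] in
theorem Raises.eq_zero {L : ℕ} (hw : ∀ a, w a ≤ L) (hM : Raises w (L + 1) M) : M = 0 := by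
  ext a b
  by_contra h
  have := hM a b h
  have := hw a
  omega

theorem Raises.pow_eq_zero {L : ℕ} (hw : ∀ a, w a ≤ L) (hM : Raises w 1 M) : M ^ (L + 1) = 0 :=
  Raises.eq_zero hw (by simpa using hM.pow (L + 1))

/-- A strictly raising matrix commuting with a diagonal matrix which separates the weights
vanishes. -/
theorem Raises.eq_zero_of_commute (hM : Raises w 1 M) {D : n → ℂ}
    (hD : ∀ a b, D a = D b → w a = w b) (hc : Commute (Matrix.diagonal D) M) : M = 0 := by
  ext a b
  by_contra h
  have h1 := hM a b h
  have h2 := congrFun (congrFun hc.eq a) b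
  rw [Matrix.diagonal_mul, Matrix.mul_diagonal, mul_comm] at h2
  have := hD a b (mul_left_cancel₀ h h2)
  omega

theorem Raises.mul_sub_one (hM : Raises w 1 (M - 1)) (hN : Raises w 1 (N - 1)) :
    Raises w 1 (M * N - 1) := by
  have : M * N - 1 = (M - 1) * (N - 1) + (M - 1) + (N - 1) := by noncomm_ring
  rw [this]
  exact (((hM.mul hN).mono (by norm_num)).add hM).add hN

theorem Raises.geom_sum_sub_one (hM : Raises w 1 M) (L : ℕ) :
    Raises w 1 (∑ k ∈ Finset.range (L + 1), M ^ k - 1) := by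
  rw [Finset.sum_range_succ', pow_zero, add_sub_cancel_right]
  exact Raises.sum fun i _ => (hM.pow (i + 1)).mono (by simp)

end Raises

/-! ### The derivation `[H, ·]` on functions of the raising operators -/

section EulerDer

variable {S R : Type*} [CommRing S] [Algebra ℂ S] [Ring R] [Algebra ℂ R]

/-- `[H, f] = f'`. -/
def EulerDer (ι : S →ₐ[ℂ] R) (H : R) (f f' : S) : Prop := H * ι f = ι f * H + ι f'

variable {ι : S →ₐ[ℂ] R} {H : R} {f g f' g' : S}

theorem EulerDer.add (hf : EulerDer ι H f f') (hg : EulerDer ι H g g') :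
    EulerDer ι H (f + g) (f' + g') := by
  unfold EulerDer at *
  rw [map_add, map_add, mul_add, hf, hg, add_mul]; abel

theorem EulerDer.mul (hf : EulerDer ι H f f') (hg : EulerDer ι H g g') :
    EulerDer ι H (f * g) (f' * g + f * g') := by
  unfold EulerDer at *
  rw [map_add, map_mul, map_mul, map_mul, ← mul_assoc, hf, add_mul, mul_assoc, hg]
  noncomm_ring

theorem EulerDer.const (c : ℂ) : EulerDer ι H (algebraMap ℂ S c) 0 := by
  unfold EulerDer
  rw [AlgHom.commutes, map_zero, add_zero, Algebra.commutes]

theorem EulerDer.one : EulerDer ι H 1 0 := by simp [EulerDer]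

theorem EulerDer.smul (c : ℂ) (hf : EulerDer ι H f f') : EulerDer ι H (c • f) (c • f') := by
  simpa [Algebra.smul_def] using (EulerDer.const c).mul hf

theorem EulerDer.sum {κ : Type*} {s : Finset κ} {F F' : κ → S}
    (h : ∀ i ∈ s, EulerDer ι H (F i) (F' i)) : EulerDer ι H (∑ i ∈ s, F i) (∑ i ∈ s, F' i) := by
  unfold EulerDer at *
  rw [map_sum, map_sum, Finset.mul_sum, Finset.sum_mul, ← Finset.sum_add_distrib]
  exact Finset.sum_congr rfl h

theorem EulerDer.pow (hf : EulerDer ι H f f') (k : ℕ) :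
    EulerDer ι H (f ^ k) (k * f ^ (k - 1) * f') := by
  induction k with
  | zero => simpa using EulerDer.one
  | succ k ih =>
    rw [pow_succ]
    convert ih.mul hf using 1
    rcases k with _ | k
    · simp
    · simp only [Nat.add_sub_cancel]; push_cast; ring

theorem EulerDer.inv {fi : S} (hf : EulerDer ι H f f') (hi : f * fi = 1) :
    EulerDer ι H fi (-(f' * fi ^ 2)) := by
  unfold EulerDer at *
  have comm : ∀ x y : S, ι x * ι y = ι y * ι x := fun x y => by
    rw [← map_mul, mul_comm, map_mul]
  have i1 : ι f * ι fi = 1 := by rw [← map_mul, hi, map_one]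
  have i2 : ι fi * ι f = 1 := by rw [comm, i1]
  have : ι fi * (H * ι f) * ι fi = ι fi * (ι f * H + ι f') * ι fi := by rw [hf]
  rw [mul_add, ← mul_assoc (ι fi) (ι f) H, i2, one_mul, add_mul, mul_assoc, mul_assoc H, i1,
    mul_one] at this
  rw [this, map_neg, show f' * fi ^ 2 = fi * f' * fi by ring, map_mul, map_mul]
  abel

theorem EulerDer.exp_sum (hf : EulerDer ι H f f') {N : ℕ} (hN : f ^ N = 0) :
    EulerDer ι H (∑ k ∈ Finset.range (N + 1), ((k ! : ℂ)⁻¹) • f ^ k)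
      ((∑ k ∈ Finset.range (N + 1), ((k ! : ℂ)⁻¹) • f ^ k) * f') := by
  convert EulerDer.sum fun k (_ : k ∈ Finset.range (N + 1)) => (hf.pow k).smul ((k ! : ℂ)⁻¹) using 1
  -- Differentiation shifts the index by one: the top term on one side dies by `f ^ N = 0`, the
  -- constant term on the other has derivative zero.
  rw [Finset.sum_range_succ, hN, smul_zero, add_zero, Finset.sum_range_succ', Finset.sum_mul]
  simp only [Nat.cast_zero, zero_mul, smul_zero, add_zero]
  refine Finset.sum_congr rfl fun k _ => ?_
  rw [Nat.add_sub_cancel, smul_mul_assoc, mul_assoc, ← nsmul_eq_mul, ← Nat.cast_smul_eq_nsmul ℂ,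
    smul_smul]
  congr 1
  have h1 : ((k : ℂ) + 1) ≠ 0 := Nat.cast_add_one_ne_zero k
  have h2 : ((k !) : ℂ) ≠ 0 := by exact_mod_cast k.factorial_ne_zero
  rw [Nat.factorial_succ]
  push_cast
  field_simp

/-- Two commuting elements of an algebra come from a commutative algebra. -/
theorem exists_commRing_algHom {R : Type} [Ring R] [Algebra ℂ R] {a b : R} (h : Commute a b) :
    ∃ (S : Type) (_ : CommRing S) (_ : Algebra ℂ S) (ι : S →ₐ[ℂ] R) (z₁ z₂ : S),
      Function.Injective ι ∧ ι z₁ = a ∧ ι z₂ = b := by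
  have hc : ∀ x ∈ ({a, b} : Set R), ∀ y ∈ ({a, b} : Set R), x * y = y * x := by
    rintro x (rfl | rfl) y (rfl | rfl)
    exacts [rfl, h.eq, h.eq.symm, rfl]
  let _ : CommRing (Algebra.adjoin ℂ ({a, b} : Set R)) :=
    { (inferInstance : Ring (Algebra.adjoin ℂ ({a, b} : Set R))) with
      mul_comm := fun x y => (Algebra.isMulCommutative_adjoin ℂ hc).is_comm.comm x y }
  exact ⟨Algebra.adjoin ℂ ({a, b} : Set R), inferInstance, inferInstance,
    (Algebra.adjoin ℂ ({a, b} : Set R)).val, ⟨a, Algebra.subset_adjoin (by simp)⟩,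
    ⟨b, Algebra.subset_adjoin (by simp)⟩, Subtype.val_injective, rfl, rfl⟩

end EulerDer

end Jordanian

namespace Jordanian

open scoped Nat

/-! ### Generating function of the coefficients `b` -/

section GeneratingFunction

/-- `(x)_n / n!` -/
noncomputable def risingBinom (x : ℚ) (n : ℕ) : ℚ := (ascPochhammer ℚ n).eval x / n !

theorem risingBinom_zero (x : ℚ) : risingBinom x 0 = 1 := by simp [risingBinom]

theorem risingBinom_succ (x : ℚ) (n : ℕ) :
    risingBinom (x + 1) (n + 1) = risingBinom x (n + 1) + risingBinom (x + 1) n := by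
  unfold risingBinom
  have h1 := ascPochhammer_succ_eval n (x + 1)
  have h2 : (ascPochhammer ℚ (n + 1)).eval x = x * (ascPochhammer ℚ n).eval (x + 1) := by
    rw [ascPochhammer_succ_left]; simp
  have h3 : ((n ! : ℕ) : ℚ) ≠ 0 := by exact_mod_cast n.factorial_ne_zero
  have h4 : ((n : ℚ) + 1) ≠ 0 := by positivity
  rw [h1, h2, Nat.factorial_succ]
  push_cast
  field_simp
  ring

theorem coeffB_natCast (m₁ m₂ : ℚ) (k l : ℕ) :
    coeffB m₁ m₂ k l = risingBinom (-2 * m₁ - k) l * risingBinom (-2 * m₂ - l) k := by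
  simp only [coeffB, risingBinom]
  rw [if_pos ⟨by positivity, by positivity⟩]
  push_cast [Int.toNat_natCast]
  rw [div_mul_div_comm, mul_comm (k ! : ℚ)]

theorem coeffB_of_neg_left (m₁ m₂ : ℚ) {k l : ℤ} (h : k < 0) : coeffB m₁ m₂ k l = 0 :=
  if_neg fun h' => by omega

theorem coeffB_of_neg_right (m₁ m₂ : ℚ) {k l : ℤ} (h : l < 0) : coeffB m₁ m₂ k l = 0 :=
  if_neg fun h' => by omega

theorem coeffB_swap (m₁ m₂ : ℚ) (k l : ℤ) : coeffB m₁ m₂ k l = coeffB m₂ m₁ l k := by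
  unfold coeffB
  simp only [and_comm (a := 0 ≤ k), mul_comm (k.toNat ! : ℚ),
    mul_comm (Polynomial.eval (-2 * m₁ - k) _)]

/-- Pascal's rule in each of the two factors. For the generating function `B` it reads `(1 - x y)
B_{m₁+1/2} = (1 - y) B_{m₁}`. -/
theorem coeffB_succ_left (m₁ m₂ : ℚ) (k l : ℕ) :
    coeffB (m₁ + 1 / 2) m₂ k l - coeffB (m₁ + 1 / 2) m₂ (k - 1) (l - 1) =
      coeffB m₁ m₂ k l - coeffB m₁ m₂ k (l - 1) := by
  rcases l with _ | l
  · rw [coeffB_of_neg_right _ _ (l := ((0 : ℕ) : ℤ) - 1) (by simp),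
      coeffB_of_neg_right _ _ (l := ((0 : ℕ) : ℤ) - 1) (by simp), coeffB_natCast, coeffB_natCast]
    simp [risingBinom_zero]
  · have hl : (((l + 1 : ℕ) : ℤ) - 1) = (l : ℕ) := by push_cast; ring
    have e1 := risingBinom_succ (-2 * m₁ - k - 1) l
    rw [sub_add_cancel] at e1
    rcases k with _ | k
    · rw [coeffB_of_neg_left _ _ (k := ((0 : ℕ) : ℤ) - 1) (by simp), hl, coeffB_natCast,
        coeffB_natCast, coeffB_natCast]
      simp only [risingBinom_zero]
      rw [e1]
      push_cast
      ring_nf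
    · have hk : (((k + 1 : ℕ) : ℤ) - 1) = (k : ℕ) := by push_cast; ring
      have e2 := risingBinom_succ (-2 * m₂ - l - 1) k
      rw [sub_add_cancel] at e2
      rw [hl, hk, coeffB_natCast, coeffB_natCast, coeffB_natCast, coeffB_natCast, e1, e2,
        show (-2 * (m₁ + 1 / 2) - ((k + 1 : ℕ) : ℚ)) = -2 * m₁ - ((k + 1 : ℕ) : ℚ) - 1 by ring,
        show (-2 * (m₁ + 1 / 2) - (k : ℚ)) = -2 * m₁ - ((k + 1 : ℕ) : ℚ) by push_cast; ring,
        show (-2 * m₂ - ((l + 1 : ℕ) : ℚ)) = -2 * m₂ - l - 1 by push_cast; ring]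
      ring

theorem coeffB_succ_right (m₁ m₂ : ℚ) (k l : ℕ) :
    coeffB m₁ (m₂ + 1 / 2) k l - coeffB m₁ (m₂ + 1 / 2) (k - 1) (l - 1) =
      coeffB m₁ m₂ k l - coeffB m₁ m₂ (k - 1) l := by
  rw [coeffB_swap m₁, coeffB_swap m₁, coeffB_succ_left, coeffB_swap m₁, coeffB_swap m₁]

theorem ascPochhammer_eval_neg_natCast_of_lt {k l : ℕ} (h : k < l) :
    (ascPochhammer ℚ l).eval (-(k : ℚ)) = 0 := by
  rw [ascPochhammer_eval_neg_eq_descPochhammer, descPochhammer_eval_coe_nat_of_lt h, mul_zero]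

/-- `(-k)_l` vanishes for `l > k` and `(-l)_k` for `k > l`; on the diagonal both equal `(-1)^k k!`.
So the generating function at weight zero is the geometric series of `x y`. -/
theorem coeffB_zero_zero (k l : ℕ) : coeffB 0 0 k l = if k = l then 1 else 0 := by
  rw [coeffB_natCast]
  simp only [mul_zero, zero_sub, risingBinom]
  rcases lt_trichotomy k l with h | rfl | h
  · rw [ascPochhammer_eval_neg_natCast_of_lt h, if_neg h.ne]; simp
  · rw [if_pos rfl, ascPochhammer_eval_neg_eq_descPochhammer, descPochhammer_eval_eq_descFactorial,
      Nat.descFactorial_self]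
    have h3 : ((k ! : ℕ) : ℚ) ≠ 0 := by exact_mod_cast k.factorial_ne_zero
    field_simp
    rw [← pow_mul, mul_comm, pow_mul]; simp
  · rw [ascPochhammer_eval_neg_natCast_of_lt h, if_neg h.ne']; simp

theorem coeffB_zero_zero_sub (k l : ℕ) :
    coeffB 0 0 k l - coeffB 0 0 (k - 1) (l - 1) = if k = 0 ∧ l = 0 then 1 else 0 := by
  rcases k with _ | k
  · rw [coeffB_of_neg_left _ _ (k := ((0 : ℕ) : ℤ) - 1) (by simp), coeffB_zero_zero]
    simp [eq_comm]
  · rcases l with _ | l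
    · rw [coeffB_of_neg_right _ _ (l := ((0 : ℕ) : ℤ) - 1) (by simp), coeffB_zero_zero]
      simp
    · rw [show (((k + 1 : ℕ) : ℤ) - 1) = (k : ℕ) by push_cast; ring,
        show (((l + 1 : ℕ) : ℤ) - 1) = (l : ℕ) by push_cast; ring, coeffB_zero_zero,
        coeffB_zero_zero]
      simp

variable {S : Type*} [CommRing S] [Algebra ℂ S]

/-- `∑ c_{k,l} x^k y^l`, truncated. -/
noncomputable def truncSum (N₁ N₂ : ℕ) (x y : S) (c : ℤ → ℤ → ℚ) : S :=
  ∑ k ∈ Finset.range N₁, ∑ l ∈ Finset.range N₂, (((c k l : ℚ) : ℂ)) • (x ^ k * y ^ l)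

variable {N₁ N₂ : ℕ} {x y : S} {c c' : ℤ → ℤ → ℚ}

theorem truncSum_congr (h : ∀ k l : ℕ, c k l = c' k l) :
    truncSum N₁ N₂ x y c = truncSum N₁ N₂ x y c' := by
  simp only [truncSum, h]

theorem truncSum_sub :
    truncSum N₁ N₂ x y (fun k l => c k l - c' k l) =
      truncSum N₁ N₂ x y c - truncSum N₁ N₂ x y c' := by
  simp only [truncSum, ← Finset.sum_sub_distrib]
  refine Finset.sum_congr rfl fun k _ => Finset.sum_congr rfl fun l _ => ?_
  push_cast
  rw [sub_smul]

/-- Truncation is harmless: the overflowing top term is killed by `x ^ N₁ = 0`, and `c (-1) l = 0`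
supplies the new bottom term. -/
theorem mul_truncSum_left (hx : x ^ N₁ = 0) (hc : ∀ l, c (-1) l = 0) :
    x * truncSum N₁ N₂ x y c = truncSum N₁ N₂ x y fun k l => c (k - 1) l := by
  unfold truncSum
  rcases N₁ with _ | N
  · simp
  rw [Finset.sum_range_succ, Finset.sum_range_succ']
  simp only [Nat.cast_zero, zero_sub, hc, mul_add, Finset.mul_sum]
  congr 1
  · refine Finset.sum_congr rfl fun k _ => Finset.sum_congr rfl fun l _ => ?_
    rw [mul_smul_comm, ← mul_assoc, ← pow_succ']
    push_cast
    rw [add_sub_cancel_right]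
  · refine Finset.sum_congr rfl fun l _ => ?_
    rw [mul_smul_comm, ← mul_assoc, ← pow_succ', hx]
    simp

theorem truncSum_swap :
    truncSum N₁ N₂ x y c = truncSum N₂ N₁ y x fun k l => c l k := by
  unfold truncSum
  rw [Finset.sum_comm]
  simp only [mul_comm]

theorem mul_truncSum_right (hy : y ^ N₂ = 0) (hc : ∀ k, c k (-1) = 0) :
    y * truncSum N₁ N₂ x y c = truncSum N₁ N₂ x y fun k l => c k (l - 1) := by
  rw [truncSum_swap, mul_truncSum_left hy hc, truncSum_swap]

omit [Algebra ℂ S] in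
theorem eq_zpow_mul_of_succ (f : ℤ → S) (a : Sˣ) (h : ∀ n, f (n + 1) = a * f n) (n : ℤ) :
    f n = (a ^ n : Sˣ) * f 0 := by
  induction n with
  | zero => simp
  | succ n ih => rw [h, ih, ← mul_assoc, zpow_add_one, Units.val_mul, mul_comm (a : S)]
  | pred n ih =>
    have h1 := h (-n - 1)
    rw [sub_add_cancel, ih] at h1
    rw [zpow_sub_one, Units.val_mul, mul_right_comm, h1, mul_right_comm, Units.mul_inv, one_mul]

/-- The generating function of the coefficients `b^{m₁,m₂}_{k,l} - b^{m₁,m₂}_{k-1,l-1}`. -/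
theorem truncSum_coeffB_sub (hN₁ : 0 < N₁) (hN₂ : 0 < N₂) {u v s : Sˣ} (hx : x ^ N₁ = 0)
    (hy : y ^ N₂ = 0) (hu : (u : S) = 1 - x) (hv : (v : S) = 1 - y) (hs : (s : S) = 1 - x * y)
    (p q : ℤ) :
    truncSum N₁ N₂ x y (fun k l => coeffB (p / 2) (q / 2) k l -
      coeffB (p / 2) (q / 2) (k - 1) (l - 1)) = twist u v s p q := by
  have hsub : ∀ m₁ m₂ : ℚ, truncSum N₁ N₂ x y (fun k l => coeffB m₁ m₂ k l -
      coeffB m₁ m₂ (k - 1) (l - 1)) = s * truncSum N₁ N₂ x y (coeffB m₁ m₂) := by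
    intro m₁ m₂
    rw [truncSum_sub, hs, sub_mul, one_mul, mul_assoc, mul_truncSum_right hy, mul_truncSum_left hx]
    · exact fun l => coeffB_of_neg_left _ _ (by norm_num)
    · exact fun k => coeffB_of_neg_right _ _ (by norm_num)
  have h₁ : ∀ m₁ m₂ : ℚ, s * truncSum N₁ N₂ x y (coeffB (m₁ + 1 / 2) m₂) =
      v * truncSum N₁ N₂ x y (coeffB m₁ m₂) := by
    intro m₁ m₂
    rw [← hsub, truncSum_congr (c' := fun k l => coeffB m₁ m₂ k l -
      coeffB m₁ m₂ k (l - 1)) (coeffB_succ_left m₁ m₂), hv, sub_mul, one_mul,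
      mul_truncSum_right hy, ← truncSum_sub]
    exact fun k => coeffB_of_neg_right _ _ (by norm_num)
  have h₂ : ∀ m₁ m₂ : ℚ, s * truncSum N₁ N₂ x y (coeffB m₁ (m₂ + 1 / 2)) =
      u * truncSum N₁ N₂ x y (coeffB m₁ m₂) := by
    intro m₁ m₂
    rw [← hsub, truncSum_congr (c' := fun k l => coeffB m₁ m₂ k l -
      coeffB m₁ m₂ (k - 1) l) (coeffB_succ_right m₁ m₂), hu, sub_mul, one_mul,
      mul_truncSum_left hx, ← truncSum_sub]
    exact fun k => coeffB_of_neg_left _ _ (by norm_num)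
  have h₀ : s * truncSum N₁ N₂ x y (coeffB 0 0) = 1 := by
    rw [← hsub, truncSum, Finset.sum_eq_single 0, Finset.sum_eq_single 0]
    · have := coeffB_zero_zero_sub 0 0
      rw [this]; simp
    · intro l _ hl
      have := coeffB_zero_zero_sub 0 l
      rw [this]; simp [hl]
    · simp [hN₂.ne']
    · intro k _ hk
      refine Finset.sum_eq_zero fun l _ => ?_
      have := coeffB_zero_zero_sub k l
      rw [this]; simp [hk]
    · simp [hN₁.ne']
  -- From weight `(0, 0)` one reaches `(p, q)` in half-integer steps: each step in `m₁` multiplies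
  -- by `v / s`, each step in `m₂` by `u / s`.
  have e₁ := eq_zpow_mul_of_succ (fun n : ℤ => (s : S) * truncSum N₁ N₂ x y (coeffB (n / 2) (q / 2)))
    (v * s⁻¹) (fun n => by
      have := h₁ (n / 2) (q / 2)
      rw [show ((n : ℚ) / 2 + 1 / 2) = ((n + 1 : ℤ) : ℚ) / 2 by push_cast; ring] at this
      rw [this, Units.val_mul, ← mul_assoc, mul_assoc (v : S), Units.inv_mul, mul_one]) p
  have e₂ := eq_zpow_mul_of_succ (fun n : ℤ => (s : S) * truncSum N₁ N₂ x y (coeffB 0 (n / 2)))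
    (u * s⁻¹) (fun n => by
      have := h₂ 0 (n / 2)
      rw [show ((n : ℚ) / 2 + 1 / 2) = ((n + 1 : ℤ) : ℚ) / 2 by push_cast; ring] at this
      rw [this, Units.val_mul, ← mul_assoc, mul_assoc (u : S), Units.inv_mul, mul_one]) q
  simp only [Int.cast_zero, zero_div] at e₁ e₂
  rw [hsub, e₁, e₂, h₀, mul_one, ← Units.val_mul]
  congr 1
  rw [twist, mul_zpow, mul_zpow, neg_add, zpow_add, inv_zpow', inv_zpow', mul_mul_mul_comm,
    mul_comm (v ^ p), mul_comm (s ^ (-p))]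

end GeneratingFunction

end Jordanian

namespace Jordanian

open scoped Nat

/-! ### The operators on a single `V^(j)` -/

section SingleSpin

variable {J : ℕ}

theorem opZp_apply_of_ne {a i : Fin (J + 1)} (h : (a : ℕ) ≠ i + 1) : opZp J a i = 0 := by
  simp [opZp, h]

theorem opZm_apply_of_ne {a i : Fin (J + 1)} (h : (a : ℕ) + 1 ≠ i) : opZm J a i = 0 := by
  simp [opZm, h]

theorem opZm_eq_transpose : opZm J = (opZp J).transpose := by
  ext a i
  simp only [opZm, opZp, Matrix.of_apply, Matrix.transpose_apply, eq_comm (a := (i : ℕ))]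
  split_ifs with h
  · rw [← h]
    push_cast
    rw [mul_comm]
    ring_nf
  · rfl

theorem opZp_mul_opZm_apply (a i : Fin (J + 1)) :
    (opZp J * opZm J) a i = if a = i then (i : ℂ) * (J - i + 1) else 0 := by
  rw [Matrix.mul_apply]
  by_cases h : a = i
  · subst h
    rw [if_pos rfl]
    rcases Nat.eq_zero_or_pos (a : ℕ) with h0 | h0
    · rw [Finset.sum_eq_zero, h0]
      · simp
      · intro b _
        rw [opZp_apply_of_ne (by omega), zero_mul]
    · rw [Finset.sum_eq_single ⟨a - 1, by omega⟩]
      · have h1 : (a : ℕ) = a - 1 + 1 := by omega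
        rw [opZm_eq_transpose, Matrix.transpose_apply, opZp, Matrix.of_apply, if_pos h1,
          ← Complex.ofReal_mul, Real.mul_self_sqrt]
        · obtain ⟨c, hc⟩ : ∃ c, (a : ℕ) = c + 1 := ⟨_, h1⟩
          simp only [hc]
          push_cast
          ring
        · have : ((a - 1 : ℕ) : ℝ) ≤ J := by exact_mod_cast (by omega : (a : ℕ) - 1 ≤ J)
          exact mul_nonneg (sub_nonneg.mpr this) (by positivity)
      · intro b _ hb
        rw [opZp_apply_of_ne, zero_mul]
        intro h
        exact hb (Fin.ext (by simp only; omega))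
      · simp
  · rw [if_neg h, Finset.sum_eq_zero]
    intro b _
    by_cases h1 : (a : ℕ) = b + 1
    · rw [opZm_apply_of_ne (a := b), mul_zero]
      intro h2
      exact h (Fin.ext (by omega))
    · rw [opZp_apply_of_ne h1, zero_mul]

theorem opZp_rev (a i : Fin (J + 1)) : opZp J a.rev i.rev = opZm J a i := by
  simp only [opZm, opZp, Matrix.of_apply, Fin.val_rev]
  have ha := a.is_lt
  have hi := i.is_lt
  have h : (J + 1 - ((a : ℕ) + 1) = J + 1 - (i + 1) + 1) ↔ (a : ℕ) + 1 = i := by omega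
  simp only [h]
  congr 3
  have : ((J + 1 - ((i : ℕ) + 1) : ℕ) : ℝ) = J - i := by
    rw [Nat.cast_sub (by omega)]; push_cast; ring
  rw [this]; ring_nf

theorem opZm_rev (a i : Fin (J + 1)) : opZm J a.rev i.rev = opZp J a i := by
  rw [← opZp_rev, Fin.rev_rev, Fin.rev_rev]

theorem opZm_mul_opZp_apply (a i : Fin (J + 1)) :
    (opZm J * opZp J) a i = if a = i then ((J : ℂ) - i) * (i + 1) else 0 := by
  have : (opZm J * opZp J) a i = (opZp J * opZm J) a.rev i.rev := by
    rw [Matrix.mul_apply, Matrix.mul_apply]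
    refine Fintype.sum_equiv Fin.revPerm _ _ fun b => ?_
    rw [Fin.revPerm_apply, opZp_rev, opZm_rev]
  rw [this, opZp_mul_opZm_apply]
  have hi := i.is_lt
  simp only [Fin.rev_inj, Fin.val_rev]
  have : ((J + 1 - ((i : ℕ) + 1) : ℕ) : ℂ) = J - i := by
    rw [Nat.cast_sub (by omega)]; push_cast; ring
  rw [this]; ring_nf

theorem opH_apply_diag (i : Fin (J + 1)) : ((2 * mag i : ℚ) : ℂ) = ((2 * (i : ℤ) - J : ℤ) : ℂ) := by
  simp only [mag]; push_cast; ring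

theorem opH_eq : opH J = Matrix.diagonal fun i : Fin (J + 1) => ((2 * (i : ℤ) - J : ℤ) : ℂ) := by
  simp only [opH, opH_apply_diag]

theorem opH_rev (a i : Fin (J + 1)) : opH J a.rev i.rev = - opH J a i := by
  rw [opH_eq, Matrix.diagonal_apply, Matrix.diagonal_apply]
  simp only [Fin.rev_inj, Fin.val_rev]
  split_ifs with h
  · have hi := a.is_lt
    rw [Nat.cast_sub (by omega)]
    push_cast
    ring
  · simp

theorem opH_mul_opZp : opH J * opZp J = opZp J * opH J + 2 * opZp J := by
  rw [opH_eq]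
  ext a i
  rw [two_mul, Matrix.add_apply, Matrix.add_apply, Matrix.diagonal_mul, Matrix.mul_diagonal]
  by_cases h : (a : ℕ) = i + 1
  · rw [h]; push_cast; ring
  · rw [opZp_apply_of_ne h]; ring

theorem opZm_mul_opZp : opZm J * opZp J = opZp J * opZm J - opH J := by
  ext a i
  rw [Matrix.sub_apply, opZm_mul_opZp_apply, opZp_mul_opZm_apply, opH_eq, Matrix.diagonal_apply]
  split_ifs with h
  · subst h; push_cast; ring
  · simp

theorem alpha_pos (i : Fin (J + 1)) : 0 < alpha i := by
  unfold alpha; positivity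

/-- A single step of `Z₊` has matrix element `alpha (i + 1) / alpha i`, so the product along a chain
telescopes. -/
theorem opZp_pow_apply (k : ℕ) (a i : Fin (J + 1)) :
    (opZp J ^ k) a i = if (a : ℕ) = i + k then ((alpha a / alpha i : ℝ) : ℂ) else 0 := by
  induction k generalizing a with
  | zero =>
    rw [pow_zero, Matrix.one_apply]
    simp only [add_zero, Fin.val_inj]
    split_ifs with h
    · subst h; rw [div_self (alpha_pos a).ne']; simp
    · rfl
  | succ k ih =>
    rw [pow_succ', Matrix.mul_apply]
    simp only [ih]
    by_cases h : (a : ℕ) = i + (k + 1)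
    · rw [if_pos h, Finset.sum_eq_single ⟨i + k, by omega⟩]
      · rw [if_pos rfl, opZp, Matrix.of_apply, if_pos (by simp only; omega), ← Complex.ofReal_mul]
        congr 1
        rw [← mul_div_assoc]
        congr 1
        have hlt : (i : ℕ) + k < J := by omega
        obtain ⟨c, hc⟩ : ∃ c, J = i + k + 1 + c := ⟨J - (i + k + 1), by omega⟩
        have e1 : J - (i + (k + 1)) = c := by omega
        have e2 : J - (i + k) = c + 1 := by omega
        have e3 : (J : ℝ) - ((i + k : ℕ) : ℝ) = c + 1 := by
          have := congrArg (Nat.cast (R := ℝ)) hc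
          push_cast at this ⊢
          linear_combination this
        simp only [alpha, h, e1, e2, e3]
        rw [← Real.sqrt_mul (by positivity)]
        congr 1
        rw [show (i : ℕ) + (k + 1) = (i + k) + 1 by ring, Nat.factorial_succ, Nat.factorial_succ]
        have h3 : ((c ! : ℕ) : ℝ) ≠ 0 := by exact_mod_cast c.factorial_ne_zero
        push_cast
        field_simp
      · intro b _ hb
        rw [if_neg, mul_zero]
        intro h'; exact hb (Fin.ext h')
      · simp
    · rw [if_neg h, Finset.sum_eq_zero]
      intro b _
      split_ifs with h1
      · rw [opZp_apply_of_ne (by omega), zero_mul]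
      · rw [mul_zero]

/-- The weight on `V^(j)`. -/
def wt (i : Fin (J + 1)) : ℕ := i

theorem wt_le (i : Fin (J + 1)) : wt i ≤ J := Nat.lt_succ_iff.mp i.is_lt

theorem opZp_raises : Raises wt 1 (opZp J) := by
  intro a i h
  by_contra h'
  exact h (opZp_apply_of_ne fun e => h' (by simp only [wt]; omega))

theorem opZp_pow_eq_zero : opZp J ^ (J + 1) = 0 := opZp_raises.pow_eq_zero wt_le

end SingleSpin

/-! ### Truncated exponential and artanh of nilpotent elements -/

section Exp

variable {n : Type*} [Fintype n] [DecidableEq n]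

theorem exp_eq_sum {A : Matrix n n ℂ} {N : ℕ} (hA : A ^ N = 0) :
    NormedSpace.exp A = ∑ k ∈ Finset.range N, ((k ! : ℂ)⁻¹) • A ^ k := by
  rw [NormedSpace.exp_eq_tsum ℂ]
  refine tsum_eq_sum fun k hk => ?_
  rw [← Nat.sub_add_cancel (not_lt.mp (Finset.mem_range.not.mp hk)), pow_add, hA, mul_zero,
    smul_zero]

theorem Raises.exp_sum_sub_one {w : n → ℕ} {A : Matrix n n ℂ} (hA : Raises w 1 A) (N : ℕ) :
    Raises w 1 (∑ k ∈ Finset.range (N + 1), ((k ! : ℂ)⁻¹) • A ^ k - 1) := by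
  rw [Finset.sum_range_succ', pow_zero, Nat.factorial_zero, Nat.cast_one, inv_one, one_smul,
    add_sub_cancel_right]
  exact Raises.sum fun i _ => ((hA.pow (i + 1)).mono (by simp)).smul _

variable {S R : Type*} [CommRing S] [Algebra ℂ S] [Ring R] [Algebra ℂ R]

/-- The truncated series `(1 / t) artanh (t z) = ∑ t^(2 * k) / (2 * k + 1) z^(2 * k + 1)`. -/
noncomputable def artanhSum {R : Type*} [Ring R] [Algebra ℂ R] (t : ℂ) (N : ℕ) (z : R) : R :=
  ∑ k ∈ Finset.range N, (t ^ (2 * k) / (2 * (k : ℂ) + 1)) • z ^ (2 * k + 1)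

theorem map_artanhSum {R' : Type*} [Ring R'] [Algebra ℂ R'] (ι : R' →ₐ[ℂ] R) (t : ℂ) (N : ℕ)
    (z : R') :
    ι (artanhSum t N z) = artanhSum t N (ι z) := by
  simp [artanhSum]

/-- Allows one common truncation length for the spins `j₁`, `j₂`, `j` and for the tensor product. -/
theorem artanhSum_eq_of_le {t : ℂ} {M N : ℕ} {z : R} (hz : z ^ M = 0) (h : M ≤ N) :
    artanhSum t N z = artanhSum t M z := by
  unfold artanhSum
  refine (Finset.sum_subset (Finset.range_mono h) fun k _ hk => ?_).symm
  have : M ≤ 2 * k + 1 := by have := Finset.mem_range.not.mp hk; omega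
  rw [← Nat.sub_add_cancel this, pow_add, hz, mul_zero, smul_zero]

theorem opX_eq_artanhSum {h : ℂ} {J : ℕ} {N : ℕ} (hN : J + 1 ≤ N) :
    opX h J = artanhSum (h / 2) N (opZp J) := by
  rw [artanhSum_eq_of_le opZp_pow_eq_zero hN]; rfl

/-- Truncated geometric series `1 / (1 - t² z²)`. -/
noncomputable def geomSum (t : ℂ) (N : ℕ) (z : S) : S :=
  ∑ k ∈ Finset.range N, (algebraMap ℂ S t ^ 2 * z ^ 2) ^ k

theorem geomSum_mul {t : ℂ} {N : ℕ} {z : S} (hz : z ^ N = 0) :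
    geomSum t N z * (1 - algebraMap ℂ S t ^ 2 * z ^ 2) = 1 := by
  have : (algebraMap ℂ S t ^ 2 * z ^ 2) ^ N = 0 := by
    rw [mul_pow, ← pow_mul z, mul_comm 2, pow_mul z, hz]; simp
  rw [geomSum, geom_sum_mul_neg, this, sub_zero]

theorem EulerDer.artanhSum {ι : S →ₐ[ℂ] R} {H : R} {f f' : S} (hf : EulerDer ι H f f') (t : ℂ)
    (N : ℕ) : EulerDer ι H (artanhSum t N f) (geomSum t N f * f') := by
  have key := EulerDer.sum fun k (_ : k ∈ Finset.range N) =>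
    (hf.pow (2 * k + 1)).smul (t ^ (2 * k) / (2 * (k : ℂ) + 1))
  unfold Jordanian.artanhSum
  convert key using 1
  rw [geomSum, Finset.sum_mul]
  refine Finset.sum_congr rfl fun k _ => ?_
  have h : (2 * (k : ℂ) + 1) ≠ 0 := by exact_mod_cast (2 * k).succ_ne_zero
  have h2 : algebraMap ℂ S (t ^ (2 * k) / (2 * k + 1)) * (2 * (k : S) + 1) =
      algebraMap ℂ S t ^ (2 * k) := by
    rw [← map_pow, ← map_natCast (algebraMap ℂ S) k, ← map_ofNat (algebraMap ℂ S) 2, ← map_mul,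
      ← map_one (algebraMap ℂ S), ← map_add, ← map_mul, div_mul_cancel₀ _ h]
  rw [Algebra.smul_def, Nat.add_sub_cancel]
  push_cast
  rw [mul_pow, ← pow_mul, ← pow_mul, ← h2]
  ring

end Exp

/-! ### Exponentials of `X` as rational functions of `Z₊` -/

section ExpX

variable (h : ℂ) (J : ℕ)

theorem opX_raises : Raises wt 1 (opX h J) :=
  Raises.sum fun k _ => ((opZp_raises.pow (2 * k + 1)).mono (by simp)).smul _

theorem expX_add (a b : ℂ) : expX h J (a + b) = expX h J a * expX h J b := by
  unfold expX
  rw [add_smul, Matrix.exp_add_of_commute]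
  exact ((Commute.refl _).smul_left _).smul_right _

theorem expX_zero : expX h J 0 = 1 := by simp [expX]

/-- The quotient `e^{hX} (1 - t Z₊) / (1 + t Z₊)` has zero Euler derivative, hence commutes with
`H`; being unipotent, it is 1 by rigidity. -/
theorem expX_mul_one_sub :
    expX h J h * (1 - (h / 2) • opZp J) = 1 + (h / 2) • opZp J := by
  obtain ⟨S, _, _, ι, z, -, hι, hz, -⟩ := exists_commRing_algHom (Commute.refl (opZp J))
  have hzN : z ^ (J + 1) = 0 := hι (by rw [map_pow, hz, opZp_pow_eq_zero, map_zero])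
  have hzd : EulerDer ι (opH J) z (2 * z) := by
    unfold EulerDer
    rw [map_mul, hz, opH_mul_opZp, map_ofNat]
  have hX : ι (artanhSum (h / 2) (J + 1) z) = opX h J := by
    rw [map_artanhSum, hz, opX_eq_artanhSum le_rfl]
  have hXd := (hzd.artanhSum (h / 2) (J + 1)).smul h
  have hXN : (h • artanhSum (h / 2) (J + 1) z) ^ (J + 1) = 0 := hι (by
    rw [map_pow, map_smul, hX, map_zero]
    exact ((opX_raises h J).smul h).pow_eq_zero wt_le)
  have hE := hXd.exp_sum hXN
  have hexp : expX h J h = ι (∑ k ∈ Finset.range (J + 1 + 1),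
      ((k ! : ℂ)⁻¹) • (h • artanhSum (h / 2) (J + 1) z) ^ k) := by
    rw [expX, exp_eq_sum (N := J + 1 + 1)]
    · simp [hX]
    · rw [← hX, ← map_smul, ← map_pow, pow_succ, hXN]; simp
  have hG := geomSum_mul (t := h / 2) hzN
  set e := ∑ k ∈ Finset.range (J + 1 + 1), ((k ! : ℂ)⁻¹) • (h • artanhSum (h / 2) (J + 1) z) ^ k
  set T := algebraMap ℂ S (h / 2) with hT
  have hTz : EulerDer ι (opH J) (T * z) (2 * (T * z)) := by
    have := hzd.smul (h / 2)
    rwa [Algebra.smul_def, Algebra.smul_def, ← hT, mul_left_comm] at this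
  set g := ∑ k ∈ Finset.range (J + 1), (-(T * z)) ^ k with hg
  have hgi : (1 + T * z) * g = 1 := by
    rw [← sub_neg_eq_add 1 (T * z), mul_neg_geom_sum, neg_pow, mul_pow, hzN]; simp
  have h1 : EulerDer ι (opH J) (1 + T * z) (2 * (T * z)) := by
    simpa using EulerDer.one.add hTz
  have h2 : EulerDer ι (opH J) (1 - T * z) (-(2 * (T * z))) := by
    simpa [sub_eq_add_neg] using EulerDer.one.add (hTz.smul (-1))
  have hh : algebraMap ℂ S h = 2 * T := by
    rw [hT, ← map_ofNat (algebraMap ℂ S) 2, ← map_mul]; congr 1; ring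
  have hM := (hE.mul h2).mul (h1.inv hgi)
  -- The derivative of `hX` is `4 T z / (1 - T² z²)`, which is minus the logarithmic derivative of
  -- `(1 - T z) / (1 + T z)`.
  have h0 : (e * (h • (geomSum (h / 2) (J + 1) z * (2 * z))) * (1 - T * z) + e * -(2 * (T * z))) * g +
      e * (1 - T * z) * -(2 * (T * z) * g ^ 2) = 0 := by
    rw [Algebra.smul_def, hh]
    generalize geomSum (h / 2) (J + 1) z = G at *
    grind
  rw [h0] at hM
  have hιT : ι (T * z) = (h / 2) • opZp J := by
    rw [hT, ← Algebra.smul_def, map_smul, hz]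
  have hzr : Raises wt 1 (ι (T * z)) := by rw [hιT]; exact opZp_raises.smul _
  have hr : Raises wt 1 (ι (e * (1 - T * z) * g) - 1) := by
    rw [map_mul, map_mul]
    refine Raises.mul_sub_one (Raises.mul_sub_one ?_ ?_) ?_
    · rw [map_sum]
      simp only [map_smul, map_pow]
      rw [hX]
      exact ((opX_raises h J).smul h).exp_sum_sub_one _
    · rw [map_sub, map_one, sub_sub_cancel_left]
      exact hzr.neg
    · rw [hg, map_sum]
      simp only [map_pow]
      exact Raises.geom_sum_sub_one (by rw [map_neg]; exact hzr.neg) _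
  have hone : ι (e * (1 - T * z) * g) - 1 = 0 := by
    refine hr.eq_zero_of_commute (D := fun i : Fin (J + 1) => ((2 * (i : ℤ) - J : ℤ) : ℂ)) ?_ ?_
    · intro a b hab
      have := Int.cast_injective hab
      simp only [wt]; omega
    · rw [← opH_eq]
      refine .sub_right ?_ (.one_right _)
      unfold EulerDer at hM
      rw [map_zero, add_zero] at hM
      exact hM
  have : e * (1 - T * z) = 1 + T * z := by
    have h3 : e * (1 - T * z) * g = 1 := hι (by rw [map_one]; exact sub_eq_zero.mp hone)
    linear_combination (1 + T * z) * h3 - e * (1 - T * z) * hgi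
  rw [hexp, ← hιT, ← map_one ι, ← map_sub, ← map_mul, this, map_add]

/-- `cosh (hX/2) e^{hX/2} = (e^{hX} + 1) / 2 = 1 / (1 - t Z₊)`. It also exhibits an inverse of the
cosh. -/
theorem coshX_mul_expX : coshX h J * expX h J (h / 2) * (1 - (h / 2) • opZp J) = 1 := by
  rw [coshX, smul_mul_assoc, add_mul, ← expX_add, ← expX_add, add_halves, neg_add_cancel,
    expX_zero, smul_mul_assoc, add_mul, expX_mul_one_sub, one_mul, add_add_sub_cancel, ← two_smul ℂ,
    smul_smul]
  norm_num

theorem coshX_mul_expX_neg : coshX h J * expX h J (-(h / 2)) * (1 + (h / 2) • opZp J) = 1 := by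
  have : expX h J (-h) * (1 + (h / 2) • opZp J) = 1 - (h / 2) • opZp J := by
    rw [← expX_mul_one_sub, ← mul_assoc, ← expX_add, neg_add_cancel, expX_zero, one_mul]
  rw [coshX, smul_mul_assoc, add_mul, ← expX_add, ← expX_add, add_neg_cancel, ← neg_add, add_halves,
    expX_zero, smul_mul_assoc, add_mul, this, one_mul, add_add_sub_cancel, ← two_smul ℂ, smul_smul]
  norm_num

/-- This is `tanh (hX/2) = t Z₊`, the defining relation of `X`. -/
theorem expX_sub_expX_neg :
    expX h J (h / 2) - expX h J (-(h / 2)) =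
      (expX h J (h / 2) + expX h J (-(h / 2))) * ((h / 2) • opZp J) := by
  have e1 : expX h J h = expX h J (h / 2) * expX h J (h / 2) := by rw [← expX_add, add_halves]
  have e2 : expX h J (-(h / 2)) * expX h J (h / 2) = 1 := by
    rw [← expX_add, neg_add_cancel, expX_zero]
  have h1 := congrArg (expX h J (-(h / 2)) * ·) (expX_mul_one_sub h J)
  simp only [e1, ← mul_assoc, e2, one_mul, mul_sub, mul_add, mul_one] at h1
  rw [add_mul, ← sub_eq_zero, ← sub_eq_zero.mpr h1]
  abel

end ExpX

end Jordanian

namespace Jordanian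

open scoped Nat Kronecker

/-! ### The two legs of the tensor product -/

section Kronecker

variable {m n : Type*} [Fintype m] [Fintype n] [DecidableEq m] [DecidableEq n]

/-- `A ↦ A ⊗ 1`. -/
def leftHom (m n : Type*) [Fintype m] [Fintype n] [DecidableEq m] [DecidableEq n] :
    Matrix m m ℂ →ₐ[ℂ] Matrix (m × n) (m × n) ℂ :=
  AlgHom.ofLinearMap
    { toFun := fun A => A ⊗ₖ (1 : Matrix n n ℂ)
      map_add' := fun A B => Matrix.add_kronecker A B 1
      map_smul' := fun c A => Matrix.smul_kronecker c A 1 }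
    (Matrix.one_kronecker_one)
    (fun A B => by
      change (A * B) ⊗ₖ (1 : Matrix n n ℂ) = A ⊗ₖ 1 * B ⊗ₖ 1
      rw [← Matrix.mul_kronecker_mul, one_mul])

/-- `B ↦ 1 ⊗ B`. -/
def rightHom (m n : Type*) [Fintype m] [Fintype n] [DecidableEq m] [DecidableEq n] :
    Matrix n n ℂ →ₐ[ℂ] Matrix (m × n) (m × n) ℂ :=
  AlgHom.ofLinearMap
    { toFun := fun B => (1 : Matrix m m ℂ) ⊗ₖ B
      map_add' := fun A B => Matrix.kronecker_add 1 A B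
      map_smul' := fun c A => Matrix.kronecker_smul c 1 A }
    (Matrix.one_kronecker_one)
    (fun A B => by
      change (1 : Matrix m m ℂ) ⊗ₖ (A * B) = 1 ⊗ₖ A * 1 ⊗ₖ B
      rw [← Matrix.mul_kronecker_mul, one_mul])

theorem leftHom_apply (A : Matrix m m ℂ) : leftHom m n A = A ⊗ₖ 1 := rfl

theorem rightHom_apply (B : Matrix n n ℂ) : rightHom m n B = 1 ⊗ₖ B := rfl

theorem leftHom_mul_rightHom (A : Matrix m m ℂ) (B : Matrix n n ℂ) :
    leftHom m n A * rightHom m n B = A ⊗ₖ B := by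
  rw [leftHom_apply, rightHom_apply, ← Matrix.mul_kronecker_mul, one_mul, mul_one]

theorem rightHom_mul_leftHom (A : Matrix m m ℂ) (B : Matrix n n ℂ) :
    rightHom m n B * leftHom m n A = A ⊗ₖ B := by
  rw [leftHom_apply, rightHom_apply, ← Matrix.mul_kronecker_mul, one_mul, mul_one]

theorem commute_leftHom_rightHom (A : Matrix m m ℂ) (B : Matrix n n ℂ) :
    Commute (leftHom m n A) (rightHom m n B) := by
  rw [Commute, SemiconjBy, leftHom_mul_rightHom, rightHom_mul_leftHom]

theorem exp_algHom (f : Matrix m m ℂ →ₐ[ℂ] Matrix n n ℂ) {A : Matrix m m ℂ} {N : ℕ}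
    (hA : A ^ N = 0) : NormedSpace.exp (f A) = f (NormedSpace.exp A) := by
  rw [exp_eq_sum hA, exp_eq_sum (N := N) (by rw [← map_pow, hA, map_zero])]
  simp

omit [Fintype n] [DecidableEq m] [DecidableEq n] in
-- The twist is a different function of the raising operators on each column; this permits replacing
-- it by a single function on vectors of one weight pair.
theorem mul_congr_of_support {l : Type*} {A B : Matrix l m ℂ} {X : Matrix m n ℂ}
    (h : ∀ a b, X a b ≠ 0 → ∀ c, A c a = B c a) : A * X = B * X := by
  ext c b
  rw [Matrix.mul_apply, Matrix.mul_apply]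
  refine Finset.sum_congr rfl fun a _ => ?_
  by_cases hx : X a b = 0
  · rw [hx, mul_zero, mul_zero]
  · rw [h a b hx c]

theorem ext_mul_single {A B : Matrix m m ℂ}
    (h : ∀ i, A * Matrix.single i i 1 = B * Matrix.single i i 1) : A = B := by
  ext a i
  simpa using congrFun (congrFun (h i) a) i

end Kronecker

/-! ### The twist matrix as a function of the raising operators -/

variable {J₁ J₂ : ℕ}

/-- The total weight on `V^(j₁) ⊗ V^(j₂)`. -/
def wt₂ (p : Fin (J₁ + 1) × Fin (J₂ + 1)) : ℕ := p.1 + p.2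

theorem wt₂_le (p : Fin (J₁ + 1) × Fin (J₂ + 1)) : wt₂ p ≤ J₁ + J₂ := by
  have := p.1.is_lt; have := p.2.is_lt; simp only [wt₂]; omega

theorem Raises.leftHom {d : ℕ} {A : Matrix (Fin (J₁ + 1)) (Fin (J₁ + 1)) ℂ} (hA : Raises wt d A) :
    Raises wt₂ d (leftHom _ (Fin (J₂ + 1)) A) := by
  intro a b hab
  rw [leftHom_apply, Matrix.kroneckerMap_apply] at hab
  have h1 := hA _ _ (left_ne_zero_of_mul hab)
  have h2 : a.2 = b.2 := by
    by_contra h; exact right_ne_zero_of_mul hab (Matrix.one_apply_ne h)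
  simp only [wt₂, wt, h2] at *
  omega

theorem Raises.rightHom {d : ℕ} {A : Matrix (Fin (J₂ + 1)) (Fin (J₂ + 1)) ℂ} (hA : Raises wt d A) :
    Raises wt₂ d (rightHom (Fin (J₁ + 1)) _ A) := by
  intro a b hab
  rw [rightHom_apply, Matrix.kroneckerMap_apply] at hab
  have h1 := hA _ _ (right_ne_zero_of_mul hab)
  have h2 : a.1 = b.1 := by
    by_contra h; exact left_ne_zero_of_mul hab (Matrix.one_apply_ne h)
  simp only [wt₂, wt, h2] at *
  omega

/-- The matrix with entries `a^{m₁,m₂}_{n₁-m₁,n₂-m₂} α_{j₁,n₁} α_{j₂,n₂} / (α_{j₁,m₁} α_{j₂,m₂})`. -/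
noncomputable def twistMatrix (h : ℂ) (J₁ J₂ : ℕ) :
    Matrix (Fin (J₁ + 1) × Fin (J₂ + 1)) (Fin (J₁ + 1) × Fin (J₂ + 1)) ℂ :=
  Matrix.of fun n p =>
    coeffA h (mag p.1) (mag p.2) ((n.1 : ℤ) - (p.1 : ℤ)) ((n.2 : ℤ) - (p.2 : ℤ)) *
      ((alpha n.1 * alpha n.2 / (alpha p.1 * alpha p.2) : ℝ) : ℂ)

/-- A model of the commutative algebra generated by `Z₊ ⊗ 1` and `1 ⊗ Z₊`, with the units
`1 + t z₁`, `1 - t z₂`, `1 + t² z₁ z₂`, where `t = h / 2`. -/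
structure RaisingModel (h : ℂ) (J₁ J₂ : ℕ) (S : Type) [CommRing S] [Algebra ℂ S] where
  ι : S →ₐ[ℂ] Matrix (Fin (J₁ + 1) × Fin (J₂ + 1)) (Fin (J₁ + 1) × Fin (J₂ + 1)) ℂ
  z₁ : S
  z₂ : S
  u : Sˣ
  v : Sˣ
  s : Sˣ
  inj : Function.Injective ι
  map_z₁ : ι z₁ = leftHom _ _ (opZp J₁)
  map_z₂ : ι z₂ = rightHom _ _ (opZp J₂)
  hu : (u : S) = 1 + algebraMap ℂ S (h / 2) * z₁
  hv : (v : S) = 1 - algebraMap ℂ S (h / 2) * z₂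
  hs : (s : S) = 1 + algebraMap ℂ S (h / 2) ^ 2 * z₁ * z₂

theorem exists_raisingModel (h : ℂ) (J₁ J₂ : ℕ) :
    ∃ (S : Type) (_ : CommRing S) (_ : Algebra ℂ S), Nonempty (RaisingModel h J₁ J₂ S) := by
  obtain ⟨S, _, _, ι, z₁, z₂, hι, h₁, h₂⟩ :=
    exists_commRing_algHom (commute_leftHom_rightHom (opZp J₁) (opZp J₂))
  have n₁ : IsNilpotent z₁ := ⟨J₁ + 1, hι (by rw [map_pow, h₁, ← map_pow, opZp_pow_eq_zero]; simp)⟩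
  have n₂ : IsNilpotent z₂ := ⟨J₂ + 1, hι (by rw [map_pow, h₂, ← map_pow, opZp_pow_eq_zero]; simp)⟩
  obtain ⟨u, hu⟩ : IsUnit (1 + algebraMap ℂ S (h / 2) * z₁) :=
    ((Commute.all _ _).isNilpotent_mul_left n₁).isUnit_one_add
  obtain ⟨v, hv⟩ : IsUnit (1 - algebraMap ℂ S (h / 2) * z₂) :=
    ((Commute.all _ _).isNilpotent_mul_left n₂).isUnit_one_sub
  obtain ⟨s, hs⟩ : IsUnit (1 + algebraMap ℂ S (h / 2) ^ 2 * z₁ * z₂) :=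
    ((Commute.all _ _).isNilpotent_mul_left n₂).isUnit_one_add
  exact ⟨S, _, _, ⟨ι, z₁, z₂, u, v, s, hι, h₁, h₂, hu, hv, hs⟩⟩

namespace RaisingModel

variable {h : ℂ} {S : Type} [CommRing S] [Algebra ℂ S] (D : RaisingModel h J₁ J₂ S)

theorem z₁_pow : D.z₁ ^ (J₁ + 1) = 0 :=
  D.inj (by rw [map_pow, D.map_z₁, ← map_pow, opZp_pow_eq_zero]; simp)

theorem z₂_pow : D.z₂ ^ (J₂ + 1) = 0 :=
  D.inj (by rw [map_pow, D.map_z₂, ← map_pow, opZp_pow_eq_zero]; simp)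

theorem tensorSL2 : TensorSL2 D.ι (leftHom _ _ (opH J₁)) (leftHom _ _ (opZm J₁))
    (rightHom _ _ (opH J₂)) (rightHom _ _ (opZm J₂)) D.z₁ D.z₂ where
  h₁ := by rw [D.map_z₁, ← map_mul, opH_mul_opZp, map_add, map_mul, map_mul, map_ofNat]
  h₂ := by rw [D.map_z₂, ← map_mul, opH_mul_opZp, map_add, map_mul, map_mul, map_ofNat]
  c₁ := by rw [D.map_z₁, ← map_mul, opZm_mul_opZp, map_sub, map_mul]
  c₂ := by rw [D.map_z₂, ← map_mul, opZm_mul_opZp, map_sub, map_mul]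
  h₁₂ := by rw [D.map_z₂]; exact commute_leftHom_rightHom _ _
  h₂₁ := by rw [D.map_z₁]; exact (commute_leftHom_rightHom _ _).symm
  c₁₂ := by rw [D.map_z₂]; exact commute_leftHom_rightHom _ _
  c₂₁ := by rw [D.map_z₁]; exact (commute_leftHom_rightHom _ _).symm

/-- The coefficient of `z₁^k z₂^l` in the twist is the `a` with indices `k`, `l`, and the ratios of
`alpha` in the entry are the matrix elements of `z₁^k z₂^l`. -/
theorem twistMatrix_apply (a p : Fin (J₁ + 1) × Fin (J₂ + 1)) :
    twistMatrix h J₁ J₂ a p =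
      D.ι (twist D.u D.v D.s (2 * (p.1 : ℕ) - J₁) (2 * (p.2 : ℕ) - J₂)) a p := by
  have hm₁ : mag p.1 = (((2 * (p.1 : ℕ) - J₁ : ℤ)) : ℚ) / 2 := by
    simp only [mag]; push_cast; ring
  have hm₂ : mag p.2 = (((2 * (p.2 : ℕ) - J₂ : ℤ)) : ℚ) / 2 := by
    simp only [mag]; push_cast; ring
  -- The choice `x = -t z₁`, `y = t z₂` accounts for the sign `(-1)^k` in `coeffA`.
  have key := truncSum_coeffB_sub (S := S) (Nat.succ_pos J₁) (Nat.succ_pos J₂) (u := D.u)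
    (v := D.v) (s := D.s) (x := -(algebraMap ℂ S (h / 2) * D.z₁))
    (y := algebraMap ℂ S (h / 2) * D.z₂) (by rw [neg_pow, mul_pow, D.z₁_pow]; simp)
    (by rw [mul_pow, D.z₂_pow]; simp) (by rw [D.hu]; ring) D.hv (by rw [D.hs]; ring)
    (2 * (p.1 : ℕ) - J₁) (2 * (p.2 : ℕ) - J₂)
  rw [← hm₁, ← hm₂] at key
  rw [← key, truncSum]
  have hent : ∀ k l : ℕ, D.ι ((-(algebraMap ℂ S (h / 2) * D.z₁)) ^ k *
      (algebraMap ℂ S (h / 2) * D.z₂) ^ l) a p = (-1) ^ k * (h / 2) ^ (k + l) *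
        ((if (a.1 : ℕ) = p.1 + k then ((alpha a.1 / alpha p.1 : ℝ) : ℂ) else 0) *
          (if (a.2 : ℕ) = p.2 + l then ((alpha a.2 / alpha p.2 : ℝ) : ℂ) else 0)) := by
    intro k l
    rw [← Algebra.smul_def, ← Algebra.smul_def, ← neg_smul, smul_pow, smul_pow, smul_mul_smul_comm,
      map_smul, map_mul, map_pow, map_pow, D.map_z₁, D.map_z₂, ← map_pow, ← map_pow,
      leftHom_mul_rightHom, Matrix.smul_apply, Matrix.kroneckerMap_apply, opZp_pow_apply,
      opZp_pow_apply, smul_eq_mul, neg_pow, pow_add]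
    ring
  simp only [map_sum, map_smul, Matrix.sum_apply, Matrix.smul_apply, hent]
  rw [twistMatrix, Matrix.of_apply]
  by_cases h1 : p.1 ≤ a.1
  · by_cases h2 : p.2 ≤ a.2
    · obtain ⟨k, hk⟩ : ∃ k : ℕ, (a.1 : ℕ) = p.1 + k := ⟨a.1 - p.1, by omega⟩
      obtain ⟨l, hl⟩ : ∃ l : ℕ, (a.2 : ℕ) = p.2 + l := ⟨a.2 - p.2, by omega⟩
      have hka := a.1.is_lt
      have hla := a.2.is_lt
      rw [Finset.sum_eq_single k, Finset.sum_eq_single l, if_pos hk, if_pos hl,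
        show ((a.1 : ℕ) : ℤ) - (p.1 : ℕ) = k by omega, show ((a.2 : ℕ) : ℤ) - (p.2 : ℕ) = l by omega]
      · rw [coeffA, smul_eq_mul, zpow_natCast, ← Nat.cast_add, zpow_natCast]
        push_cast
        rw [mul_div_mul_comm]
        ring
      · intro l' _ hl'
        rw [if_neg (c := (a.2 : ℕ) = p.2 + l') (by omega)]
        simp
      · intro hl'; exact absurd (Finset.mem_range.mpr (by omega)) hl'
      · intro k' _ hk'
        refine Finset.sum_eq_zero fun l' _ => ?_
        rw [if_neg (c := (a.1 : ℕ) = p.1 + k') (by omega)]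
        simp
      · intro hk'; exact absurd (Finset.mem_range.mpr (by omega)) hk'
    · rw [coeffA, coeffB_of_neg_right _ _ (by omega), coeffB_of_neg_right _ _ (by omega),
        Finset.sum_eq_zero]
      · simp
      · intro k _
        refine Finset.sum_eq_zero fun l _ => ?_
        rw [if_neg (c := (a.2 : ℕ) = p.2 + l) (by omega)]
        simp
  · rw [coeffA, coeffB_of_neg_left _ _ (by omega), coeffB_of_neg_left _ _ (by omega),
      Finset.sum_eq_zero]
    · simp
    · intro k _
      refine Finset.sum_eq_zero fun l _ => ?_
      rw [if_neg (c := (a.1 : ℕ) = p.1 + k) (by omega)]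
      simp

end RaisingModel

end Jordanian

/-! ### Intertwining of the deformed coproducts of `H`, `Z₊`, `Z₋` -/

namespace Jordanian

open scoped Nat Kronecker

variable {J₁ J₂ : ℕ}

theorem leftHom_opH : leftHom _ (Fin (J₂ + 1)) (opH J₁) =
    Matrix.diagonal fun p => ((2 * (p.1 : ℤ) - J₁ : ℤ) : ℂ) := by
  rw [leftHom_apply, opH_eq, ← Matrix.diagonal_one, Matrix.diagonal_kronecker_diagonal]
  simp only [mul_one]

theorem rightHom_opH : rightHom (Fin (J₁ + 1)) _ (opH J₂) =
    Matrix.diagonal fun p => ((2 * (p.2 : ℤ) - J₂ : ℤ) : ℂ) := by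
  rw [rightHom_apply, opH_eq, ← Matrix.diagonal_one, Matrix.diagonal_kronecker_diagonal]
  simp only [one_mul]

theorem diagonal_intCast_mul_single {n : Type*} [Fintype n] [DecidableEq n] (f : n → ℤ) (p : n) :
    Matrix.diagonal (fun p => (f p : ℂ)) * Matrix.single p p 1 =
      ((f p : ℤ) : Matrix n n ℂ) * Matrix.single p p 1 := by
  rw [← zsmul_eq_mul]
  ext a b
  rw [Matrix.diagonal_mul, Matrix.smul_apply, zsmul_eq_mul, Matrix.single_apply]
  split_ifs with h
  · rw [h.1]
  · simp

theorem leftHom_opH_mul_single (p : Fin (J₁ + 1) × Fin (J₂ + 1)) :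
    leftHom _ _ (opH J₁) * Matrix.single p p 1 =
      ((2 * (p.1 : ℕ) - J₁ : ℤ) : Matrix (Fin (J₁ + 1) × Fin (J₂ + 1)) _ ℂ) *
        Matrix.single p p 1 := by
  rw [leftHom_opH]
  have := diagonal_intCast_mul_single
    (fun p : Fin (J₁ + 1) × Fin (J₂ + 1) => 2 * ((p.1 : ℕ) : ℤ) - J₁) p
  exact this

theorem rightHom_opH_mul_single (p : Fin (J₁ + 1) × Fin (J₂ + 1)) :
    rightHom _ _ (opH J₂) * Matrix.single p p 1 =
      ((2 * (p.2 : ℕ) - J₂ : ℤ) : Matrix (Fin (J₁ + 1) × Fin (J₂ + 1)) _ ℂ) *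
        Matrix.single p p 1 := by
  rw [rightHom_opH]
  have := diagonal_intCast_mul_single
    (fun p : Fin (J₁ + 1) × Fin (J₂ + 1) => 2 * ((p.2 : ℕ) : ℤ) - J₂) p
  exact this

theorem leftHom_mul_single_ne_zero {A : Matrix (Fin (J₁ + 1)) (Fin (J₁ + 1)) ℂ}
    {p a b : Fin (J₁ + 1) × Fin (J₂ + 1)}
    (h : (leftHom _ (Fin (J₂ + 1)) A * Matrix.single p p (1 : ℂ)) a b ≠ 0) : A a.1 p.1 ≠ 0 ∧ a.2 = p.2 := by
  have hb : b = p := by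
    by_contra hne
    exact h (by rw [Matrix.mul_single_apply_of_ne _ _ _ _ _ hne])
  subst hb
  rw [Matrix.mul_single_apply_same, mul_one, leftHom_apply, Matrix.kroneckerMap_apply] at h
  refine ⟨left_ne_zero_of_mul h, ?_⟩
  by_contra hne
  exact right_ne_zero_of_mul h (Matrix.one_apply_ne hne)

theorem rightHom_mul_single_ne_zero {A : Matrix (Fin (J₂ + 1)) (Fin (J₂ + 1)) ℂ}
    {p a b : Fin (J₁ + 1) × Fin (J₂ + 1)}
    (h : (rightHom (Fin (J₁ + 1)) _ A * Matrix.single p p (1 : ℂ)) a b ≠ 0) : A a.2 p.2 ≠ 0 ∧ a.1 = p.1 := by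
  have hb : b = p := by
    by_contra hne
    exact h (by rw [Matrix.mul_single_apply_of_ne _ _ _ _ _ hne])
  subst hb
  rw [Matrix.mul_single_apply_same, mul_one, rightHom_apply, Matrix.kroneckerMap_apply] at h
  refine ⟨right_ne_zero_of_mul h, ?_⟩
  by_contra hne
  exact left_ne_zero_of_mul h (Matrix.one_apply_ne hne)

theorem commute_expX_opZp (h : ℂ) (J : ℕ) (c : ℂ) : Commute (expX h J c) (opZp J) := by
  have hX : Commute (opX h J) (opZp J) :=
    Commute.sum_left _ _ _ fun k _ => (((Commute.refl (opZp J)).pow_left _).smul_left _)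
  rw [expX, exp_eq_sum (((opX_raises h J).smul c).pow_eq_zero wt_le)]
  exact Commute.sum_left _ _ _ fun k _ => ((hX.smul_left c).pow_left k).smul_left _

theorem expX_neg_mul (h : ℂ) (J : ℕ) :
    expX h J (-h) * (1 + (h / 2) • opZp J) = 1 - (h / 2) • opZp J := by
  rw [← expX_mul_one_sub, ← mul_assoc, ← expX_add, neg_add_cancel, expX_zero, one_mul]

theorem coshX_mul_opY_mul_coshX (h : ℂ) (J : ℕ) : coshX h J * opY h J * coshX h J = opZm J := by
  have hc : IsUnit (coshX h J).det := by
    have := congrArg Matrix.det (coshX_mul_expX h J)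
    rw [Matrix.det_mul, Matrix.det_mul, Matrix.det_one, mul_assoc] at this
    exact IsUnit.of_mul_eq_one _ this
  rw [opY, ← mul_assoc, ← mul_assoc, Matrix.mul_nonsing_inv _ hc, one_mul, mul_assoc,
    Matrix.nonsing_inv_mul _ hc, mul_one]

theorem coshX_commute_expX (h : ℂ) (J : ℕ) (c : ℂ) : Commute (coshX h J) (expX h J c) := by
  refine .smul_left (.add_left ?_ ?_) _ <;>
  rw [Commute, SemiconjBy, ← expX_add, ← expX_add, add_comm c]

theorem coshX_mul_expX_mul_coshX (h : ℂ) (J : ℕ) (c : ℂ) :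
    coshX h J * expX h J (c + c) * coshX h J = (coshX h J * expX h J c) ^ 2 := by
  rw [expX_add, sq, ← mul_assoc, mul_assoc _ _ (coshX h J), ← (coshX_commute_expX h J c).eq]

/-- `cosh (h Δ(X) / 2)` -/
noncomputable def deltaCosh (h : ℂ) (J₁ J₂ : ℕ) :
    Matrix (Fin (J₁ + 1) × Fin (J₂ + 1)) (Fin (J₁ + 1) × Fin (J₂ + 1)) ℂ :=
  (1 / 2 : ℂ) • (NormedSpace.exp ((h / 2) • deltaX h J₁ J₂) +
    NormedSpace.exp ((-(h / 2)) • deltaX h J₁ J₂))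

theorem exp_smul_deltaX (h c : ℂ) (J₁ J₂ : ℕ) :
    NormedSpace.exp (c • deltaX h J₁ J₂) = expX h J₁ c ⊗ₖ expX h J₂ c := by
  have h₁ : (c • opX h J₁) ^ (J₁ + 1) = 0 := ((opX_raises h J₁).smul c).pow_eq_zero wt_le
  have h₂ : (c • opX h J₂) ^ (J₂ + 1) = 0 := ((opX_raises h J₂).smul c).pow_eq_zero wt_le
  rw [deltaX, smul_add, ← leftHom_apply, ← rightHom_apply, ← map_smul, ← map_smul,
    Matrix.exp_add_of_commute _ _ (commute_leftHom_rightHom _ _), exp_algHom _ h₁, exp_algHom _ h₂,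
    leftHom_mul_rightHom]
  rfl

namespace RaisingModel

variable {h : ℂ} {S : Type} [CommRing S] [Algebra ℂ S] (D : RaisingModel h J₁ J₂ S)

theorem twistMatrix_mul_single (p : Fin (J₁ + 1) × Fin (J₂ + 1)) :
    twistMatrix h J₁ J₂ * Matrix.single p p 1 =
      D.ι (twist D.u D.v D.s (2 * (p.1 : ℕ) - J₁) (2 * (p.2 : ℕ) - J₂)) * Matrix.single p p 1 := by
  refine mul_congr_of_support fun a b hab c => ?_
  have : p = a := by
    by_contra hne; exact hab (by simp [hne])
  rw [D.twistMatrix_apply, this]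

theorem map_mul_z₁ : D.ι (algebraMap ℂ S (h / 2) * D.z₁) =
    leftHom _ _ ((h / 2) • opZp J₁) := by
  rw [← Algebra.smul_def, map_smul, D.map_z₁, map_smul]

theorem map_mul_z₂ : D.ι (algebraMap ℂ S (h / 2) * D.z₂) =
    rightHom _ _ ((h / 2) • opZp J₂) := by
  rw [← Algebra.smul_def, map_smul, D.map_z₂, map_smul]

theorem map_u : D.ι D.u = leftHom _ _ (1 + (h / 2) • opZp J₁) := by
  rw [D.hu, map_add, D.map_mul_z₁, map_add, map_one, map_one]

theorem map_v : D.ι D.v = rightHom _ _ (1 - (h / 2) • opZp J₂) := by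
  rw [D.hv, map_sub, D.map_mul_z₂, map_sub, map_one, map_one]

theorem map_s : D.ι D.s = 1 + ((h / 2) • opZp J₁) ⊗ₖ ((h / 2) • opZp J₂) := by
  rw [D.hs, show algebraMap ℂ S (h / 2) ^ 2 * D.z₁ * D.z₂ = (algebraMap ℂ S (h / 2) * D.z₁) *
    (algebraMap ℂ S (h / 2) * D.z₂) by ring, map_add, map_mul, D.map_mul_z₁, D.map_mul_z₂,
    leftHom_mul_rightHom, map_one]

theorem eq_of_mul_unit {A : Matrix (Fin (J₁ + 1) × Fin (J₂ + 1)) (Fin (J₁ + 1) × Fin (J₂ + 1)) ℂ}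
    {w : Sˣ} {b : S} (hA : A * D.ι w = D.ι b) : A = D.ι (b * ↑w⁻¹) := by
  rw [map_mul, ← hA, mul_assoc, ← map_mul, Units.mul_inv, map_one, mul_one]

theorem leftHom_expX_neg : leftHom _ _ (expX h J₁ (-h)) =
    D.ι ((1 - algebraMap ℂ S (h / 2) * D.z₁) * ↑D.u⁻¹) := by
  refine D.eq_of_mul_unit ?_
  rw [D.map_u, ← map_mul, expX_neg_mul, map_sub, map_sub, D.map_mul_z₁, map_one, map_one]

theorem rightHom_expX : rightHom _ _ (expX h J₂ h) =
    D.ι ((1 + algebraMap ℂ S (h / 2) * D.z₂) * ↑D.v⁻¹) := by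
  refine D.eq_of_mul_unit ?_
  rw [D.map_v, ← map_mul, expX_mul_one_sub, map_add, map_add, D.map_mul_z₂, map_one, map_one]

theorem leftHom_coshX_mul : leftHom _ _ (coshX h J₁ * expX h J₁ (-(h / 2))) = D.ι ↑D.u⁻¹ := by
  rw [← one_mul (D.u⁻¹ : Sˣ).val]
  refine D.eq_of_mul_unit ?_
  rw [D.map_u, ← map_mul, coshX_mul_expX_neg, map_one, map_one]

theorem rightHom_coshX_mul : rightHom _ _ (coshX h J₂ * expX h J₂ (h / 2)) = D.ι ↑D.v⁻¹ := by
  rw [← one_mul (D.v⁻¹ : Sˣ).val]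
  refine D.eq_of_mul_unit ?_
  rw [D.map_v, ← map_mul, coshX_mul_expX, map_one, map_one]

/-- `Δ(H)` is intertwined with its undeformed counterpart. -/
theorem deltaH_mul_twistMatrix (D : RaisingModel h J₁ J₂ S) : deltaH h J₁ J₂ * twistMatrix h J₁ J₂ =
    twistMatrix h J₁ J₂ * (leftHom _ _ (opH J₁) + rightHom _ _ (opH J₂)) := by
  refine ext_mul_single fun p => ?_
  have e₁ := leftHom_opH_mul_single p
  have e₂ := rightHom_opH_mul_single p
  have key := D.tensorSL2.twist_H D.hu D.hv D.hs e₁ e₂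
  rw [← D.leftHom_expX_neg, ← D.rightHom_expX, leftHom_mul_rightHom, leftHom_mul_rightHom] at key
  rw [mul_assoc, D.twistMatrix_mul_single, deltaH, key, mul_assoc, add_mul, e₁, e₂, ← add_mul,
    ← Int.cast_add, Int.cast_comm, ← mul_assoc, ← mul_assoc, D.twistMatrix_mul_single]

/-- The deformed `Δ(Z₊)` is intertwined with its undeformed counterpart. -/
theorem deltaZp_mul_twistMatrix : D.ι ((D.z₁ + D.z₂) * ↑D.s⁻¹) * twistMatrix h J₁ J₂ =
    twistMatrix h J₁ J₂ * (leftHom _ _ (opZp J₁) + rightHom _ _ (opZp J₂)) := by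
  refine ext_mul_single fun p => ?_
  -- `Z₊ ⊗ 1` raises `m₁` by one, so the column met is the one with first exponent `2m₁ + 2`.
  have e₁ : twistMatrix h J₁ J₂ * (leftHom _ _ (opZp J₁) * Matrix.single p p 1) =
      D.ι (twist D.u D.v D.s (2 * (p.1 : ℕ) - J₁ + 2) (2 * (p.2 : ℕ) - J₂)) *
        (leftHom _ _ (opZp J₁) * Matrix.single p p 1) := by
    refine mul_congr_of_support fun a b hab c => ?_
    obtain ⟨h₁, h₂⟩ := leftHom_mul_single_ne_zero hab
    have h₃ : (a.1 : ℕ) = p.1 + 1 := by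
      by_contra hne; exact h₁ (opZp_apply_of_ne hne)
    rw [D.twistMatrix_apply, h₂,
      show (2 * ((a.1 : ℕ) : ℤ) - J₁) = 2 * (p.1 : ℕ) - J₁ + 2 by omega]
  have e₂ : twistMatrix h J₁ J₂ * (rightHom _ _ (opZp J₂) * Matrix.single p p 1) =
      D.ι (twist D.u D.v D.s (2 * (p.1 : ℕ) - J₁) (2 * (p.2 : ℕ) - J₂ + 2)) *
        (rightHom _ _ (opZp J₂) * Matrix.single p p 1) := by
    refine mul_congr_of_support fun a b hab c => ?_
    obtain ⟨h₁, h₂⟩ := rightHom_mul_single_ne_zero hab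
    have h₃ : (a.2 : ℕ) = p.2 + 1 := by
      by_contra hne; exact h₁ (opZp_apply_of_ne hne)
    rw [D.twistMatrix_apply, h₂,
      show (2 * ((a.2 : ℕ) : ℤ) - J₂) = 2 * (p.2 : ℕ) - J₂ + 2 by omega]
  have key := congrArg D.ι (twist_Zp (algebraMap ℂ S (h / 2)) D.hu D.hv D.hs
    (2 * (p.1 : ℕ) - J₁) (2 * (p.2 : ℕ) - J₂))
  rw [mul_assoc, D.twistMatrix_mul_single, ← mul_assoc, ← map_mul, ← key, mul_assoc, add_mul,
    mul_add, e₁, e₂, map_add, map_mul, map_mul, D.map_z₁, D.map_z₂, add_mul, mul_assoc, mul_assoc]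

/-- The deformed `Δ(Z₋)` is intertwined with its undeformed counterpart. -/
theorem deltaZm_mul_twistMatrix :
    D.ι D.s * (leftHom _ _ (opZm J₁) * D.ι ↑(D.v⁻¹ ^ 2) + D.ι ↑(D.u⁻¹ ^ 2) *
      rightHom _ _ (opZm J₂)) * D.ι D.s * twistMatrix h J₁ J₂ =
    twistMatrix h J₁ J₂ * (leftHom _ _ (opZm J₁) + rightHom _ _ (opZm J₂)) := by
  refine ext_mul_single fun p => ?_
  have e₁ : twistMatrix h J₁ J₂ * (leftHom _ _ (opZm J₁) * Matrix.single p p 1) =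
      D.ι (twist D.u D.v D.s (2 * (p.1 : ℕ) - J₁ - 2) (2 * (p.2 : ℕ) - J₂)) *
        (leftHom _ _ (opZm J₁) * Matrix.single p p 1) := by
    refine mul_congr_of_support fun a b hab c => ?_
    obtain ⟨h₁, h₂⟩ := leftHom_mul_single_ne_zero hab
    have h₃ : (a.1 : ℕ) + 1 = p.1 := by
      by_contra hne; exact h₁ (opZm_apply_of_ne hne)
    rw [D.twistMatrix_apply, h₂,
      show (2 * ((a.1 : ℕ) : ℤ) - J₁) = 2 * (p.1 : ℕ) - J₁ - 2 by omega]
  have e₂ : twistMatrix h J₁ J₂ * (rightHom _ _ (opZm J₂) * Matrix.single p p 1) =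
      D.ι (twist D.u D.v D.s (2 * (p.1 : ℕ) - J₁) (2 * (p.2 : ℕ) - J₂ - 2)) *
        (rightHom _ _ (opZm J₂) * Matrix.single p p 1) := by
    refine mul_congr_of_support fun a b hab c => ?_
    obtain ⟨h₁, h₂⟩ := rightHom_mul_single_ne_zero hab
    have h₃ : (a.2 : ℕ) + 1 = p.2 := by
      by_contra hne; exact h₁ (opZm_apply_of_ne hne)
    rw [D.twistMatrix_apply, h₂,
      show (2 * ((a.2 : ℕ) : ℤ) - J₂) = 2 * (p.2 : ℕ) - J₂ - 2 by omega]
  rw [mul_assoc, D.twistMatrix_mul_single, D.tensorSL2.twist_Zm D.hu D.hv D.hs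
    (leftHom_opH_mul_single p) (rightHom_opH_mul_single p), mul_assoc, add_mul, mul_add, e₁, e₂]

/-- Addition formula `cosh (a + b) = cosh a cosh b (1 + tanh a tanh b)`, with `tanh (hX/2) = t Z₊`
on each leg. -/
theorem deltaCosh_eq (D : RaisingModel h J₁ J₂ S) :
    deltaCosh h J₁ J₂ = (coshX h J₁ ⊗ₖ coshX h J₂) * D.ι D.s := by
  have e : ∀ J : ℕ, coshX h J * ((h / 2) • opZp J) =
      (1 / 2 : ℂ) • (expX h J (h / 2) - expX h J (-(h / 2))) := fun J => by
    rw [coshX, smul_mul_assoc, expX_sub_expX_neg]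
  rw [D.map_s, mul_add, mul_one, ← Matrix.mul_kronecker_mul, e, e, deltaCosh, exp_smul_deltaX,
    exp_smul_deltaX, coshX, coshX]
  simp only [Matrix.smul_kronecker, Matrix.kronecker_smul, Matrix.add_kronecker,
    Matrix.kronecker_add, sub_eq_add_neg, ← neg_one_smul ℂ (expX _ _ _)]
  module

theorem commute_map_s (D : RaisingModel h J₁ J₂ S) :
    Commute (D.ι D.s) (coshX h J₁ ⊗ₖ coshX h J₂) := by
  have e : ∀ J : ℕ, Commute ((h / 2) • opZp J) (coshX h J) := fun J =>
    (((commute_expX_opZp h J _).symm.add_right (commute_expX_opZp h J _).symm).smul_right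
      _).smul_left _
  rw [D.map_s]
  refine .add_left (.one_left _) ?_
  rw [Commute, SemiconjBy, ← Matrix.mul_kronecker_mul, ← Matrix.mul_kronecker_mul, (e J₁).eq,
    (e J₂).eq]

/-- On one leg `cosh Y cosh` gives `Z₋`, on the other `cosh e^{±hX} cosh = (cosh e^{±hX/2})²` gives
`v⁻²` or `u⁻²`; the factors `s` come from the addition formula. -/
theorem deltaCosh_mul_deltaY_mul_deltaCosh :
    deltaCosh h J₁ J₂ * deltaY h J₁ J₂ * deltaCosh h J₁ J₂ =
      D.ι D.s * (leftHom _ _ (opZm J₁) * D.ι ↑(D.v⁻¹ ^ 2) + D.ι ↑(D.u⁻¹ ^ 2) *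
        rightHom _ _ (opZm J₂)) * D.ι D.s := by
  have e₁ := coshX_mul_expX_mul_coshX h J₁ (-(h / 2))
  have e₂ := coshX_mul_expX_mul_coshX h J₂ (h / 2)
  rw [← neg_add, add_halves] at e₁
  rw [add_halves] at e₂
  rw [deltaCosh_eq D]
  nth_rw 1 [← (commute_map_s D).eq]
  rw [mul_assoc (D.ι D.s), mul_assoc (D.ι D.s), ← mul_assoc _ _ (D.ι D.s), mul_assoc (D.ι D.s)]
  congr 2
  rw [deltaY, mul_add, add_mul, ← Matrix.mul_kronecker_mul, ← Matrix.mul_kronecker_mul,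
    ← Matrix.mul_kronecker_mul, ← Matrix.mul_kronecker_mul, coshX_mul_opY_mul_coshX,
    coshX_mul_opY_mul_coshX, e₁, e₂, ← leftHom_mul_rightHom, ← leftHom_mul_rightHom, map_pow,
    map_pow, D.leftHom_coshX_mul, D.rightHom_coshX_mul]
  simp only [Units.val_pow_eq_pow_val, map_pow]

end RaisingModel

end Jordanian

namespace Jordanian

open scoped Nat Kronecker

variable {J₁ J₂ : ℕ}

/-! ### Transport of power series along an intertwiner -/

section Intertwine

variable {m n : Type*} [Fintype m] [Fintype n] [DecidableEq m] [DecidableEq n]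
  {A : Matrix m m ℂ} {B : Matrix n n ℂ} {M : Matrix m n ℂ}

theorem pow_mul_of_intertwine (h : A * M = M * B) (k : ℕ) : A ^ k * M = M * B ^ k := by
  induction k with
  | zero => simp
  | succ k ih => rw [pow_succ, Matrix.mul_assoc, h, ← Matrix.mul_assoc, ih, Matrix.mul_assoc,
      ← pow_succ]

theorem artanhSum_mul_of_intertwine (h : A * M = M * B) (t : ℂ) (N : ℕ) :
    artanhSum t N A * M = M * artanhSum t N B := by
  simp only [artanhSum, Matrix.sum_mul, Matrix.mul_sum, Matrix.smul_mul, Matrix.mul_smul,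
    pow_mul_of_intertwine h]

theorem exp_mul_of_intertwine (h : A * M = M * B) {N : ℕ} (hA : A ^ N = 0) (hB : B ^ N = 0) :
    NormedSpace.exp A * M = M * NormedSpace.exp B := by
  rw [exp_eq_sum hA, exp_eq_sum hB]
  simp only [Matrix.sum_mul, Matrix.mul_sum, Matrix.smul_mul, Matrix.mul_smul,
    pow_mul_of_intertwine h]

end Intertwine

/-! ### The coproduct of `X` and the deformed coupled basis -/

section Euler

theorem artanhSum_raises {n : Type*} [Fintype n] [DecidableEq n] {w : n → ℕ} {M : Matrix n n ℂ}
    (hM : Raises w 1 M) (t : ℂ) (N : ℕ) : Raises w 1 (artanhSum t N M) :=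
  Raises.sum fun k _ => ((hM.pow (2 * k + 1)).mono (by simp)).smul _

variable {h : ℂ} {S : Type} [CommRing S] [Algebra ℂ S]

/-- Derivative form of `artanh (t z₁) + artanh (t z₂) = artanh (t w)` with `w = (z₁ + z₂) / s`, the
`G`'s being the derivatives of artanh. -/
theorem artanh_addition_identity {S : Type*} [CommRing S] {T z₁ z₂ s si G₁ G₂ G : S}
    (hs : s = 1 + T ^ 2 * z₁ * z₂) (hsi : s * si = 1) (h₁ : G₁ * (1 - T ^ 2 * z₁ ^ 2) = 1)
    (h₂ : G₂ * (1 - T ^ 2 * z₂ ^ 2) = 1) (h : G * (1 - T ^ 2 * ((z₁ + z₂) * si) ^ 2) = 1) :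
    G₁ * (2 * z₁) + G₂ * (2 * z₂) =
      G * (2 * ((z₁ + z₂) * si) - (z₁ + z₂) * (4 * (T ^ 2 * z₁ * z₂) * si ^ 2)) := by
  -- This is `s² (1 - T² w²) = (1 - T² z₁²) (1 - T² z₂²)`.
  have hG : G = s ^ 2 * G₁ * G₂ := by
    have e : (1 - T ^ 2 * ((z₁ + z₂) * si) ^ 2) * (s ^ 2 * G₁ * G₂) = 1 := by
      have : (1 - T ^ 2 * ((z₁ + z₂) * si) ^ 2) * s ^ 2 =
          (1 - T ^ 2 * z₁ ^ 2) * (1 - T ^ 2 * z₂ ^ 2) := by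
        subst hs; grind
      linear_combination G₁ * G₂ * this + G₂ * (1 - T ^ 2 * z₂ ^ 2) * h₁ + h₂
    linear_combination (s ^ 2 * G₁ * G₂) * h - G * e
  rw [hG]
  have e₁ : s ^ 2 * si = s := by linear_combination s * hsi
  have e₂ : s ^ 2 * si ^ 2 = 1 := by linear_combination (s * si + 1) * hsi
  subst hs
  linear_combination (-2 * G₁ * z₁) * h₂ - 2 * G₂ * z₂ * h₁ - 2 * G₁ * G₂ * (z₁ + z₂) * e₁ +
    4 * G₁ * G₂ * (z₁ + z₂) * T ^ 2 * z₁ * z₂ * e₂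

namespace RaisingModel

theorem map_inv_s_raises (D : RaisingModel h J₁ J₂ S) : Raises wt₂ 0 (D.ι ↑D.s⁻¹) := by
  set x := algebraMap ℂ S (h / 2) ^ 2 * D.z₁ * D.z₂ with hx
  have hxr : Raises wt₂ 1 (D.ι (-x)) := by
    have : D.ι (-x) = -(D.ι D.s - 1) := by rw [D.hs, map_add, map_one, map_neg]; abel
    rw [this, D.map_s, add_sub_cancel_left, ← leftHom_mul_rightHom]
    exact (((opZp_raises.smul _).leftHom.mul (opZp_raises.smul _).rightHom).mono (by norm_num)).neg
  have hN : (-x) ^ (J₁ + J₂ + 1) = 0 := D.inj (by rw [map_pow, hxr.pow_eq_zero wt₂_le, map_zero])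
  have : ((D.s⁻¹ : Sˣ) : S) = ∑ k ∈ Finset.range (J₁ + J₂ + 1), (-x) ^ k := by
    rw [Units.inv_eq_of_mul_eq_one_right]
    rw [D.hs, ← hx, ← sub_neg_eq_add 1 x, mul_neg_geom_sum, hN, sub_zero]
  rw [this, map_sum]
  refine Raises.sum fun k _ => ?_
  rw [map_pow]
  exact (hxr.pow k).mono (by simp)

/-- `Δ(X)` is the `artanh` of the deformed `Δ(Z₊)`. -/
theorem deltaX_eq (D : RaisingModel h J₁ J₂ S) :
    deltaX h J₁ J₂ = artanhSum (h / 2) (J₁ + J₂ + 1) (D.ι ((D.z₁ + D.z₂) * ↑D.s⁻¹)) := by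
  set H := leftHom _ (Fin (J₂ + 1)) (opH J₁) + rightHom (Fin (J₁ + 1)) _ (opH J₂) with hH
  set N := J₁ + J₂ + 1 with hN
  set w := (D.z₁ + D.z₂) * ↑D.s⁻¹ with hw
  have d₁ : EulerDer D.ι H D.z₁ (2 * D.z₁) := by
    unfold EulerDer
    rw [hH, add_mul, D.tensorSL2.h₁, D.tensorSL2.h₂₁.eq, map_mul, map_ofNat, mul_add]; abel
  have d₂ : EulerDer D.ι H D.z₂ (2 * D.z₂) := by
    unfold EulerDer
    rw [hH, add_mul, D.tensorSL2.h₂, D.tensorSL2.h₁₂.eq, map_mul, map_ofNat, mul_add]; abel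
  have ds : EulerDer D.ι H D.s (4 * (algebraMap ℂ S (h / 2) ^ 2 * D.z₁ * D.z₂)) := by
    rw [D.hs]
    convert EulerDer.one.add (((EulerDer.const ((h / 2) ^ 2)).mul d₁).mul d₂) using 1
    · rw [map_pow]
    · rw [map_pow]; ring
  have dw := (d₁.add d₂).mul (ds.inv D.s.mul_inv)
  have hr₁ : Raises wt₂ 1 (D.ι D.z₁) := by rw [D.map_z₁]; exact opZp_raises.leftHom
  have hr₂ : Raises wt₂ 1 (D.ι D.z₂) := by rw [D.map_z₂]; exact opZp_raises.rightHom
  have hrw : Raises wt₂ 1 (D.ι w) := by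
    rw [hw, map_mul, map_add]
    exact (hr₁.add hr₂).mul D.map_inv_s_raises
  have nil : ∀ z, Raises wt₂ 1 (D.ι z) → z ^ N = 0 := fun z hz =>
    D.inj (by rw [map_pow, hz.pow_eq_zero wt₂_le, map_zero])
  have dd := ((d₁.artanhSum (h / 2) N).add (d₂.artanhSum (h / 2) N)).add
    ((dw.artanhSum (h / 2) N).smul (-1))
  have key := artanh_addition_identity D.hs D.s.mul_inv (geomSum_mul (t := h / 2) (nil _ hr₁))
    (geomSum_mul (t := h / 2) (nil _ hr₂)) (geomSum_mul (t := h / 2) (nil _ hrw))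
  have hX : deltaX h J₁ J₂ = D.ι (artanhSum (h / 2) N D.z₁ + artanhSum (h / 2) N D.z₂) := by
    rw [map_add, map_artanhSum, map_artanhSum, D.map_z₁, D.map_z₂, ← map_artanhSum, ← map_artanhSum,
      ← opX_eq_artanhSum (by omega), ← opX_eq_artanhSum (by omega)]
    rfl
  -- The difference of the two sides strictly raises the total weight and has zero Euler derivative,
  -- so rigidity applies.
  have hz : D.ι (artanhSum (h / 2) N D.z₁ + artanhSum (h / 2) N D.z₂ +
      (-1 : ℂ) • artanhSum (h / 2) N w) = 0 := by
    refine Raises.eq_zero_of_commute (w := wt₂) ?_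
      (D := fun p => ((2 * (p.1 : ℤ) - J₁ + (2 * (p.2 : ℤ) - J₂) : ℤ) : ℂ)) ?_ ?_
    · simp only [map_add, map_smul, map_artanhSum]
      exact ((artanhSum_raises hr₁ _ _).add (artanhSum_raises hr₂ _ _)).add
        ((artanhSum_raises hrw _ _).smul _)
    · intro a b hab
      have := Int.cast_injective hab
      simp only [wt₂]; omega
    · have hd : Matrix.diagonal (fun p : Fin (J₁ + 1) × Fin (J₂ + 1) =>
          ((2 * (p.1 : ℤ) - J₁ + (2 * (p.2 : ℤ) - J₂) : ℤ) : ℂ)) = H := by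
        rw [hH, leftHom_opH, rightHom_opH, Matrix.diagonal_add]
        simp only [Int.cast_add]
      rw [hd]
      unfold EulerDer at dd
      rw [Commute, SemiconjBy, dd]
      have : geomSum (h / 2) N D.z₁ * (2 * D.z₁) + geomSum (h / 2) N D.z₂ * (2 * D.z₂) +
        (-1 : ℂ) • (geomSum (h / 2) N w * ((2 * D.z₁ + 2 * D.z₂) * ↑D.s⁻¹ +
          (D.z₁ + D.z₂) * -(4 * (algebraMap ℂ S (h / 2) ^ 2 * D.z₁ * D.z₂) * ↑D.s⁻¹ ^ 2))) = 0 := by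
        rw [key, neg_one_smul]; ring
      rw [this, map_zero, add_zero]
  rw [hX, ← map_artanhSum, ← sub_eq_zero, ← map_sub, ← hz, neg_one_smul, sub_eq_add_neg]

end RaisingModel

theorem deltaX_raises (h : ℂ) : Raises wt₂ 1 (deltaX h J₁ J₂) :=
  (opX_raises h J₁).leftHom.add (opX_raises h J₂).rightHom

/-- The twist turns a coupled basis of the undeformed tensor product into a deformed one. -/
theorem isCoupledBasis_twistMatrix_mul (h : ℂ) {J : ℕ} (hJ : J ≤ J₁ + J₂)
    {C : Matrix (Fin (J₁ + 1) × Fin (J₂ + 1)) (Fin (J + 1)) ℂ}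
    (hH : (leftHom _ _ (opH J₁) + rightHom _ _ (opH J₂)) * C = C * opH J)
    (hP : (leftHom _ _ (opZp J₁) + rightHom _ _ (opZp J₂)) * C = C * opZp J)
    (hM : (leftHom _ _ (opZm J₁) + rightHom _ _ (opZm J₂)) * C = C * opZm J) :
    IsCoupledBasis h J₁ J₂ J (twistMatrix h J₁ J₂ * C) := by
  obtain ⟨S, _, _, ⟨D⟩⟩ := exists_raisingModel h J₁ J₂
  have hX : deltaX h J₁ J₂ * (twistMatrix h J₁ J₂ * C) = twistMatrix h J₁ J₂ * C * opX h J := by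
    rw [D.deltaX_eq, opX_eq_artanhSum (N := J₁ + J₂ + 1) (by omega)]
    refine artanhSum_mul_of_intertwine ?_ _ _
    rw [← Matrix.mul_assoc, D.deltaZp_mul_twistMatrix, Matrix.mul_assoc, hP, Matrix.mul_assoc]
  refine ⟨?_, hX, ?_⟩
  · rw [← Matrix.mul_assoc, D.deltaH_mul_twistMatrix, Matrix.mul_assoc, hH, Matrix.mul_assoc]
  have hexp : ∀ c : ℂ, NormedSpace.exp (c • deltaX h J₁ J₂) * (twistMatrix h J₁ J₂ * C) =
      twistMatrix h J₁ J₂ * C * expX h J c := by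
    intro c
    refine exp_mul_of_intertwine (N := J₁ + J₂ + 1) ?_
      (((deltaX_raises h).smul c).pow_eq_zero wt₂_le)
      (((opX_raises h J).smul c).pow_eq_zero fun a => (wt_le a).trans hJ)
    rw [Matrix.smul_mul, hX, Matrix.mul_smul]
  have hcosh : deltaCosh h J₁ J₂ * (twistMatrix h J₁ J₂ * C) =
      twistMatrix h J₁ J₂ * C * coshX h J := by
    rw [deltaCosh, coshX, Matrix.smul_mul, Matrix.add_mul, hexp, hexp, Matrix.mul_smul,
      Matrix.mul_add]
  have hY : deltaCosh h J₁ J₂ * deltaY h J₁ J₂ * deltaCosh h J₁ J₂ * (twistMatrix h J₁ J₂ * C) =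
      twistMatrix h J₁ J₂ * C * opZm J := by
    rw [D.deltaCosh_mul_deltaY_mul_deltaCosh, ← Matrix.mul_assoc, D.deltaZm_mul_twistMatrix,
      Matrix.mul_assoc, hM, Matrix.mul_assoc]
  -- The inverse is read off from `deltaCosh_eq` and `coshX_mul_expX`; it is needed to strip the
  -- outer cosh from the relation for `Δ(Y)`.
  obtain ⟨K, hK⟩ : ∃ K, K * deltaCosh h J₁ J₂ = 1 := by
    refine ⟨D.ι ↑D.s⁻¹ * ((expX h J₁ (h / 2) * (1 - (h / 2) • opZp J₁)) ⊗ₖ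
      (expX h J₂ (h / 2) * (1 - (h / 2) • opZp J₂))), mul_eq_one_comm.mp ?_⟩
    rw [RaisingModel.deltaCosh_eq D, mul_assoc, ← mul_assoc (D.ι _) (D.ι _), ← map_mul,
      Units.mul_inv, map_one, one_mul, ← Matrix.mul_kronecker_mul, ← mul_assoc, ← mul_assoc,
      coshX_mul_expX, coshX_mul_expX, Matrix.one_kronecker_one]
  set W := twistMatrix h J₁ J₂ * C
  have hY' : deltaCosh h J₁ J₂ * deltaY h J₁ J₂ * deltaCosh h J₁ J₂ * W =
      deltaCosh h J₁ J₂ * (W * (opY h J * coshX h J)) := by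
    rw [hY, ← coshX_mul_opY_mul_coshX h J, ← Matrix.mul_assoc, ← Matrix.mul_assoc, ← hcosh,
      Matrix.mul_assoc, Matrix.mul_assoc]
  have e₁ : deltaY h J₁ J₂ * W * coshX h J = W * opY h J * coshX h J := by
    rw [Matrix.mul_assoc, ← hcosh, Matrix.mul_assoc W,
      ← Matrix.one_mul (W * (opY h J * coshX h J)), ← hK, Matrix.mul_assoc K, ← hY',
      Matrix.mul_assoc _ _ W, Matrix.mul_assoc _ (deltaY h J₁ J₂), ← Matrix.mul_assoc K, hK,
      Matrix.one_mul]
  -- Right multiplication by the inverse of `coshX h J`.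
  have e₂ := congrArg (· * (expX h J (h / 2) * (1 - (h / 2) • opZp J))) e₁
  simpa only [Matrix.mul_assoc _ (coshX h J), ← Matrix.mul_assoc (coshX h J), coshX_mul_expX,
    Matrix.mul_one] using e₂

end Euler

/-! ### Inverse of the twist by antidiagonal transposition -/

section Dagger

variable {m n : Type*} [Fintype m] [Fintype n] [DecidableEq m] [DecidableEq n]

/-- Transposition along the antidiagonal given by the involution `σ`. -/
def dagger (σ : Equiv.Perm n) (M : Matrix n n ℂ) : Matrix n n ℂ := (M.submatrix σ σ).transpose

omit [Fintype n] [DecidableEq n] in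
theorem dagger_apply (σ : Equiv.Perm n) (M : Matrix n n ℂ) (a b : n) :
    dagger σ M a b = M (σ b) (σ a) := rfl

omit [DecidableEq n] in
theorem dagger_mul (σ : Equiv.Perm n) (M N : Matrix n n ℂ) :
    dagger σ (M * N) = dagger σ N * dagger σ M := by
  rw [dagger, ← Matrix.submatrix_mul_equiv M N σ σ σ, Matrix.transpose_mul]; rfl

theorem dagger_pow {σ : Equiv.Perm n} {M : Matrix n n ℂ} (h : dagger σ M = M) (k : ℕ) :
    dagger σ (M ^ k) = M ^ k := by
  induction k with
  | zero => ext a b; simp [dagger_apply, Matrix.one_apply, eq_comm]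
  | succ k ih => rw [pow_succ, dagger_mul, ih, h, ← pow_succ', pow_succ]

theorem dagger_sum_smul_pow {σ : Equiv.Perm n} {M : Matrix n n ℂ} (h : dagger σ M = M)
    (s : Finset ℕ) (c : ℕ → ℂ) (e : ℕ → ℕ) :
    dagger σ (∑ k ∈ s, c k • M ^ e k) = ∑ k ∈ s, c k • M ^ e k := by
  ext a b
  rw [dagger_apply, Matrix.sum_apply, Matrix.sum_apply]
  refine Finset.sum_congr rfl fun k _ => ?_
  have := congrFun (congrFun (dagger_pow h (e k)) a) b
  rw [dagger_apply] at this
  rw [Matrix.smul_apply, Matrix.smul_apply, this]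

/-- Reversal of the basis turns `Z₊` into `Z₋`, and transposition turns it back. So every polynomial
in `Z₊` is fixed by `dagger`, while `H` changes sign. -/
theorem dagger_opZp {J : ℕ} : dagger Fin.revPerm (opZp J) = opZp J := by
  ext a b
  rw [dagger_apply, Fin.revPerm_apply, Fin.revPerm_apply, opZp_rev, opZm_eq_transpose]; rfl

theorem dagger_expX {h : ℂ} {J : ℕ} (c : ℂ) : dagger Fin.revPerm (expX h J c) = expX h J c := by
  have hX : dagger Fin.revPerm (opX h J) = opX h J :=
    dagger_sum_smul_pow dagger_opZp _ _ _
  rw [expX, exp_eq_sum (((opX_raises h J).smul c).pow_eq_zero wt_le)]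
  simp only [smul_pow, smul_smul]
  exact dagger_sum_smul_pow hX _ _ _

theorem dagger_opH {J : ℕ} : dagger Fin.revPerm (opH J) = -opH J := by
  ext a b
  rw [dagger_apply, Fin.revPerm_apply, Fin.revPerm_apply, opH_rev, Matrix.neg_apply]
  congr 1
  rw [opH, ← Matrix.transpose_apply (Matrix.diagonal _), Matrix.diagonal_transpose]

/-- The reversal `(m₁, m₂) ↦ (-m₁, -m₂)`. -/
def revProd (J₁ J₂ : ℕ) : Equiv.Perm (Fin (J₁ + 1) × Fin (J₂ + 1)) :=
  Equiv.prodCongr Fin.revPerm Fin.revPerm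

theorem dagger_kronecker (A : Matrix (Fin (J₁ + 1)) (Fin (J₁ + 1)) ℂ)
    (B : Matrix (Fin (J₂ + 1)) (Fin (J₂ + 1)) ℂ) :
    dagger (revProd J₁ J₂) (A ⊗ₖ B) = dagger Fin.revPerm A ⊗ₖ dagger Fin.revPerm B := rfl

theorem dagger_deltaH (h : ℂ) : dagger (revProd J₁ J₂) (deltaH h J₁ J₂) = -deltaH h J₁ J₂ := by
  have : dagger (revProd J₁ J₂) (deltaH h J₁ J₂) =
      dagger (revProd J₁ J₂) (opH J₁ ⊗ₖ expX h J₂ h) +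
        dagger (revProd J₁ J₂) (expX h J₁ (-h) ⊗ₖ opH J₂) := rfl
  rw [this, dagger_kronecker, dagger_kronecker, dagger_expX, dagger_expX, dagger_opH, dagger_opH,
    deltaH, neg_add]
  ext a b
  simp [Matrix.kroneckerMap_apply]

/-- The diagonal entries are `a_{0,0} = 1`, and `a_{k,l}` vanishes as soon as `k` or `l` is
negative. -/
theorem twistMatrix_sub_one_raises (h : ℂ) : Raises wt₂ 1 (twistMatrix h J₁ J₂ - 1) := by
  intro a p hap
  by_contra hlt
  refine hap ?_
  rw [Matrix.sub_apply, twistMatrix, Matrix.of_apply]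
  by_cases hp : a = p
  · subst hp
    have := coeffB_natCast (mag a.1) (mag a.2) 0 0
    rw [Matrix.one_apply_eq, sub_self, sub_self, coeffA, coeffB_of_neg_left _ _ (k := 0 - 1) (by norm_num),
      div_self (mul_pos (alpha_pos _) (alpha_pos _)).ne']
    simp only [Nat.cast_zero, risingBinom_zero, mul_one] at this
    simp [this]
  · rw [Matrix.one_apply_ne hp, sub_zero]
    have : (a.1 : ℕ) < p.1 ∨ (a.2 : ℕ) < p.2 := by
      by_contra hh
      have h1 : (a.1 : ℕ) = p.1 := by simp only [wt₂] at hlt; omega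
      have h2 : (a.2 : ℕ) = p.2 := by simp only [wt₂] at hlt; omega
      exact hp (Prod.ext (Fin.ext h1) (Fin.ext h2))
    rw [coeffA]
    rcases this with h' | h'
    · rw [coeffB_of_neg_left _ _ (by omega), coeffB_of_neg_left _ _ (by omega)]; simp
    · rw [coeffB_of_neg_right _ _ (by omega), coeffB_of_neg_right _ _ (by omega)]; simp

theorem wt₂_revProd (a : Fin (J₁ + 1) × Fin (J₂ + 1)) : wt₂ (revProd J₁ J₂ a) + wt₂ a = J₁ + J₂ := by
  have h1 := a.1.is_lt
  have h2 := a.2.is_lt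
  simp only [wt₂, revProd, Equiv.prodCongr_apply, Prod.map_fst, Prod.map_snd, Fin.revPerm_apply,
    Fin.val_rev]
  omega

/-- The inverse of the twist is its transpose along the antidiagonal. -/
theorem dagger_twistMatrix_mul (h : ℂ) :
    dagger (revProd J₁ J₂) (twistMatrix h J₁ J₂) * twistMatrix h J₁ J₂ = 1 := by
  obtain ⟨S, _, _, ⟨D⟩⟩ := exists_raisingModel h J₁ J₂
  set U := twistMatrix h J₁ J₂ with hU
  set H := leftHom _ (Fin (J₂ + 1)) (opH J₁) + rightHom (Fin (J₁ + 1)) _ (opH J₂) with hH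
  have hU₁ : deltaH h J₁ J₂ * U = U * H := D.deltaH_mul_twistMatrix
  have hHd : H = Matrix.diagonal (fun p : Fin (J₁ + 1) × Fin (J₂ + 1) =>
      ((2 * (p.1 : ℤ) - J₁ + (2 * (p.2 : ℤ) - J₂) : ℤ) : ℂ)) := by
    rw [hH, leftHom_opH, rightHom_opH, Matrix.diagonal_add]
    simp only [Int.cast_add]
  have hHdag : dagger (revProd J₁ J₂) H = -H := by
    have : dagger (revProd J₁ J₂) H = dagger (revProd J₁ J₂) (opH J₁ ⊗ₖ 1) +
        dagger (revProd J₁ J₂) (1 ⊗ₖ opH J₂) := rfl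
    have h1 : ∀ J : ℕ, dagger Fin.revPerm (1 : Matrix (Fin (J + 1)) (Fin (J + 1)) ℂ) = 1 :=
      fun J => by simpa using dagger_pow (dagger_opZp (J := J)) 0
    rw [this, dagger_kronecker, dagger_kronecker, h1, h1, dagger_opH, dagger_opH, hH, leftHom_apply,
      rightHom_apply, neg_add]
    ext a b
    simp [Matrix.kroneckerMap_apply]
  -- `dagger` reverses products and negates both `Δ(H)` and `H`; the two signs cancel.
  have hU₂ : H * dagger (revProd J₁ J₂) U = dagger (revProd J₁ J₂) U * deltaH h J₁ J₂ := by
    have := congrArg (dagger (revProd J₁ J₂)) hU₁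
    rw [dagger_mul, dagger_mul, dagger_deltaH, hHdag, mul_neg, neg_mul, neg_inj] at this
    exact this.symm
  have hr : Raises wt₂ 1 (dagger (revProd J₁ J₂) U - 1) := by
    intro a b hab
    have := twistMatrix_sub_one_raises (J₁ := J₁) (J₂ := J₂) h (revProd J₁ J₂ b) (revProd J₁ J₂ a)
      (by
        rw [Matrix.sub_apply, dagger_apply] at hab
        rw [Matrix.sub_apply, ← hU]
        convert hab using 2
        simp [Matrix.one_apply, eq_comm])
    have h1 := wt₂_revProd a
    have h2 := wt₂_revProd b
    omega
  -- `U† U` is unipotent for the total weight and commutes with `H`, which separates total weights.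
  refine sub_eq_zero.mp ((hr.mul_sub_one (twistMatrix_sub_one_raises h)).eq_zero_of_commute
    (D := fun p => ((2 * (p.1 : ℤ) - J₁ + (2 * (p.2 : ℤ) - J₂) : ℤ) : ℂ)) ?_ ?_)
  · intro a b hab
    have := Int.cast_injective hab
    simp only [wt₂]; omega
  · rw [← hHd]
    refine .sub_right ?_ (.one_right _)
    rw [Commute, SemiconjBy, ← mul_assoc, hU₂, mul_assoc, hU₁, mul_assoc]

end Dagger

end Jordanian

/-! ### Racah's sum: recurrence, symmetry and boundary values -/

namespace Jordanian

open scoped Nat Kronecker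

/-- `1 / n!`, with the convention `1 / n! = 0` for `n < 0`. -/
noncomputable def invFact (n : ℤ) : ℝ := if 0 ≤ n then ((n.toNat ! : ℕ) : ℝ)⁻¹ else 0

theorem invFact_of_neg {n : ℤ} (h : n < 0) : invFact n = 0 := if_neg (by omega)

theorem invFact_natCast (n : ℕ) : invFact n = ((n ! : ℕ) : ℝ)⁻¹ := by simp [invFact]

theorem mul_invFact (n : ℤ) : (n : ℝ) * invFact n = invFact (n - 1) := by
  rcases lt_trichotomy n 0 with h | rfl | h
  · rw [invFact_of_neg h, invFact_of_neg (by omega), mul_zero]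
  · rw [invFact_of_neg (n := 0 - 1) (by norm_num)]; simp
  · obtain ⟨m, rfl⟩ : ∃ m : ℕ, n = (m + 1 : ℕ) := ⟨(n - 1).toNat, by omega⟩
    rw [show (((m + 1 : ℕ) : ℤ) - 1) = (m : ℕ) by push_cast; ring, invFact_natCast, invFact_natCast,
      Nat.factorial_succ]
    have h1 : ((m : ℝ) + 1) ≠ 0 := by positivity
    have h2 : ((m ! : ℕ) : ℝ) ≠ 0 := by exact_mod_cast m.factorial_ne_zero
    push_cast
    field_simp

/-- The summand of the sum in Racah's formula. -/
noncomputable def racahTerm (J₁ J₂ r x y k : ℤ) : ℝ :=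
  invFact k * invFact (r - k) * invFact (J₁ - x - k) * invFact (y - k) * invFact (x + k - r) *
    invFact (J₂ - y + k - r)

/-- The sum in Racah's formula. -/
noncomputable def racahSum (J₁ J₂ : ℤ) (r : ℕ) (x y : ℤ) : ℝ :=
  ∑ k ∈ Finset.range (r + 1), (-1) ^ k * racahTerm J₁ J₂ r x y k

/-- The recurrence expressing `Z₊` in the coupled basis, proved by creative telescoping. Integer
arguments and the convention for `invFact` spare all boundary cases. -/
theorem racahSum_succ (J₁ J₂ : ℤ) (r : ℕ) (x y : ℤ) :
    ((J₁ - x + 1 : ℤ) : ℝ) * racahSum J₁ J₂ r (x - 1) y +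
      ((J₂ - y + 1 : ℤ) : ℝ) * racahSum J₁ J₂ r x (y - 1) =
        ((x + y - r : ℤ) : ℝ) * racahSum J₁ J₂ r x y := by
  -- The telescoping certificate; it vanishes at `k = 0` through `1 / (k - 1)!` and at `k = r + 1`
  -- through `1 / (r - k)!`.
  set B : ℕ → ℝ := fun k => (-1) ^ k * (invFact (k - 1) * invFact (r - k) *
    invFact (J₁ - x + 1 - k) * invFact (y - k) * invFact (x - 1 + k - r) *
      invFact (J₂ - y + k - r)) with hB
  have hterm : ∀ k : ℕ, ((J₁ - x + 1 : ℤ) : ℝ) * racahTerm J₁ J₂ r (x - 1) y k +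
      ((J₂ - y + 1 : ℤ) : ℝ) * racahTerm J₁ J₂ r x (y - 1) k =
      ((x + y - r : ℤ) : ℝ) * racahTerm J₁ J₂ r x y k + (-1) ^ k * (B k - B (k + 1)) := by
    intro k
    have e₁ := mul_invFact (J₁ - x + 1 - k)
    have e₂ := mul_invFact (k : ℤ)
    have e₃ := mul_invFact (x + k - r)
    have e₄ := mul_invFact (J₂ - y + 1 + k - r)
    have e₅ := mul_invFact (r - k)
    have e₆ := mul_invFact (y - k)
    have hs : ((-1 : ℝ)) ^ k * (-1) ^ k = 1 := by rw [← mul_pow]; simp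
    simp only [hB, racahTerm]
    rw [show J₁ - (x - 1) - k = J₁ - x + 1 - k by ring, show x - 1 + k - r = x + k - r - 1 by ring,
      show J₂ - (y - 1) + k - r = J₂ - y + 1 + k - r by ring, show y - 1 - (k : ℤ) = y - k - 1 by ring,
      show J₁ - x - k = J₁ - x + 1 - k - 1 by ring,
      show J₂ - y + k - r = J₂ - y + 1 + k - r - 1 by ring]
    rw [show ((k + 1 : ℕ) : ℤ) - 1 = k by push_cast; ring,
      show (r : ℤ) - ((k + 1 : ℕ) : ℤ) = r - k - 1 by push_cast; ring,
      show J₁ - x + 1 - ((k + 1 : ℕ) : ℤ) = J₁ - x + 1 - k - 1 by push_cast; ring,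
      show y - ((k + 1 : ℕ) : ℤ) = y - k - 1 by push_cast; ring,
      show x - 1 + ((k + 1 : ℕ) : ℤ) - r = x + k - r by push_cast; ring,
      show J₂ - y + ((k + 1 : ℕ) : ℤ) - r = J₂ - y + 1 + k - r by push_cast; ring]
    have hp : ∀ u v : ℝ, (-1) ^ k * ((-1) ^ k * u - (-1) ^ (k + 1) * v) = u + v := fun u v => by
      rw [pow_succ]; linear_combination (u + v) * hs
    rw [hp]
    simp only [← e₁, ← e₂, ← e₃, ← e₄, ← e₅, ← e₆]
    push_cast
    ring
  have hsum : ∑ k ∈ Finset.range (r + 1), (B k - B (k + 1)) = 0 := by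
    rw [Finset.sum_range_sub']
    have h0 : B 0 = 0 := by
      simp only [hB]
      rw [invFact_of_neg (n := ((0 : ℕ) : ℤ) - 1) (by norm_num)]; simp
    have h1 : B (r + 1) = 0 := by
      simp only [hB]
      rw [invFact_of_neg (n := (r : ℤ) - ((r + 1 : ℕ) : ℤ)) (by push_cast; omega)]; simp
    rw [h0, h1, sub_zero]
  simp only [racahSum, Finset.mul_sum]
  rw [← Finset.sum_add_distrib, ← add_zero (∑ k ∈ _, ((x + y - r : ℤ) : ℝ) * _), ← hsum,
    ← Finset.sum_add_distrib]
  refine Finset.sum_congr rfl fun k _ => ?_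
  have hs : ((-1 : ℝ)) ^ k * (-1) ^ k = 1 := by rw [← mul_pow]; simp
  linear_combination (-1) ^ k * hterm k + (B k - B (k + 1)) * hs

/-- The substitution `k ↦ r - k` permutes the six factorials and contributes `(-1)^r`. -/
theorem racahSum_reflect (J₁ J₂ : ℤ) (r : ℕ) (x y : ℤ) :
    racahSum J₁ J₂ r (J₁ - x) (J₂ - y) = (-1) ^ r * racahSum J₁ J₂ r x y := by
  unfold racahSum
  rw [← Finset.sum_range_reflect, Finset.mul_sum]
  refine Finset.sum_congr rfl fun k hk => ?_
  have hk' : k ≤ r := by have := Finset.mem_range.mp hk; omega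
  rw [show r + 1 - 1 - k = r - k by omega]
  have hs : (-1 : ℝ) ^ (r - k) = (-1) ^ r * (-1) ^ k := by
    have : (-1 : ℝ) ^ r = (-1) ^ (r - k) * (-1) ^ k := by rw [← pow_add, Nat.sub_add_cancel hk']
    rw [this, mul_assoc, ← mul_pow]; simp
  rw [hs, mul_assoc, racahTerm, racahTerm, Nat.cast_sub hk',
    show (r : ℤ) - (r - k) = k by ring, show J₁ - (J₁ - x) - ((r : ℤ) - k) = x + k - r by ring,
    show J₂ - y - ((r : ℤ) - k) = J₂ - y + k - r by ring, show J₁ - x + ((r : ℤ) - k) - r = J₁ - x - k by ring,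
    show J₂ - (J₂ - y) + ((r : ℤ) - k) - r = y - k by ring]
  ring

theorem racahSum_eq_zero {J₁ J₂ : ℤ} {r : ℕ} {x y : ℤ}
    (h : ∀ k : ℕ, k ≤ r → y - k < 0 ∨ x + k - r < 0 ∨ J₁ - x - k < 0 ∨ J₂ - y + k - r < 0) :
    racahSum J₁ J₂ r x y = 0 := by
  refine Finset.sum_eq_zero fun k hk => ?_
  rw [racahTerm]
  rcases h k (by have := Finset.mem_range.mp hk; omega) with h | h | h | h <;>
  simp [invFact_of_neg h]

/-- `√(i! (J - i)!)` -/
noncomputable def sqrtFact {J : ℕ} (i : Fin (J + 1)) : ℝ := Real.sqrt (((i : ℕ)! * (J - i)! : ℕ) : ℝ)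

theorem sqrtFact_rev {J : ℕ} (i : Fin (J + 1)) : sqrtFact i.rev = sqrtFact i := by
  have := i.is_lt
  rw [sqrtFact, sqrtFact, Fin.val_rev, show J + 1 - ((i : ℕ) + 1) = J - i by omega,
    show J - (J - (i : ℕ)) = i by omega, mul_comm]

/-- Rescaling the basis by `sqrtFact` removes the square roots, leaving integer matrix elements for
`Z₊`. -/
theorem opZp_mul_sqrtFact {J : ℕ} {a i : Fin (J + 1)} (h : (a : ℕ) = i + 1) :
    opZp J a i * (sqrtFact i : ℂ) = ((J : ℂ) - i) * sqrtFact a := by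
  obtain ⟨c, hc⟩ : ∃ c, J = i + 1 + c := ⟨J - (i + 1), by omega⟩
  have e₁ : J - (i : ℕ) = c + 1 := by omega
  have e₂ : J - ((i : ℕ) + 1) = c := by omega
  have e₃ : (J : ℝ) - i = c + 1 := by
    have := congrArg (Nat.cast (R := ℝ)) hc
    push_cast at this
    linear_combination this
  have e₄ : (J : ℂ) - i = ((c + 1 : ℝ) : ℂ) := by rw [← e₃]; push_cast; rfl
  rw [opZp, Matrix.of_apply, if_pos h, sqrtFact, sqrtFact, h, e₁, e₂, e₃, e₄, ← Complex.ofReal_mul,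
    ← Complex.ofReal_mul, ← Real.sqrt_mul (by positivity)]
  congr 1
  rw [Real.sqrt_eq_iff_mul_self_eq (by positivity) (by positivity), mul_mul_mul_comm,
    Real.mul_self_sqrt (by positivity), Nat.factorial_succ, Nat.factorial_succ]
  push_cast
  ring

theorem sqrtFact_mul_opZp {J : ℕ} {a i : Fin (J + 1)} (h : (a : ℕ) = i + 1) :
    (sqrtFact a : ℂ) * opZp J a i = ((i : ℂ) + 1) * sqrtFact i := by
  obtain ⟨c, hc⟩ : ∃ c, J = i + 1 + c := ⟨J - (i + 1), by omega⟩
  have e₁ : J - (i : ℕ) = c + 1 := by omega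
  have e₂ : J - ((i : ℕ) + 1) = c := by omega
  have e₃ : (J : ℝ) - i = c + 1 := by
    have := congrArg (Nat.cast (R := ℝ)) hc
    push_cast at this
    linear_combination this
  have e₄ : (i : ℂ) + 1 = ((i + 1 : ℝ) : ℂ) := by push_cast; rfl
  rw [opZp, Matrix.of_apply, if_pos h, sqrtFact, sqrtFact, h, e₁, e₂, e₃, e₄, ← Complex.ofReal_mul,
    ← Complex.ofReal_mul, ← Real.sqrt_mul (by positivity)]
  congr 1
  rw [Real.sqrt_eq_iff_mul_self_eq (by positivity) (by positivity), mul_mul_mul_comm,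
    Real.mul_self_sqrt (by positivity), Nat.factorial_succ, Nat.factorial_succ]
  push_cast
  ring

/-- At `n = 0` the left side is empty while the coefficient on the right is `J + 1`, whence the
condition on `g (-1)`. -/
theorem sum_opZp_mul_sqrtFact {J : ℕ} (n : Fin (J + 1)) (g : ℤ → ℂ) (hg : g (-1) = 0) :
    ∑ a, opZp J n a * ((sqrtFact a : ℂ) * g (a : ℕ)) =
      sqrtFact n * (((J - n + 1 : ℤ) : ℂ) * g ((n : ℕ) - 1)) := by
  rcases Nat.eq_zero_or_pos (n : ℕ) with h0 | h0
  · rw [Finset.sum_eq_zero, h0]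
    · simp [hg]
    · intro b _
      rw [opZp_apply_of_ne (by omega), zero_mul]
  · have hn : (n : ℕ) = (n - 1 : ℕ) + 1 := by omega
    rw [Finset.sum_eq_single ⟨n - 1, by omega⟩]
    · rw [← mul_assoc, opZp_mul_sqrtFact (by simpa using hn)]
      obtain ⟨c, hc⟩ : ∃ c, (n : ℕ) = c + 1 := ⟨_, hn⟩
      simp only [hc, Nat.add_sub_cancel]
      push_cast
      rw [add_sub_cancel_right]
      ring
    · intro b _ hb
      rw [opZp_apply_of_ne, zero_mul]
      intro h
      exact hb (Fin.ext (by simp only; omega))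
    · simp

theorem sum_sqrtFact_mul_opZp {J : ℕ} (i : Fin (J + 1)) (g : ℤ → ℂ) (hg : g (J + 1) = 0) :
    ∑ a, ((sqrtFact a : ℂ) * g (a : ℕ)) * opZp J a i =
      sqrtFact i * (((i : ℂ) + 1) * g ((i : ℕ) + 1)) := by
  by_cases h0 : (i : ℕ) = J
  · rw [Finset.sum_eq_zero, h0]
    · simp [hg]
    · intro b _
      rw [opZp_apply_of_ne (by omega), mul_zero]
  · rw [Finset.sum_eq_single ⟨i + 1, by omega⟩]
    · rw [mul_right_comm, sqrtFact_mul_opZp rfl]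
      push_cast
      ring
    · intro b _ hb
      rw [opZp_apply_of_ne, mul_zero]
      intro h
      exact hb (Fin.ext h)
    · simp

/-- Coefficient of `x^r` in `(1 - x)^-(A+1) (1 - x)^-(B+1) = (1 - x)^-(A+B+2)`. -/
theorem sum_choose_mul_choose (A B r : ℕ) :
    ∑ p ∈ Finset.HasAntidiagonal.antidiagonal r, (A + p.1).choose A * (B + p.2).choose B =
      (A + B + 1 + r).choose (A + B + 1) := by
  have h := congrArg (fun u : (PowerSeries ℤ)ˣ => PowerSeries.coeff r (u : PowerSeries ℤ))
    (PowerSeries.invOneSubPow_add ℤ (A + 1) (B + 1))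
  simp only [Units.val_mul, PowerSeries.coeff_mul] at h
  rw [PowerSeries.invOneSubPow_val_succ_eq_mk_add_choose,
    PowerSeries.invOneSubPow_val_succ_eq_mk_add_choose,
    show A + 1 + (B + 1) = (A + B + 1) + 1 by ring,
    PowerSeries.invOneSubPow_val_succ_eq_mk_add_choose] at h
  simp only [PowerSeries.coeff_mk] at h
  exact_mod_cast h.symm

end Jordanian

/-! ### The `su(2)` coefficients form a coupled basis -/

namespace Jordanian

open scoped Nat Kronecker

/-- Subtraction-free coordinates: `A = j + j₁ - j₂`, `B = j + j₂ - j₁`, `r = j₁ + j₂ - j`. -/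
theorem exists_of_mem_coupledSpins {J₁ J₂ J : ℕ} (hJ : J ∈ coupledSpins J₁ J₂) :
    ∃ A B r : ℕ, J₁ = A + r ∧ J₂ = B + r ∧ J = A + B := by
  simp only [coupledSpins, Finset.mem_filter, Finset.mem_Icc, Nat.dist] at hJ
  obtain ⟨⟨h1, h2⟩, c, hc⟩ := hJ
  exact ⟨J₁ - (c - J), J₂ - (c - J), c - J, by omega, by omega, by omega⟩

theorem add_mem_coupledSpins (A B r : ℕ) : A + B ∈ coupledSpins (A + r) (B + r) := by
  simp only [coupledSpins, Finset.mem_filter, Finset.mem_Icc, Nat.dist]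
  exact ⟨by omega, A + B + r, by ring⟩

theorem defect_add (A B r : ℕ) : defect (A + r) (B + r) (A + B) = r := by
  rw [defect]; omega

theorem mag_add_mag_eq_iff {A B r : ℕ} {i₁ : Fin (A + r + 1)} {i₂ : Fin (B + r + 1)}
    {i : Fin (A + B + 1)} :
    mag i₁ + mag i₂ = mag i ↔ (i₁ : ℤ) + (i₂ : ℤ) = i + r := by
  rw [← @Int.cast_inj ℚ, mag, mag, mag]
  push_cast
  constructor <;> intro h <;> linear_combination h

/-- The sum in Racah's formula, restricted to indices of matching weights. -/
noncomputable def racahDelta (J₁ J₂ : ℤ) (r : ℕ) (x y z : ℤ) : ℝ :=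
  if x + y = z + r then racahSum J₁ J₂ r x y else 0

/-- The normalisation factor of Racah's formula. -/
noncomputable def racahNorm (A B r : ℕ) : ℝ :=
  Real.sqrt ((((A + B + 1) * A ! * B ! * r ! : ℕ) : ℝ) / ((A + B + r + 1)! : ℝ))

/-- The range conditions on `k` are exactly those under which no factorial argument is negative, so
`invFact` absorbs them. -/
theorem su2CG_eq (A B r : ℕ) (i₁ : Fin (A + r + 1)) (i₂ : Fin (B + r + 1)) (i : Fin (A + B + 1)) :
    su2CG (A + r) (B + r) (A + B) i₁ i₂ i =
      racahNorm A B r * (sqrtFact i * sqrtFact i₁ * sqrtFact i₂) *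
        racahDelta (A + r : ℕ) (B + r : ℕ) r i₁ i₂ i := by
  have h₁ := i₁.is_lt
  have h₂ := i₂.is_lt
  simp only [su2CG, defect_add, mag_add_mag_eq_iff, racahDelta]
  split_ifs with h
  · congr 1
    · congr 1
      · rw [racahNorm]
        simp only [Nat.add_sub_cancel]
        rw [show A + r + (B + r) - r + 1 = A + B + r + 1 by omega]
      · rw [sqrtFact, sqrtFact, sqrtFact, ← Real.sqrt_mul (by positivity),
          ← Real.sqrt_mul (by positivity)]
        congr 1
        push_cast
        ring
    · rw [Finset.sum_filter, racahSum]
      refine Finset.sum_congr rfl fun k hk => ?_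
      have hk' := Finset.mem_range.mp hk
      split_ifs with hc
      · rw [racahTerm, show (r : ℤ) - k = (r - k : ℕ) by omega,
          show ((A + r : ℕ) : ℤ) - (i₁ : ℕ) - k = (A + r - i₁ - k : ℕ) by omega,
          show ((i₂ : ℕ) : ℤ) - k = (i₂ - k : ℕ) by omega,
          show ((i₁ : ℕ) : ℤ) + k - r = (i₁ + k - r : ℕ) by omega,
          show ((B + r : ℕ) : ℤ) - (i₂ : ℕ) + k - r = (B + r - i₂ + k - r : ℕ) by omega]
        simp only [invFact_natCast]
        push_cast
        rw [div_eq_mul_inv]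
        simp only [mul_inv]
      · rw [racahTerm]
        have : ((i₂ : ℕ) : ℤ) - k < 0 ∨ ((i₁ : ℕ) : ℤ) + k - r < 0 ∨
          ((A + r : ℕ) : ℤ) - (i₁ : ℕ) - k < 0 ∨
          ((B + r : ℕ) : ℤ) - (i₂ : ℕ) + k - r < 0 := by omega
        rcases this with h | h | h | h <;> rw [invFact_of_neg h] <;> simp
  · rw [mul_zero]

/-- The `su(2)` Clebsch–Gordan coefficients of a fixed total spin, as a matrix. -/
noncomputable def su2Matrix (J₁ J₂ J : ℕ) :
    Matrix (Fin (J₁ + 1) × Fin (J₂ + 1)) (Fin (J + 1)) ℂ :=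
  Matrix.of fun p i => (su2CG J₁ J₂ J p.1 p.2 i : ℂ)

theorem su2Matrix_apply (A B r : ℕ) (p : Fin (A + r + 1) × Fin (B + r + 1)) (i : Fin (A + B + 1)) :
    su2Matrix (A + r) (B + r) (A + B) p i =
      racahNorm A B r * (sqrtFact i * sqrtFact p.1 * sqrtFact p.2) *
        racahDelta (A + r : ℕ) (B + r : ℕ) r p.1 p.2 i := by
  rw [su2Matrix, Matrix.of_apply, su2CG_eq]
  push_cast
  rfl

theorem opH_mul_su2Matrix {J₁ J₂ J : ℕ} (hJ : J ∈ coupledSpins J₁ J₂) :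
    (leftHom _ _ (opH J₁) + rightHom _ _ (opH J₂)) * su2Matrix J₁ J₂ J =
      su2Matrix J₁ J₂ J * opH J := by
  obtain ⟨A, B, r, rfl, rfl, rfl⟩ := exists_of_mem_coupledSpins hJ
  rw [leftHom_opH, rightHom_opH, opH_eq, Matrix.diagonal_add]
  ext p i
  rw [Matrix.diagonal_mul, Matrix.mul_diagonal, su2Matrix_apply, racahDelta]
  split_ifs with h
  · have h' : (((p.1 : ℤ) + (p.2 : ℤ) : ℤ) : ℂ) = ((i + r : ℤ) : ℂ) := by rw [h]
    push_cast at h' ⊢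
    linear_combination 2 * (racahNorm A B r * (sqrtFact i * sqrtFact p.1 * sqrtFact p.2) *
        racahSum (A + r) (B + r) r p.1 p.2 : ℂ) * h'
  · simp

/-- Once the normalisation and the `sqrtFact` factors are pulled out, only `racahSum_succ` is left.
-/
theorem opZp_mul_su2Matrix {J₁ J₂ J : ℕ} (hJ : J ∈ coupledSpins J₁ J₂) :
    (leftHom _ _ (opZp J₁) + rightHom _ _ (opZp J₂)) * su2Matrix J₁ J₂ J =
      su2Matrix J₁ J₂ J * opZp J := by
  obtain ⟨A, B, r, rfl, rfl, rfl⟩ := exists_of_mem_coupledSpins hJ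
  ext ⟨x, y⟩ i
  -- The boundary values `x = -1`, `y = -1` and `z = J + 1` all give a zero Racah sum: in every term
  -- some factorial argument is negative.
  have hl := sum_opZp_mul_sqrtFact x
    (fun u => (racahDelta (A + r : ℕ) (B + r : ℕ) r u y i : ℂ)) (by
      rw [racahDelta, racahSum_eq_zero, ite_self, Complex.ofReal_zero]
      intro k hk
      omega)
  have hr := sum_opZp_mul_sqrtFact y
    (fun u => (racahDelta (A + r : ℕ) (B + r : ℕ) r x u i : ℂ)) (by
      rw [racahDelta, racahSum_eq_zero, ite_self, Complex.ofReal_zero]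
      intro k hk
      omega)
  have hm := sum_sqrtFact_mul_opZp i
    (fun z => (racahDelta (A + r : ℕ) (B + r : ℕ) r x y z : ℂ)) (by
      rw [racahDelta]
      split_ifs with h
      · rw [racahSum_eq_zero, Complex.ofReal_zero]
        intro k hk
        push_cast at h ⊢
        omega
      · simp)
  have key : ((((A + r : ℕ) : ℤ) - (x : ℕ) + 1 : ℤ) : ℝ) *
        racahDelta (A + r : ℕ) (B + r : ℕ) r ((x : ℕ) - 1) y i +
      ((((B + r : ℕ) : ℤ) - (y : ℕ) + 1 : ℤ) : ℝ) *
        racahDelta (A + r : ℕ) (B + r : ℕ) r x ((y : ℕ) - 1) i =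
      ((i : ℝ) + 1) * racahDelta (A + r : ℕ) (B + r : ℕ) r x y ((i : ℕ) + 1) := by
    simp only [racahDelta]
    by_cases h : ((x : ℕ) : ℤ) + (y : ℕ) = (i : ℕ) + 1 + r
    · rw [if_pos (by omega), if_pos (by omega), if_pos h, racahSum_succ, h]
      push_cast
      ring
    · rw [if_neg (by omega), if_neg (by omega), if_neg h]
      simp
  have key' := congrArg (fun t : ℝ => (t : ℂ)) key
  have e₁ : (leftHom (Fin (A + r + 1)) (Fin (B + r + 1)) (opZp (A + r)) * su2Matrix (A + r) (B + r) (A + B)) (x, y) i =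
      (racahNorm A B r * sqrtFact i * sqrtFact y) * ∑ a, opZp (A + r) x a * ((sqrtFact a : ℂ) *
        (racahDelta (A + r : ℕ) (B + r : ℕ) r a y i : ℂ)) := by
    rw [Matrix.mul_apply, Fintype.sum_prod_type, Finset.mul_sum]
    refine Finset.sum_congr rfl fun a _ => ?_
    rw [Finset.sum_eq_single y]
    · rw [leftHom_apply, su2Matrix_apply]
      simp only [Matrix.kroneckerMap_apply, Matrix.one_apply_eq]
      ring
    · intro b _ hb
      rw [leftHom_apply]
      simp [Matrix.one_apply_ne hb.symm]
    · simp
  have e₂ : (rightHom (Fin (A + r + 1)) (Fin (B + r + 1)) (opZp (B + r)) * su2Matrix (A + r) (B + r) (A + B)) (x, y) i =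
      (racahNorm A B r * sqrtFact i * sqrtFact x) * ∑ a, opZp (B + r) y a * ((sqrtFact a : ℂ) *
        (racahDelta (A + r : ℕ) (B + r : ℕ) r x a i : ℂ)) := by
    rw [Matrix.mul_apply, Fintype.sum_prod_type_right, Finset.mul_sum]
    refine Finset.sum_congr rfl fun a _ => ?_
    rw [Finset.sum_eq_single x]
    · rw [rightHom_apply, su2Matrix_apply]
      simp only [Matrix.kroneckerMap_apply, Matrix.one_apply_eq]
      ring
    · intro b _ hb
      rw [rightHom_apply]
      simp [Matrix.one_apply_ne hb.symm]
    · simp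
  have e₃ : (su2Matrix (A + r) (B + r) (A + B) * opZp (A + B)) (x, y) i =
      (racahNorm A B r * sqrtFact x * sqrtFact y) * ∑ a, ((sqrtFact a : ℂ) *
        (racahDelta (A + r : ℕ) (B + r : ℕ) r x y a : ℂ)) * opZp (A + B) a i := by
    rw [Matrix.mul_apply, Finset.mul_sum]
    refine Finset.sum_congr rfl fun a _ => ?_
    rw [su2Matrix_apply]
    ring
  rw [Matrix.add_mul, Matrix.add_apply, e₁, e₂, e₃, hl, hr, hm]
  push_cast at key' ⊢
  linear_combination (racahNorm A B r * sqrtFact i * sqrtFact x * sqrtFact y : ℂ) * key'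

theorem su2CG_rev {J₁ J₂ J : ℕ} (hJ : J ∈ coupledSpins J₁ J₂) (i₁ : Fin (J₁ + 1))
    (i₂ : Fin (J₂ + 1)) (i : Fin (J + 1)) :
    su2CG J₁ J₂ J i₁.rev i₂.rev i.rev = (-1) ^ defect J₁ J₂ J * su2CG J₁ J₂ J i₁ i₂ i := by
  obtain ⟨A, B, r, rfl, rfl, rfl⟩ := exists_of_mem_coupledSpins hJ
  have h := i.is_lt
  have h₁ := i₁.is_lt
  have h₂ := i₂.is_lt
  rw [su2CG_eq, su2CG_eq, sqrtFact_rev, sqrtFact_rev, sqrtFact_rev, defect_add, racahDelta,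
    racahDelta, Fin.val_rev, Fin.val_rev, Fin.val_rev,
    show ((A + r + 1 - ((i₁ : ℕ) + 1) : ℕ) : ℤ) = (A + r : ℕ) - (i₁ : ℕ) by omega,
    show ((B + r + 1 - ((i₂ : ℕ) + 1) : ℕ) : ℤ) = (B + r : ℕ) - (i₂ : ℕ) by omega]
  by_cases hc : ((i₁ : ℕ) : ℤ) + (i₂ : ℕ) = (i : ℕ) + r
  · rw [if_pos (by omega), if_pos hc, racahSum_reflect]
    ring
  · rw [if_neg (by omega), if_neg hc]
    simp

theorem su2Matrix_submatrix_rev {J₁ J₂ J : ℕ} (hJ : J ∈ coupledSpins J₁ J₂) :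
    (su2Matrix J₁ J₂ J).submatrix (revProd J₁ J₂) Fin.revPerm =
      (-1 : ℂ) ^ defect J₁ J₂ J • su2Matrix J₁ J₂ J := by
  ext p i
  have := su2CG_rev hJ p.1 p.2 i
  simp only [su2Matrix, Matrix.submatrix_apply, Matrix.of_apply, Matrix.smul_apply, revProd,
    Equiv.prodCongr_apply, Prod.map, Fin.revPerm_apply, this]
  push_cast
  rfl

/-- Reversal `m ↦ -m` exchanges `Z₊` and `Z₋` and multiplies the coefficients by a sign, which
cancels. -/
theorem opZm_mul_su2Matrix {J₁ J₂ J : ℕ} (hJ : J ∈ coupledSpins J₁ J₂) :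
    (leftHom _ _ (opZm J₁) + rightHom _ _ (opZm J₂)) * su2Matrix J₁ J₂ J =
      su2Matrix J₁ J₂ J * opZm J := by
  have h := congrArg (fun M => M.submatrix (revProd J₁ J₂) (Fin.revPerm (n := J + 1)))
    (opZp_mul_su2Matrix hJ)
  rw [← Matrix.submatrix_mul_equiv _ _ _ (revProd J₁ J₂),
    ← Matrix.submatrix_mul_equiv _ _ _ (Fin.revPerm (n := J + 1)), su2Matrix_submatrix_rev hJ,
    Matrix.mul_smul, Matrix.smul_mul] at h
  have hu : ((-1 : ℂ) ^ defect J₁ J₂ J) ≠ 0 := pow_ne_zero _ (by norm_num)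
  have h' := smul_right_injective _ hu h
  have e₁ : (opZp J).submatrix (Fin.revPerm (n := J + 1)) (Fin.revPerm (n := J + 1)) = opZm J := by
    ext a b
    simp only [Matrix.submatrix_apply, Fin.revPerm_apply, opZp_rev]
  have e₂ : (leftHom _ _ (opZp J₁) + rightHom _ _ (opZp J₂)).submatrix (revProd J₁ J₂)
      (revProd J₁ J₂) = leftHom _ _ (opZm J₁) + rightHom _ _ (opZm J₂) := by
    ext ⟨a, a'⟩ ⟨b, b'⟩
    simp only [Matrix.submatrix_apply, Matrix.add_apply, leftHom_apply, rightHom_apply, revProd,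
      Equiv.prodCongr_apply, Prod.map, Fin.revPerm_apply, Matrix.kroneckerMap_apply, opZp_rev,
      Matrix.one_apply, Fin.rev_inj]
  rw [e₁, e₂] at h'
  exact h'

end Jordanian

/-! ### Orthonormality of the `su(2)` coefficients -/

namespace Jordanian

open scoped Nat Kronecker

theorem leftHom_transpose {m n : Type*} [Fintype m] [Fintype n] [DecidableEq m] [DecidableEq n]
    (M : Matrix m m ℂ) : (leftHom m n M).transpose = leftHom m n M.transpose := by
  ext ⟨a, a'⟩ ⟨b, b'⟩
  simp [leftHom_apply, Matrix.one_apply, eq_comm]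

theorem rightHom_transpose {m n : Type*} [Fintype m] [Fintype n] [DecidableEq m] [DecidableEq n]
    (M : Matrix n n ℂ) : (rightHom m n M).transpose = rightHom m n M.transpose := by
  ext ⟨a, a'⟩ ⟨b, b'⟩
  simp [rightHom_apply, Matrix.one_apply, eq_comm]

theorem opH_transpose (J : ℕ) : (opH J).transpose = opH J := Matrix.diagonal_transpose _

/-- The matrix of inner products of the coupled bases with total spins `J` and `J'`. -/
noncomputable def gram (J₁ J₂ J J' : ℕ) : Matrix (Fin (J + 1)) (Fin (J' + 1)) ℂ :=
  (su2Matrix J₁ J₂ J).transpose * su2Matrix J₁ J₂ J'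

theorem mul_gram {J₁ J₂ J J' : ℕ} {A A' : Matrix (Fin (J + 1)) (Fin (J + 1)) ℂ}
    {B : Matrix (Fin (J' + 1)) (Fin (J' + 1)) ℂ}
    {T T' : Matrix (Fin (J₁ + 1) × Fin (J₂ + 1)) (Fin (J₁ + 1) × Fin (J₂ + 1)) ℂ}
    (hA : T * su2Matrix J₁ J₂ J = su2Matrix J₁ J₂ J * A)
    (hB : T' * su2Matrix J₁ J₂ J' = su2Matrix J₁ J₂ J' * B) (hT : T.transpose = T')
    (hA' : A.transpose = A') : A' * gram J₁ J₂ J J' = gram J₁ J₂ J J' * B := by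
  rw [gram, Matrix.mul_assoc, ← hB, ← hT, ← Matrix.mul_assoc, ← Matrix.mul_assoc, ← hA',
    ← Matrix.transpose_mul, ← Matrix.transpose_mul, hA]

variable {J₁ J₂ J J' : ℕ}

theorem opH_mul_gram (hJ : J ∈ coupledSpins J₁ J₂) (hJ' : J' ∈ coupledSpins J₁ J₂) :
    opH J * gram J₁ J₂ J J' = gram J₁ J₂ J J' * opH J' :=
  mul_gram (opH_mul_su2Matrix hJ) (opH_mul_su2Matrix hJ')
    (by rw [Matrix.transpose_add, leftHom_transpose, rightHom_transpose, opH_transpose,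
      opH_transpose]) (opH_transpose J)

theorem opZm_mul_gram (hJ : J ∈ coupledSpins J₁ J₂) (hJ' : J' ∈ coupledSpins J₁ J₂) :
    opZm J * gram J₁ J₂ J J' = gram J₁ J₂ J J' * opZm J' :=
  mul_gram (opZp_mul_su2Matrix hJ) (opZm_mul_su2Matrix hJ')
    (by rw [Matrix.transpose_add, leftHom_transpose, rightHom_transpose, opZm_eq_transpose,
      opZm_eq_transpose]) opZm_eq_transpose.symm

theorem opZp_mul_gram (hJ : J ∈ coupledSpins J₁ J₂) (hJ' : J' ∈ coupledSpins J₁ J₂) :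
    opZp J * gram J₁ J₂ J J' = gram J₁ J₂ J J' * opZp J' :=
  mul_gram (opZm_mul_su2Matrix hJ) (opZp_mul_su2Matrix hJ')
    (by rw [Matrix.transpose_add, leftHom_transpose, rightHom_transpose, opZm_eq_transpose,
      opZm_eq_transpose, Matrix.transpose_transpose, Matrix.transpose_transpose])
    (by rw [opZm_eq_transpose, Matrix.transpose_transpose])

/-- Schur's lemma by eigenvalues: a nonzero entry forces equal eigenvalues of `H` and of `Z₋ Z₊`,
and these determine both the spin and `m`. -/
theorem gram_eq_zero (hJ : J ∈ coupledSpins J₁ J₂) (hJ' : J' ∈ coupledSpins J₁ J₂)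
    {a : Fin (J + 1)} {b : Fin (J' + 1)} (hab : ¬ (J = J' ∧ (a : ℕ) = b)) :
    gram J₁ J₂ J J' a b = 0 := by
  by_contra hne
  have ha := a.is_lt
  have hb := b.is_lt
  have h₁ := congrFun (congrFun (opH_mul_gram hJ hJ') a) b
  rw [opH_eq, opH_eq, Matrix.diagonal_mul, Matrix.mul_diagonal, mul_comm] at h₁
  have h₁' : 2 * (a : ℤ) - J = 2 * (b : ℤ) - J' := by exact_mod_cast mul_left_cancel₀ hne h₁
  have hc : opZm J * opZp J * gram J₁ J₂ J J' = gram J₁ J₂ J J' * (opZm J' * opZp J') := by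
    rw [Matrix.mul_assoc, opZp_mul_gram hJ hJ', ← Matrix.mul_assoc, opZm_mul_gram hJ hJ',
      Matrix.mul_assoc]
  have h₂ := congrFun (congrFun hc a) b
  rw [Matrix.mul_apply, Matrix.mul_apply, Finset.sum_eq_single a, Finset.sum_eq_single b,
    opZm_mul_opZp_apply, opZm_mul_opZp_apply, if_pos rfl, if_pos rfl, mul_comm] at h₂
  · have h₃ := mul_left_cancel₀ hne h₂
    have h₄ : ((J : ℤ) - a) * (a + 1) = ((J' : ℤ) - b) * (b + 1) := by
      have h₅ : ((((J : ℤ) - a) * (a + 1) : ℤ) : ℂ) = (((J' : ℤ) - b) * (b + 1) : ℤ) := by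
        push_cast
        exact h₃
      exact_mod_cast h₅
    -- Equal weights give `J' = J + 2 (b - a)`. The second factor is positive since `a ≤ J`.
    have h₆ : ((b : ℤ) - a) * ((J : ℤ) + 1 + (b - a)) = 0 := by
      have : (J' : ℤ) = 2 * b - 2 * a + J := by omega
      rw [this] at h₄
      linear_combination -h₄
    rcases mul_eq_zero.mp h₆ with h | h
    · exact hab (by omega)
    · omega
  · intro c _ hc
    rw [opZm_mul_opZp_apply, if_neg hc, mul_zero]
  · simp
  · intro c _ hc
    rw [opZm_mul_opZp_apply, if_neg hc.symm, zero_mul]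
  · simp

theorem sqrtFact_mul_self {J : ℕ} (i : Fin (J + 1)) :
    sqrtFact i * sqrtFact i = (i : ℕ)! * (J - i)! := by
  rw [sqrtFact, Real.mul_self_sqrt (by positivity)]
  push_cast
  rfl

/-- At `m = j` the arguments `b - k` and `k - b` both occur, so only `k = b` survives. -/
theorem racahSum_top (A B a b : ℕ) :
    racahSum (A + (a + b) : ℕ) (B + (a + b) : ℕ) (a + b) (A + a : ℕ) (B + b : ℕ) =
      (-1) ^ b * ((b ! : ℝ) * a ! * B ! * A !)⁻¹ := by
  rw [racahSum, Finset.sum_eq_single b]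
  · rw [racahTerm, show ((a + b : ℕ) : ℤ) - b = a by push_cast; ring,
      show ((A + (a + b) : ℕ) : ℤ) - (A + a : ℕ) - b = (0 : ℕ) by push_cast; ring,
      show ((B + b : ℕ) : ℤ) - b = B by push_cast; ring,
      show ((A + a : ℕ) : ℤ) + b - (a + b : ℕ) = A by push_cast; ring,
      show ((B + (a + b) : ℕ) : ℤ) - (B + b : ℕ) + b - (a + b : ℕ) = (0 : ℕ) by push_cast; ring]
    simp only [invFact_natCast, mul_inv]
    simp
  · intro k _ hk
    rw [racahTerm]
    rcases lt_or_gt_of_ne hk with h | h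
    · rw [invFact_of_neg (n := ((B + (a + b) : ℕ) : ℤ) - (B + b : ℕ) + k - (a + b : ℕ))
        (by push_cast; omega)]
      simp
    · rw [invFact_of_neg (n := ((A + (a + b) : ℕ) : ℤ) - (A + a : ℕ) - k) (by push_cast; omega)]
      simp
  · intro h
    exact absurd (Finset.mem_range.mpr (by omega)) h

theorem su2CG_top_sq (A B : ℕ) {a b r : ℕ} (hr : a + b = r) {x : Fin (A + r + 1)}
    {y : Fin (B + r + 1)} (hx : (x : ℕ) = A + a) (hy : (y : ℕ) = B + b) :
    su2CG (A + r) (B + r) (A + B) x y (Fin.last _) ^ 2 =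
      ((A + a).choose A * (B + b).choose B : ℕ) / (A + B + 1 + r).choose (A + B + 1) := by
  subst hr
  have e₁ := sqrtFact_mul_self x
  have e₂ := sqrtFact_mul_self y
  have e₃ := sqrtFact_mul_self (Fin.last (A + B))
  have e₄ : racahNorm A B (a + b) ^ 2 = ((((A + B + 1) * A ! * B ! * (a + b)! : ℕ) : ℝ) /
      ((A + B + (a + b) + 1)! : ℝ)) := Real.sq_sqrt (by positivity)
  rw [hx, show A + (a + b) - (A + a) = b by omega] at e₁
  rw [hy, show B + (a + b) - (B + b) = a by omega] at e₂
  rw [Fin.val_last, Nat.sub_self] at e₃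
  have hs : ((-1 : ℝ) ^ b) ^ 2 = 1 := by rw [← pow_mul, mul_comm, pow_mul]; simp
  have hfac : ∀ n : ℕ, ((n ! : ℕ) : ℝ) ≠ 0 := fun n => by exact_mod_cast n.factorial_ne_zero
  have c₁ : (((A + a).choose A : ℕ) : ℝ) = (A + a)! / (A ! * a !) := by
    rw [Nat.cast_add_choose]
  have c₂ : (((B + b).choose B : ℕ) : ℝ) = (B + b)! / (B ! * b !) := by
    rw [Nat.cast_add_choose]
  have c₃ : (((A + B + 1 + (a + b)).choose (A + B + 1) : ℕ) : ℝ) =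
      (A + B + (a + b) + 1)! / ((A + B + 1 : ℕ) * (A + B)! * (a + b)!) := by
    rw [Nat.cast_add_choose, show A + B + 1 + (a + b) = A + B + (a + b) + 1 by ring,
      Nat.factorial_succ (A + B)]
    push_cast
    rfl
  rw [su2CG_eq, racahDelta, if_pos (by rw [hx, hy, Fin.val_last]; push_cast; ring), hx, hy,
    racahSum_top]
  calc _ = racahNorm A B (a + b) ^ 2 * ((sqrtFact (Fin.last (A + B)) * sqrtFact (Fin.last (A + B))) *
        (sqrtFact x * sqrtFact x) * (sqrtFact y * sqrtFact y)) * (((-1 : ℝ) ^ b) ^ 2 *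
          (((b ! : ℝ) * a ! * B ! * A !)⁻¹) ^ 2) := by ring
    _ = _ := by
      rw [e₁, e₂, e₃, e₄, hs, Nat.cast_mul ((A + a).choose A), c₁, c₂, c₃]
      have := hfac (A + B + (a + b) + 1)
      have := hfac (A + B)
      have := hfac (a + b)
      have := hfac a
      have := hfac b
      have := hfac A
      have := hfac B
      push_cast at *
      simp only [Nat.factorial_zero, Nat.cast_one]
      field_simp

/-- The nonzero terms are indexed by `a + b = r`, and their numerators add up by Vandermonde's
identity. -/
theorem sum_su2CG_top_sq (A B r : ℕ) :
    ∑ p : Fin (A + r + 1) × Fin (B + r + 1),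
      su2CG (A + r) (B + r) (A + B) p.1 p.2 (Fin.last _) ^ 2 = 1 := by
  have hpos : (((A + B + 1 + r).choose (A + B + 1) : ℕ) : ℝ) ≠ 0 := by
    exact_mod_cast (Nat.choose_pos (by omega)).ne'
  have h := congrArg (Nat.cast (R := ℝ)) (sum_choose_mul_choose A B r)
  rw [← div_self hpos]
  nth_rewrite 1 [← h]
  rw [Nat.cast_sum, Finset.sum_div]
  symm
  refine Finset.sum_bij_ne_zero (fun q hq _ =>
      ((⟨A + q.1, by have := Finset.HasAntidiagonal.mem_antidiagonal.mp hq; omega⟩,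
        ⟨B + q.2, by have := Finset.HasAntidiagonal.mem_antidiagonal.mp hq; omega⟩) :
        Fin (A + r + 1) × Fin (B + r + 1))) ?_ ?_ ?_ ?_
  · intros; exact Finset.mem_univ _
  · intro q _ _ q' _ _ he
    simp only [Prod.mk.injEq, Fin.mk.injEq] at he
    exact Prod.ext (by omega) (by omega)
  · rintro ⟨x, y⟩ _ hne
    have hxy : (x : ℤ) + (y : ℤ) = (A + B : ℕ) + (r : ℤ) := by
      by_contra hc
      apply hne
      rw [su2CG_eq, racahDelta, if_neg (by rw [Fin.val_last]; exact hc)]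
      simp
    have hx := x.is_lt
    have hy := y.is_lt
    have hq : ((x : ℕ) - A) + ((y : ℕ) - B) = r := by omega
    refine ⟨(x - A, y - B), Finset.HasAntidiagonal.mem_antidiagonal.mpr hq, ?_,
      Prod.ext (Fin.ext (by simp only; omega)) (Fin.ext (by simp only; omega))⟩
    rw [← su2CG_top_sq A B hq (x := x) (y := y) (by omega) (by omega)]
    exact hne
  · intro q hq _
    exact (su2CG_top_sq A B (Finset.HasAntidiagonal.mem_antidiagonal.mp hq) rfl rfl).symm

theorem gram_last (hJ : J ∈ coupledSpins J₁ J₂) :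
    gram J₁ J₂ J J (Fin.last J) (Fin.last J) = 1 := by
  obtain ⟨A, B, r, rfl, rfl, rfl⟩ := exists_of_mem_coupledSpins hJ
  rw [gram, Matrix.mul_apply, ← Complex.ofReal_one, ← sum_su2CG_top_sq A B r, Complex.ofReal_sum]
  refine Finset.sum_congr rfl fun p _ => ?_
  rw [Matrix.transpose_apply, su2Matrix, Matrix.of_apply, Complex.ofReal_pow, sq]

/-- The Gram matrix commutes with `Z₊`, whose subdiagonal entries are nonzero, so all its diagonal
entries equal the last one. -/
theorem gram_diag (hJ : J ∈ coupledSpins J₁ J₂) (i : Fin (J + 1)) : gram J₁ J₂ J J i i = 1 := by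
  induction i using Fin.reverseInduction with
  | last => exact gram_last hJ
  | cast i ih =>
    have h := congrFun (congrFun (opZp_mul_gram hJ hJ) i.succ) i.castSucc
    rw [Matrix.mul_apply, Matrix.mul_apply, Finset.sum_eq_single i.castSucc,
      Finset.sum_eq_single i.succ, ih, one_mul] at h
    · refine mul_left_cancel₀ (a := opZp J i.succ i.castSucc) ?_ (by rw [h, mul_one])
      rw [opZp, Matrix.of_apply, if_pos (by simp), Complex.ofReal_ne_zero]
      refine (Real.sqrt_pos.mpr (mul_pos ?_ (by positivity))).ne'
      rw [sub_pos]
      exact_mod_cast i.is_lt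
    · intro b _ hb
      rw [gram_eq_zero hJ hJ, zero_mul]
      exact fun hc => hb (Fin.ext hc.2).symm
    · simp
    · intro b _ hb
      rw [gram_eq_zero hJ hJ, mul_zero]
      exact fun hc => hb (Fin.ext hc.2)
    · simp

theorem gram_apply (hJ : J ∈ coupledSpins J₁ J₂) (hJ' : J' ∈ coupledSpins J₁ J₂)
    (a : Fin (J + 1)) (b : Fin (J' + 1)) :
    gram J₁ J₂ J J' a b = if J = J' ∧ (a : ℕ) = b then 1 else 0 := by
  split_ifs with h
  · obtain ⟨rfl, h⟩ := h
    rw [Fin.ext h, gram_diag hJ]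
  · exact gram_eq_zero hJ hJ' h

end Jordanian

/-! ### Assembly: the Clebsch–Gordan matrix and its inverse -/

namespace Jordanian

variable (h : ℂ) (J₁ J₂ : ℕ)

theorem CG_eq (J : ℕ) (n₁ : Fin (J₁ + 1)) (n₂ : Fin (J₂ + 1)) (m : Fin (J + 1)) :
    CG h J₁ J₂ J n₁ n₂ m = (twistMatrix h J₁ J₂ * su2Matrix J₁ J₂ J) (n₁, n₂) m := by
  rw [CG, Matrix.mul_apply, Finset.sum_filter]
  refine Finset.sum_congr rfl fun p _ => ?_
  split_ifs with hp
  · rw [su2Matrix, Matrix.of_apply, twistMatrix, Matrix.of_apply, mul_comm]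
  · simp [su2Matrix, su2CG, hp]

/-- All the `su(2)` Clebsch–Gordan coefficients, with columns indexed by `(j, m)`. -/
noncomputable def su2FullMatrix : Matrix (Fin (J₁ + 1) × Fin (J₂ + 1)) (CoupledIndex J₁ J₂) ℂ :=
  Matrix.of fun p s => su2Matrix J₁ J₂ s.1.1 p s.2

theorem su2FullMatrix_transpose_mul :
    (su2FullMatrix J₁ J₂).transpose * su2FullMatrix J₁ J₂ = 1 := by
  ext ⟨⟨J, hJ⟩, a⟩ ⟨⟨J', hJ'⟩, b⟩
  have hg := gram_apply hJ hJ' a b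
  have hgram : ((su2FullMatrix J₁ J₂).transpose * su2FullMatrix J₁ J₂) ⟨⟨J, hJ⟩, a⟩ ⟨⟨J', hJ'⟩, b⟩ =
      gram J₁ J₂ J J' a b := rfl
  rw [hgram, hg, Matrix.one_apply]
  congr 1
  rw [eq_iff_iff]
  constructor
  · rintro ⟨rfl, hab⟩
    rw [Fin.ext hab]
  · intro he
    obtain ⟨h₁, h₂⟩ := Sigma.mk.inj_iff.mp he
    obtain rfl := Subtype.mk.inj h₁
    exact ⟨rfl, congrArg Fin.val (eq_of_heq h₂)⟩

theorem CGMatrix_eq : CGMatrix h J₁ J₂ = (twistMatrix h J₁ J₂ * su2FullMatrix J₁ J₂).transpose := by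
  ext s n
  exact CG_eq h J₁ J₂ s.1.1 n.1 n.2 s.2

/-- Reversing all indices of the `su(2)` factor yields the sign `(-1)^(j₁+j₂-j)`, which cancels the
prescribed one; the reversed twist is `(U†)ᵀ`. -/
theorem CGSkewTranspose_eq : CGSkewTranspose h J₁ J₂ =
    (dagger (revProd J₁ J₂) (twistMatrix h J₁ J₂)).transpose * su2FullMatrix J₁ J₂ := by
  ext n ⟨⟨J, hJ⟩, m⟩
  rw [CGSkewTranspose, Matrix.of_apply, CG_eq, Matrix.mul_apply, Matrix.mul_apply, Finset.mul_sum,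
    ← Equiv.sum_comp (revProd J₁ J₂)]
  refine Finset.sum_congr rfl fun p _ => ?_
  have hr := congrFun (congrFun (su2Matrix_submatrix_rev hJ) p) m
  rw [Matrix.submatrix_apply, Matrix.smul_apply, Fin.revPerm_apply, smul_eq_mul] at hr
  have hs : ((-1 : ℂ) ^ defect J₁ J₂ J) * (-1) ^ defect J₁ J₂ J = 1 := by rw [← mul_pow]; simp
  rw [hr, Matrix.transpose_apply, dagger_apply]
  have e : revProd J₁ J₂ n = (n.1.rev, n.2.rev) := rfl
  rw [e, su2FullMatrix, Matrix.of_apply]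
  linear_combination (twistMatrix h J₁ J₂ (n.1.rev, n.2.rev) (revProd J₁ J₂ p) *
    su2Matrix J₁ J₂ J p m) * hs

theorem CGMatrix_mul_CGSkewTranspose : CGMatrix h J₁ J₂ * CGSkewTranspose h J₁ J₂ = 1 := by
  rw [CGMatrix_eq, CGSkewTranspose_eq, Matrix.transpose_mul, Matrix.mul_assoc,
    ← Matrix.mul_assoc (twistMatrix h J₁ J₂).transpose, ← Matrix.transpose_mul,
    dagger_twistMatrix_mul, Matrix.transpose_one, Matrix.one_mul, su2FullMatrix_transpose_mul]

theorem sum_coupledSpins {M : Type*} [AddCommMonoid M] (f : ℕ → M) :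
    ∑ J ∈ coupledSpins J₁ J₂, f J =
      ∑ r ∈ Finset.range (min J₁ J₂ + 1), f (J₁ + J₂ - 2 * r) := by
  symm
  refine Finset.sum_bij (fun r _ => J₁ + J₂ - 2 * r) ?_ ?_ ?_ fun _ _ => rfl
  · intro r hr
    have := Finset.mem_range.mp hr
    obtain ⟨A, rfl⟩ : ∃ A, J₁ = A + r := ⟨J₁ - r, by omega⟩
    obtain ⟨B, rfl⟩ : ∃ B, J₂ = B + r := ⟨J₂ - r, by omega⟩
    rw [show A + r + (B + r) - 2 * r = A + B by omega]
    exact add_mem_coupledSpins A B r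
  · intro r hr r' hr' he
    have := Finset.mem_range.mp hr
    have := Finset.mem_range.mp hr'
    omega
  · intro J hJ
    obtain ⟨A, B, r, rfl, rfl, rfl⟩ := exists_of_mem_coupledSpins hJ
    exact ⟨r, Finset.mem_range.mpr (by omega), by omega⟩

theorem card_coupledIndex :
    Fintype.card (CoupledIndex J₁ J₂) = Fintype.card (Fin (J₁ + 1) × Fin (J₂ + 1)) := by
  -- Partial sums of the dimensions `2j + 1`, listed from `j = j₁ + j₂` downwards; `n = min J₁ J₂ +
  -- 1` gives `(J₁ + 1) (J₂ + 1)`.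
  have hsum : ∀ n : ℕ, n ≤ min J₁ J₂ + 1 →
      ∑ r ∈ Finset.range n, (((J₁ + J₂ - 2 * r + 1 : ℕ)) : ℤ) = n * (J₁ + J₂ - n + 2) := by
    intro n hn
    induction n with
    | zero => simp
    | succ n ih =>
      rw [Finset.sum_range_succ, ih (by omega),
        show ((J₁ + J₂ - 2 * n + 1 : ℕ) : ℤ) = J₁ + J₂ - 2 * n + 1 by omega]
      push_cast
      ring
  rw [Fintype.card_sigma, Fintype.card_prod]
  simp only [Fintype.card_fin]
  rw [Finset.sum_coe_sort (coupledSpins J₁ J₂) (fun J => J + 1), sum_coupledSpins]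
  have h := hsum _ le_rfl
  rw [← @Nat.cast_inj ℤ, Nat.cast_sum, h]
  rcases le_total J₁ J₂ with hle | hle
  · rw [min_eq_left hle]; push_cast; ring
  · rw [min_eq_right hle]; push_cast; ring

theorem CGSkewTranspose_mul_CGMatrix : CGSkewTranspose h J₁ J₂ * CGMatrix h J₁ J₂ = 1 :=
  (Matrix.mul_eq_one_comm_of_card_eq _ _ _ (card_coupledIndex J₁ J₂)).mp
    (CGMatrix_mul_CGSkewTranspose h J₁ J₂)

end Jordanian

theorem proposition7 (J₁ J₂ : ℕ) (h : ℂ) :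
    -- the coefficients are Clebsch-Gordan coefficients of the tensor product representation
    (∀ J ∈ Jordanian.coupledSpins J₁ J₂,
      Jordanian.IsCoupledBasis h J₁ J₂ J
        (Matrix.of fun n m => Jordanian.CG h J₁ J₂ J n.1 n.2 m)) ∧
    -- first skew-orthogonality relation
    (∀ J ∈ Jordanian.coupledSpins J₁ J₂, ∀ J' ∈ Jordanian.coupledSpins J₁ J₂,
      ∀ (m : Fin (J + 1)) (m' : Fin (J' + 1)),
        ∑ n₁ : Fin (J₁ + 1), ∑ n₂ : Fin (J₂ + 1),
          (-1 : ℂ) ^ Jordanian.defect J₁ J₂ J * Jordanian.CG h J₁ J₂ J n₁ n₂ m *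
            Jordanian.CG h J₁ J₂ J' n₁.rev n₂.rev m'.rev =
        if J = J' ∧ Jordanian.mag m = Jordanian.mag m' then 1 else 0) ∧
    -- second skew-orthogonality relation
    (∀ (n₁ n₁' : Fin (J₁ + 1)) (n₂ n₂' : Fin (J₂ + 1)),
        ∑ J ∈ Jordanian.coupledSpins J₁ J₂, ∑ m : Fin (J + 1),
          (-1 : ℂ) ^ Jordanian.defect J₁ J₂ J * Jordanian.CG h J₁ J₂ J n₁ n₂ m *
            Jordanian.CG h J₁ J₂ J n₁'.rev n₂'.rev m.rev =
        if n₁ = n₁' ∧ n₂ = n₂' then 1 else 0) ∧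
    -- the signed skew-transpose is the two-sided inverse of the Clebsch-Gordan matrix
    Jordanian.CGMatrix h J₁ J₂ * Jordanian.CGSkewTranspose h J₁ J₂ = 1 ∧
    Jordanian.CGSkewTranspose h J₁ J₂ * Jordanian.CGMatrix h J₁ J₂ = 1 := by
  open Jordanian in
  refine ⟨fun J hJ => ?_, fun J hJ J' hJ' m m' => ?_, fun n₁ n₁' n₂ n₂' => ?_,
    CGMatrix_mul_CGSkewTranspose h J₁ J₂, CGSkewTranspose_mul_CGMatrix h J₁ J₂⟩
  · have hle : J ≤ J₁ + J₂ := by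
      obtain ⟨A, B, r, rfl, rfl, rfl⟩ := exists_of_mem_coupledSpins hJ
      omega
    have e : (Matrix.of fun n m => CG h J₁ J₂ J n.1 n.2 m) =
        twistMatrix h J₁ J₂ * su2Matrix J₁ J₂ J := by
      ext n m
      exact CG_eq h J₁ J₂ J n.1 n.2 m
    rw [e]
    exact isCoupledBasis_twistMatrix_mul h hle (opH_mul_su2Matrix hJ) (opZp_mul_su2Matrix hJ)
      (opZm_mul_su2Matrix hJ)
  · have hc := congrFun (congrFun (CGMatrix_mul_CGSkewTranspose h J₁ J₂) ⟨⟨J, hJ⟩, m⟩)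
      ⟨⟨J', hJ'⟩, m'⟩
    have hg := congrFun (congrFun (su2FullMatrix_transpose_mul J₁ J₂) ⟨⟨J, hJ⟩, m⟩)
      ⟨⟨J', hJ'⟩, m'⟩
    have hgram : gram J₁ J₂ J J' m m' = _ := hg
    rw [← hgram, gram_apply hJ hJ', Matrix.mul_apply, Fintype.sum_prod_type] at hc
    have hmag : (J = J' ∧ mag m = mag m') ↔ (J = J' ∧ (m : ℕ) = m') := by
      refine and_congr_right fun hJJ => ?_
      subst hJJ
      simp [mag]
    simp only [hmag]
    split_ifs at hc ⊢ with hd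
    · obtain ⟨rfl, -⟩ := hd
      refine Eq.trans (Finset.sum_congr rfl fun x _ => Finset.sum_congr rfl fun y _ => ?_) hc
      simp only [CGMatrix, CGSkewTranspose, Matrix.of_apply]
      ring
    -- The matrix product carries the sign of `J'`, the stated sum that of `J`. They agree for `J =
    -- J'`; here the value is zero, so the signs can be exchanged freely.
    · have hs : (-1 : ℂ) ^ defect J₁ J₂ J' * (-1) ^ defect J₁ J₂ J' = 1 := by rw [← mul_pow]; simp
      rw [← mul_zero ((-1 : ℂ) ^ defect J₁ J₂ J * (-1) ^ defect J₁ J₂ J'), ← hc, Finset.mul_sum]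
      refine Finset.sum_congr rfl fun x _ => ?_
      rw [Finset.mul_sum]
      refine Finset.sum_congr rfl fun y _ => ?_
      simp only [CGMatrix, CGSkewTranspose, Matrix.of_apply]
      linear_combination -((-1 : ℂ) ^ defect J₁ J₂ J * CG h J₁ J₂ J x y m *
        CG h J₁ J₂ J' x.rev y.rev m'.rev) * hs
  -- The reversed factor carries the primed indices and is the left one in the product, so the entry
  -- is taken in row `n'` and column `n`.
  · have hc := congrFun (congrFun (CGSkewTranspose_mul_CGMatrix h J₁ J₂) (n₁', n₂')) (n₁, n₂)
    rw [Matrix.mul_apply, Fintype.sum_sigma, Matrix.one_apply] at hc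
    simp only [Prod.mk.injEq] at hc
    simp only [eq_comm (a := n₁), eq_comm (a := n₂)]
    rw [← hc, ← Finset.sum_coe_sort (coupledSpins J₁ J₂)]
    refine Finset.sum_congr rfl fun J _ => Finset.sum_congr rfl fun m _ => ?_
    simp only [CGMatrix, CGSkewTranspose, Matrix.of_apply]
    ring
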